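/- Consider the three families of affine curves $E_{\underline g}=\{F(x,y,\underline g)=0\}\subset\mathbb C^2$ with parameter $\underline g=(g_s,g_l)\in\mathbb C^2$, where $$\begin{aligned} F_{A_2}&=y^2-(4x^3-g_sx-g_l),\\ F_{B_2}&=y^2-(x^4-g_sx^2+g_l+g_s^2/8),\\ F_{G_2}&=x(y^2-x^2)+g_s(3x^2+y^2)-g_l-2g_s^3 , \end{aligned}$$ with discriminants $\Delta_{A_2}=g_s^3-27g_l^2$, $\Delta_{B_2}=(8g_l+g_s^2)(-8g_l+g_s^2)^2$, $\Delta_{G_2}=(g_l+2g_s^3)(-g_l+2g_s^3)^3$; put $N=1,2,3$ for type $A_2,B_2,G_2$. For $\Delta(\underline g)\neq0$ the curve is completed to a smooth elliptic curve $\overline E_{\underline g}$ by $N$ points at infinity; $\infty_1$ denotes the one through which the real curve passes in the direction $x\to+\infty$, $y\to-\infty$ (so $x\to\infty$ at $\infty_1$ and, moreover, $y/x^2\to-1$ for $B_2$ and $y/x\to-1$ for $G_2$). Let $\zeta_F=\mathrm{Res}[dx\,dy/F]=dx/(\partial F/\partial y)=-dy/(\partial F/\partial x)$, a holomorphic 1-form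 on $\overline E_{\underline g}$. Let $\Gamma$ be the totally real component of the set of real parameters with $\Delta\ne0$: $g_s>0$ and $27g_l^2<g_s^3$, $|8g_l|<g_s^2$, $|g_l/2|<g_s^3$ for $A_2,B_2,G_2$ respectively. For $\underline g\in\Gamma$ let $\gamma_0$ be the compact component of the real affine curve, oriented so that $\zeta_F$ is positive on it, and let $\gamma_1$ be the compact component of $E_{\underline g}\cap(\mathbb R\times i\mathbb R)$ that lies over the interval of the $x$-axis between $\gamma_0$ and the real branch leaving $\infty_1$ in the direction above (for $B_2$ this is the one of the two compact components with $x>0$; for $A_2$, $G_2$ there is only one), oriented so that $\zeta_F$ takes values in $i\mathbb R_{>0}$ on it. For a path in $\{\Delta\neq0\}$ from a point of $\Gamma$ to a point $\underline g$, transport $\gamma_0,\gamma_1$ along the path to loops in $E_{\underline g}$ and let $\omega_0=\oint_{\gamma_0}\zeta_F$ and $\omega_1=\oint_{\gamma_1}\zeta_F$ be the periods at the end point $\underline g$. **Theorem.** For each of the three types and every such path, with end point $\underline g$: $\mathrm{Im}(\omega_1/\omega_0)>0$; let $\Omega=\mathbb Z\omega_0+\mathbb Z\omega_1$ and let $$\wp(z)=\frac1{z^2}+\sum_{0\ne\omega\in\Omega}\Big(\frac1{(z-\omega)^2}-\frac1{\omega^2}\Big),\qquad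 \zeta(z)=\frac1z+\sum_{0\neq\omega\in\Omega}\Big(\frac1{z-\omega}+\frac1\omega+\frac z{\omega^2}\Big).$$ The integral $z=\int_{\infty_1}^{(x,y)}\zeta_F$ (along arbitrary paths in $\overline E_{\underline g}$) has single-valued inverse functions $x(z)$, $y(z)$, meromorphic in $z\in\mathbb C$: a number $z$ is a value of the integral at a point of the affine curve if and only if $z\notin\bigcup_{0\le k<N}\big(\tfrac kN\omega_0+\Omega\big)$, and that point is then unique and equal to $(x(z),y(z))$. They are given by $$\begin{aligned} A_2:\quad& x(z)=\tfrac14\wp(z),\qquad y(z)=\tfrac18\wp'(z);\\ B_2:\quad& x(z)=-\tfrac12\zeta(\tfrac12\omega_0)+\tfrac12\zeta(z)-\tfrac12\zeta(z-\tfrac12\omega_0),\\ & y(z)=-\tfrac14\wp(z)+\tfrac14\wp(z-\tfrac12\omega_0);\\ G_2:\quad& x(z)=-\tfrac16\zeta(\tfrac13\omega_0)-\tfrac16\zeta(\tfrac23\omega_0)+\tfrac12\zeta(z)-\tfrac12\zeta(z-\tfrac13\omega_0),\\ & y(z)=\tfrac12\zeta(\tfrac13\omega_0)+\tfrac12\zeta(\tfrac23\omega_0)-\tfrac12\zeta(z)-\tfrac12\zeta(z-\tfrac13\omega_0)+\zeta(z-\tfrac23\omega_0).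 \end{aligned}$$ Moreover $g_s=\tfrac32\wp(\tfrac12\omega_0)$ for type $B_2$, and $g_s=\tfrac23\zeta(\tfrac13\omega_0)-\tfrac13\zeta(\tfrac23\omega_0)$ for type $G_2$. -/

import Mathlib

open Set Filter Topology

noncomputable section

/-- The Weierstrass zeta function `1 / z + ∑_{l ≠ 0} (1 / (z - l) + 1 / l + z / l ^ 2)` of the
lattice of `L`. The summand for `l = 0` is `1 / z`, since `1 / 0 = 0`. -/
def PeriodPair.weierstrassZeta (L : PeriodPair) (z : ℂ) : ℂ :=
  ∑' l : L.lattice, (1 / (z - l) + 1 / (l : ℂ) + z / (l : ℂ) ^ 2)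

namespace EllipticFamily

/-- The three types `A₂ = I₂(3)`, `B₂ = I₂(4)`, `G₂ = I₂(6)`. -/
inductive DihedralType
  | A2
  | B2
  | G2

/-- The number `[p/2]` of points at infinity of the curves of type `I₂(p)`. -/
def level : DihedralType → ℕ
  | .A2 => 1
  | .B2 => 2
  | .G2 => 3

/-- The polynomial `F(x, y, g)`, where `g = (g_s, g_l)`. -/
def F : DihedralType → ℂ → ℂ → ℂ × ℂ → ℂ
  | .A2, x, y, g => y ^ 2 - (4 * x ^ 3 - g.1 * x - g.2)
  | .B2, x, y, g => y ^ 2 - (x ^ 4 - g.1 * x ^ 2 + g.2 + g.1 ^ 2 / 8)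
  | .G2, x, y, g => x * (y ^ 2 - x ^ 2) + g.1 * (3 * x ^ 2 + y ^ 2) - g.2 - 2 * g.1 ^ 3

/-- The discriminant `Δ(g)`; its zero set is the discriminant locus `D`. -/
def discriminant : DihedralType → ℂ × ℂ → ℂ
  | .A2, g => -27 * g.2 ^ 2 + g.1 ^ 3
  | .B2, g => (8 * g.2 + g.1 ^ 2) * (-8 * g.2 + g.1 ^ 2) ^ 2
  | .G2, g => (g.2 + 2 * g.1 ^ 3) * (-g.2 + 2 * g.1 ^ 3) ^ 3

/-- The totally real component `Γ` of the real parameter space: `g_s > 0` and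
`|c g_l| < g_s ^ (p / 2)` with `c = √27, 8, 1/2` (squared for type `A₂`). -/
def IsTotallyReal : DihedralType → ℝ → ℝ → Prop
  | .A2, gs, gl => 0 < gs ∧ 27 * gl ^ 2 < gs ^ 3
  | .B2, gs, gl => 0 < gs ∧ |8 * gl| < gs ^ 2
  | .G2, gs, gl => 0 < gs ∧ |gl / 2| < gs ^ 3

/-- The affine curve `F(x, y, g) = 0` in the `(x, y)`-plane. -/
def curve (T : DihedralType) (g : ℂ × ℂ) : Set (ℂ × ℂ) :=
  {P | F T P.1 P.2 g = 0}

/-- `∂F/∂x` at the point `P`. -/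
def dFx (T : DihedralType) (g : ℂ × ℂ) (P : ℂ × ℂ) : ℂ :=
  deriv (fun x => F T x P.2 g) P.1

/-- `∂F/∂y` at the point `P`. -/
def dFy (T : DihedralType) (g : ℂ × ℂ) (P : ℂ × ℂ) : ℂ :=
  deriv (fun y => F T P.1 y g) P.2

open Classical in
/-- The residue form `ζ = Res [dx dy / F]`, evaluated at a point `P` of the curve on a tangent
vector `v` of the curve at `P`: it is `dx / (∂F/∂y)` where `∂F/∂y ≠ 0`, and `-dy / (∂F/∂x)`
at the other (smooth) points; the two expressions agree where both make sense. -/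
def primitiveForm (T : DihedralType) (g : ℂ × ℂ) (P v : ℂ × ℂ) : ℂ :=
  if dFy T g P ≠ 0 then v.1 / dFy T g P else -v.2 / dFx T g P

/-- The integral of `ζ` along the restriction to `[a, b]` of a path in the curve. -/
def pathIntegral (T : DihedralType) (g : ℂ × ℂ) (c : ℝ → ℂ × ℂ) (a b : ℝ) : ℂ :=
  ∫ s in a..b, primitiveForm T g (c s) (deriv c s)

/-! ### Periods -/

/-- A simple closed `C¹` curve in the affine curve, parametrized by `[0, 1]`. -/
structure IsSimpleLoop (T : DihedralType) (g : ℂ × ℂ) (c : ℝ → ℂ × ℂ) : Prop where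
  contDiffOn : ContDiffOn ℝ 1 c (Icc 0 1)
  mem_curve : ∀ s ∈ Icc (0 : ℝ) 1, c s ∈ curve T g
  closed : c 0 = c 1
  injOn : InjOn c (Ico 0 1)

/-- For `g` in the totally real component: `c` parametrizes the cycle `γ₀`, that is, the unique
compact component of the set of real points of the affine curve. It is oriented so that `ζ` is
positive on it, as `ζ` is on the real arcs `δ₁, …, δ_[p/2]` whose cyclic union (starting from
`∞₁` in the direction `x → +∞`, `y → -∞`) is homologous to `γ₀` in the compactified curve. -/
structure IsGammaZero (T : DihedralType) (g : ℂ × ℂ) (c : ℝ → ℂ × ℂ) : Prop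
    extends IsSimpleLoop T g c where
  real : ∀ s ∈ Icc (0 : ℝ) 1, (c s).1.im = 0 ∧ (c s).2.im = 0
  oriented : ∀ s ∈ Ioo (0 : ℝ) 1, ∃ r : ℝ, 0 < r ∧ primitiveForm T g (c s) (deriv c s) = r

/-- For `g` in the totally real component: `c` parametrizes the vanishing cycle `γ₁`, which meets
the oval `γ₀` and the arc `δ₁` in one point each and is contracted to the node when `γ₀` and `δ₁`
come together. It is the compact component of `{x ∈ ℝ, y ∈ iℝ}` that lies over the interval
of the `x`-axis between `γ₀` and `δ₁` (`δ₁` cuts the `x`-axis at a positive `x`). The orientation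
is the one with `⟨γ₀, γ₁⟩ = ⟨δ₁, γ₁⟩ = 1`, that is, `γ₁` crosses `γ₀` and `δ₁` counter-clockwise:
`ζ` is positive on them and lies in `i ℝ_{>0}` on `γ₁`. -/
structure IsGammaOne (T : DihedralType) (g : ℂ × ℂ) (c : ℝ → ℂ × ℂ) : Prop
    extends IsSimpleLoop T g c where
  real : ∀ s ∈ Icc (0 : ℝ) 1, (c s).1.im = 0 ∧ (c s).2.re = 0
  meets : ∃ s ∈ Icc (0 : ℝ) 1, 0 < (c s).1.re
  oriented : ∀ s ∈ Ioo (0 : ℝ) 1,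
    ∃ r : ℝ, 0 < r ∧ primitiveForm T g (c s) (deriv c s) = r * Complex.I

/-- A path in the complement of the discriminant locus that starts in the totally real
component. Such paths represent the points of the universal covering of that complement, hence
those of its quotient, the monodromy covering; the path `g` represents a point over `g 1`. -/
structure IsParameterPath (T : DihedralType) (g : ℝ → ℂ × ℂ) : Prop where
  continuousOn : ContinuousOn g (Icc 0 1)
  discriminant_ne_zero : ∀ t ∈ Icc (0 : ℝ) 1, discriminant T (g t) ≠ 0
  base : ∃ gs gl : ℝ, IsTotallyReal T gs gl ∧ g 0 = ((gs : ℂ), (gl : ℂ))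

/-- `ω` is the integral of `ζ` over a loop in the curve over `g 1` which is obtained from the loop
`c` in the curve over `g 0` by horizontal transport along `g`: the family `t ↦ H t` consists of
loops in the curves over `g t`, starts with `c`, and depends continuously on `t`. -/
def IsTransportedPeriod (T : DihedralType) (g : ℝ → ℂ × ℂ) (c : ℝ → ℂ × ℂ) (ω : ℂ) : Prop :=
  ∃ H : ℝ → ℝ → ℂ × ℂ,
    ContinuousOn (Function.uncurry H) (Icc 0 1 ×ˢ Icc 0 1) ∧
    (∀ t ∈ Icc (0 : ℝ) 1, ∀ s ∈ Icc (0 : ℝ) 1, H t s ∈ curve T (g t)) ∧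
    (∀ t ∈ Icc (0 : ℝ) 1, H t 0 = H t 1) ∧
    EqOn (H 0) c (Icc 0 1) ∧
    ContDiffOn ℝ 1 (H 1) (Icc 0 1) ∧
    ω = pathIntegral T (g 1) (H 1) 0 1

/-- `ω = ω_{γ₀}` at the point of the monodromy covering represented by `g`. -/
def IsPeriodGammaZero (T : DihedralType) (g : ℝ → ℂ × ℂ) (ω : ℂ) : Prop :=
  ∃ c, IsGammaZero T (g 0) c ∧ IsTransportedPeriod T g c ω

/-- `ω = ω_{γ₁}` at the point of the monodromy covering represented by `g`. -/
def IsPeriodGammaOne (T : DihedralType) (g : ℝ → ℂ × ℂ) (ω : ℂ) : Prop :=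
  ∃ c, IsGammaOne T (g 0) c ∧ IsTransportedPeriod T g c ω

/-! ### The inverse functions of the indefinite integral -/

/-- The filter of neighbourhoods of the point at infinity `∞₁`, through which the real curve
passes in the direction `x → +∞`, `y → -∞`. Besides `x → ∞`, the asymptotics `y / x² → -1` for
type `B₂` (`y / x → -1` for type `G₂`) separates `∞₁` from the other points at infinity. -/
def nhdsInfinityOne : DihedralType → Filter (ℂ × ℂ)
  | .A2 => comap (fun P => ‖P.1‖) atTop
  | .B2 => comap (fun P => ‖P.1‖) atTop ⊓ comap (fun P => P.2 / P.1 ^ 2) (𝓝 (-1))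
  | .G2 => comap (fun P => ‖P.1‖) atTop ⊓ comap (fun P => P.2 / P.1) (𝓝 (-1))

/-- `z = ∫_{∞₁}^{P} ζ` along some path, `P` being a point of the affine curve. The path lies in
the affine curve except for its initial point `∞₁` (this is no loss for the set of values `z`,
since every path from `∞₁` to `P` can be deformed so that it avoids the points at infinity after
its start), and the integral is the limit of the integrals over `[ε, 1]`. -/
def IsAbelIntegral (T : DihedralType) (g : ℂ × ℂ) (P : ℂ × ℂ) (z : ℂ) : Prop :=
  ∃ c : ℝ → ℂ × ℂ,
    ContDiffOn ℝ 1 c (Ioc 0 1) ∧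
    (∀ s ∈ Ioc (0 : ℝ) 1, c s ∈ curve T g) ∧
    Tendsto c (𝓝[>] 0) (nhdsInfinityOne T) ∧
    c 1 = P ∧
    Tendsto (fun ε => pathIntegral T g c ε 1) (𝓝[>] 0) (𝓝 z)

/-- The points `k ω₀ / [p/2] + ω` with `0 ≤ k < [p/2]` and `ω` in the period lattice, where
`ω₀ = L.ω₁`. -/
def placesAtInfinity (T : DihedralType) (L : PeriodPair) : Set ℂ :=
  {z | ∃ k : ℕ, k < level T ∧ z - k * (L.ω₁ / level T) ∈ L.lattice}

/-- The meromorphic functions `x` and `y` are the inverse functions `x(z, g)`, `y(z, g)` of the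
integral `z = ∫_{∞₁}^{(x, y)} ζ`: a number `z` is a value of the integral at a point of the affine
curve exactly if `z` is not in `S` (the places of the points at infinity), and in this
case the point is unique and equal to `(x z, y z)`. -/
structure IsInversePair (T : DihedralType) (g : ℂ × ℂ) (S : Set ℂ) (x y : ℂ → ℂ) : Prop where
  meromorphic_x : Meromorphic x
  meromorphic_y : Meromorphic y
  isAbelIntegral_iff : ∀ (P : ℂ × ℂ) (z : ℂ), IsAbelIntegral T g P z ↔ z ∉ S ∧ P = (x z, y z)

end EllipticFamily

end

/-! The vector field V = (∂F/∂y, -∂F/∂x) satisfies ζ_F(V) = 1 along the curve, so inverting the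
integral of ζ_F means solving Φ' = V(Φ) in complex time. Two solutions off closed countable sets
that meet once agree after a translation of time, and if both blow up at their exceptional sets,
these sets match as well (`IsComplexFlow.eq_of_eq`). This uniqueness principle takes the place of
divisors and degrees: it yields the injectivity of z ↦ (℘ z, ℘' z) modulo the lattice, the addition
formula (`thirdPoint_eq`) and the reflection principle; with blow-up it also yields path lifting.

The polynomial map `cubicMap` carries the affine curve bijectively onto a Weierstrass cubic without
N torsion points, the origin of the cubic standing for ∞₁. Let a be a parameter of the torsion
point. Half the slope m of the line through the points with parameters z and -a solves the Riccati
equation m' = 2℘(z) + ℘(a) - m² and equals -(ζ(z) - ζ(z - a) - ζ(a)) (`zetaDiff_eq`). For types B₂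
and G₂ the coordinates on the curve are polynomials in such half slopes and ℘, hence
`isUniformization`. A path that starts at ∞₁ lifts to one that starts at a lattice point, which
determines the values of the integral (`IsUniformization.isAbelIntegral_iff`).

What remains is to express the lattice and a by the cycles. Over Γ, a simple loop on which ζ_F is a
positive multiple of e lifts to a segment whose length is the least period in the direction e, so
that γ₀ and γ₁ have periods l and i m with l, m > 0. Reflection in the line over γ₀, which contains
no pole, shows that these two span the lattice and that a ≡ l / N for types B₂ and G₂
(`exists_isCompatible_of_isTotallyReal`). Off Γ, continuation is covering theory: oriented period
bases cover the space of nonsingular cubics with group SL(2, ℤ), where surjectivity comes from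
modular forms, and parameters of points cover the family of cubics with group ℤ². Basis, torsion
parameter and loops therefore lift along the path. Integer coordinates of lattice elements stay
constant, so ω₀, ω₁ remain an oriented basis and a remains ω₀ / N (`exists_isCompatible`,
`eq_period_of_isTransportedPeriod`). -/

noncomputable section

/-! ### Meromorphic solutions of autonomous systems in the plane -/

/-- `Φ` is a solution in complex time of `Φ' = V(Φ)` off the closed countable set `S`. -/
structure IsComplexSolution (V : ℂ × ℂ → ℂ × ℂ) (S : Set ℂ) (Φ : ℂ → ℂ × ℂ) : Prop where
  contDiff : ContDiff ℝ 1 V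
  isClosed : IsClosed S
  countable : S.Countable
  hasDerivAt : ∀ z ∉ S, HasDerivAt Φ (V (Φ z)) z

/-- A solution in complex time of `Φ' = V(Φ)` off `S` that blows up at the points of `S`. -/
structure IsComplexFlow (V : ℂ × ℂ → ℂ × ℂ) (S : Set ℂ) (Φ : ℂ → ℂ × ℂ) : Prop
    extends IsComplexSolution V S Φ where
  tendsto : ∀ s ∈ S, Tendsto (fun z => ‖Φ z‖) (𝓝[Sᶜ] s) atTop

lemma countable_isPreconnected_compl {S : Set ℂ} (hS : S.Countable) : IsPreconnected Sᶜ :=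
  (hS.isConnected_compl_of_one_lt_rank (by simp)).2

lemma neBot_nhdsWithin_compl_of_countable {S : Set ℂ} (hS : S.Countable) (s : ℂ) :
    (𝓝[Sᶜ] s).NeBot := by
  rw [← mem_closure_iff_nhdsWithin_neBot]
  exact (hS.dense_compl ℝ) s

/-- Local uniqueness on a compact interval for solutions of `u' = f(s) V(u)`. -/
lemma eventually_eq_of_hasDerivWithinAt_smul {V : ℂ × ℂ → ℂ × ℂ} (hV : ContDiff ℝ 1 V)
    {a b : ℝ} {f : ℝ → ℂ} (hf : ContinuousOn f (Icc a b)) {u c : ℝ → ℂ × ℂ} {s₀ : ℝ}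
    (hs₀ : s₀ ∈ Icc a b)
    (hu : ∀ᶠ s in 𝓝[Icc a b] s₀, HasDerivWithinAt u (f s • V (u s)) (Icc a b) s)
    (hc : ∀ᶠ s in 𝓝[Icc a b] s₀, HasDerivWithinAt c (f s • V (c s)) (Icc a b) s)
    (h0 : u s₀ = c s₀) : ∀ᶠ s in 𝓝[Icc a b] s₀, u s = c s := by
  obtain ⟨K, N, hN, hK⟩ := (hV.contDiffAt (x := c s₀)).exists_lipschitzOnWith
  have hcc : ContinuousWithinAt c (Icc a b) s₀ :=
    (hc.self_of_nhdsWithin hs₀).continuousWithinAt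
  have huc : ContinuousWithinAt u (Icc a b) s₀ :=
    (hu.self_of_nhdsWithin hs₀).continuousWithinAt
  obtain ⟨C, hC⟩ := (isCompact_Icc.exists_bound_of_continuousOn hf)
  have hev : ∀ᶠ s in 𝓝[Icc a b] s₀,
      (HasDerivWithinAt u (f s • V (u s)) (Icc a b) s ∧
        HasDerivWithinAt c (f s • V (c s)) (Icc a b) s) ∧ u s ∈ N ∧ c s ∈ N :=
    (hu.and hc).and ((huc.eventually_mem (h0 ▸ hN)).and (hcc.eventually_mem hN))
  rw [eventually_nhdsWithin_iff, Metric.eventually_nhds_iff] at hev ⊢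
  obtain ⟨ε, hε, hev⟩ := hev
  refine ⟨ε, hε, fun s hs hsI => ?_⟩
  have hlip : ∀ t ∈ Icc a b, LipschitzOnWith (C.toNNReal * K) (fun x => f t • V x) N := by
    intro t ht
    refine LipschitzOnWith.of_dist_le_mul fun x hx y hy => ?_
    rw [dist_smul₀, NNReal.coe_mul, mul_assoc]
    have h1 := hK.dist_le_mul x hx y hy
    have h2 : ‖f t‖ ≤ (C.toNNReal : ℝ) := (hC t ht).trans (Real.le_coe_toNNReal C)
    gcongr
  -- The point s₀ may be an end of the interval, so uniqueness to the right and to the left are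
  -- applied separately.
  rcases le_total s₀ s with h | h
  · have hsub : Icc s₀ s ⊆ Icc a b := Icc_subset_Icc hs₀.1 hsI.2
    have key : ∀ t ∈ Icc s₀ s, (HasDerivWithinAt u (f t • V (u t)) (Icc a b) t ∧
        HasDerivWithinAt c (f t • V (c t)) (Icc a b) t) ∧ u t ∈ N ∧ c t ∈ N := by
      intro t ht
      refine hev ?_ (hsub ht)
      rw [Real.dist_eq, abs_lt] at hs ⊢
      constructor <;> linarith [ht.1, ht.2]
    have hmem : ∀ t ∈ Ico s₀ s, Icc a b ∈ 𝓝[≥] t := fun t ht =>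
      Icc_mem_nhdsGE_of_mem ⟨hs₀.1.trans ht.1, ht.2.trans_le hsI.2⟩
    exact ODE_solution_unique_of_mem_Icc_right (v := fun t x => f t • V x) (s := fun _ => N)
      (fun t ht => hlip t (hsub (Ico_subset_Icc_self ht)))
      (fun t ht => (key t ht).1.1.continuousWithinAt.mono hsub)
      (fun t ht => (key t (Ico_subset_Icc_self ht)).1.1.mono_of_mem_nhdsWithin (hmem t ht))
      (fun t ht => (key t (Ico_subset_Icc_self ht)).2.1)
      (fun t ht => (key t ht).1.2.continuousWithinAt.mono hsub)
      (fun t ht => (key t (Ico_subset_Icc_self ht)).1.2.mono_of_mem_nhdsWithin (hmem t ht))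
      (fun t ht => (key t (Ico_subset_Icc_self ht)).2.2) h0 (right_mem_Icc.2 h)
  · have hsub : Icc s s₀ ⊆ Icc a b := Icc_subset_Icc hsI.1 hs₀.2
    have key : ∀ t ∈ Icc s s₀, (HasDerivWithinAt u (f t • V (u t)) (Icc a b) t ∧
        HasDerivWithinAt c (f t • V (c t)) (Icc a b) t) ∧ u t ∈ N ∧ c t ∈ N := by
      intro t ht
      refine hev ?_ (hsub ht)
      rw [Real.dist_eq, abs_lt] at hs ⊢
      constructor <;> linarith [ht.1, ht.2]
    have hmem : ∀ t ∈ Ioc s s₀, Icc a b ∈ 𝓝[≤] t := fun t ht =>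
      Icc_mem_nhdsLE_of_mem ⟨hsI.1.trans_lt ht.1, ht.2.trans hs₀.2⟩
    exact ODE_solution_unique_of_mem_Icc_left (v := fun t x => f t • V x) (s := fun _ => N)
      (fun t ht => hlip t (hsub (Ioc_subset_Icc_self ht)))
      (fun t ht => (key t ht).1.1.continuousWithinAt.mono hsub)
      (fun t ht => (key t (Ioc_subset_Icc_self ht)).1.1.mono_of_mem_nhdsWithin (hmem t ht))
      (fun t ht => (key t (Ioc_subset_Icc_self ht)).2.1)
      (fun t ht => (key t ht).1.2.continuousWithinAt.mono hsub)
      (fun t ht => (key t (Ioc_subset_Icc_self ht)).1.2.mono_of_mem_nhdsWithin (hmem t ht))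
      (fun t ht => (key t (Ioc_subset_Icc_self ht)).2.2) h0 (left_mem_Icc.2 h)

namespace IsComplexFlow

variable {V : ℂ × ℂ → ℂ × ℂ} {S S' : Set ℂ} {Φ Φ' : ℂ → ℂ × ℂ}

lemma continuousAt (h : IsComplexFlow V S Φ) {z : ℂ} (hz : z ∉ S) : ContinuousAt Φ z :=
  (h.hasDerivAt z hz).continuousAt

/-- Blow-up excludes finite limits at the points of S. This is what keeps lifts of paths in the
affine curve away from S and what lets the exceptional sets of two solutions be compared. -/
lemma not_tendsto_nhds (h : IsComplexFlow V S Φ) {s : ℂ} (hs : s ∈ S) {ι : Type*}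
    {l : Filter ι} [l.NeBot] {w : ι → ℂ} (hw : Tendsto w l (𝓝 s)) (hwS : ∀ᶠ i in l, w i ∉ S)
    {P : ℂ × ℂ} : ¬ Tendsto (fun i => Φ (w i)) l (𝓝 P) := by
  intro hP
  have h1 : Tendsto (fun i => ‖Φ (w i)‖) l atTop :=
    (h.tendsto s hs).comp (tendsto_nhdsWithin_iff.2 ⟨hw, hwS⟩)
  exact not_tendsto_atTop_of_tendsto_nhds hP.norm h1

lemma comp_hasDerivWithinAt (h : IsComplexFlow V S Φ) {w : ℝ → ℂ} {w' : ℂ} {t : Set ℝ} {s : ℝ}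
    (hw : HasDerivWithinAt w w' t s) (hs : w s ∉ S) :
    HasDerivWithinAt (fun s => Φ (w s)) (w' • V (Φ (w s))) t s := by
  exact (h.hasDerivAt _ hs).scomp_hasDerivWithinAt s hw

/-- Lifting of a path in the plane that is tangent to `V` to complex time. -/
lemma lift_of_hasDerivWithinAt (h : IsComplexFlow V S Φ) {a b : ℝ} {f : ℝ → ℂ}
    (hf : ContinuousOn f (Icc a b)) {c : ℝ → ℂ × ℂ} {w : ℝ → ℂ}
    (hc : ∀ s ∈ Icc a b, HasDerivWithinAt c (f s • V (c s)) (Icc a b) s)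
    (hw : ∀ s ∈ Icc a b, HasDerivWithinAt w (f s) (Icc a b) s)
    {s₀ : ℝ} (hs₀ : s₀ ∈ Icc a b) (h0 : w s₀ ∉ S) (h0' : Φ (w s₀) = c s₀) :
    ∀ s ∈ Icc a b, w s ∉ S ∧ Φ (w s) = c s := by
  have hwc : Continuous fun s : Icc a b => w s :=
    continuousOn_iff_continuous_domRestrict.1 fun s hs => (hw s hs).continuousWithinAt
  have hcc : Continuous fun s : Icc a b => c s :=
    continuousOn_iff_continuous_domRestrict.1 fun s hs => (hc s hs).continuousWithinAt
  -- A clopen argument: A is closed because a limit of lifted points cannot lie in S, the path c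
  -- being finite there, and open by local uniqueness for the differential equation.
  let A : Set (Icc a b) := {s | w s ∉ S ∧ Φ (w s) = c s}
  have hcl : IsClosed A := by
    refine isClosed_of_closure_subset fun s hs => ?_
    rw [mem_closure_iff_nhdsWithin_neBot] at hs
    have t1 : Tendsto (fun s : Icc a b => w s) (𝓝[A] s) (𝓝 (w s)) :=
      hwc.continuousAt.mono_left nhdsWithin_le_nhds
    have t2 : Tendsto (fun s : Icc a b => Φ (w s)) (𝓝[A] s) (𝓝 (c s)) := by
      have : Tendsto (fun s : Icc a b => c s) (𝓝[A] s) (𝓝 (c s)) :=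
        hcc.continuousAt.mono_left nhdsWithin_le_nhds
      refine this.congr' ?_
      filter_upwards [self_mem_nhdsWithin] with t ht using ht.2.symm
    have hS : w s ∉ S := fun hS => h.not_tendsto_nhds hS t1
      (by filter_upwards [self_mem_nhdsWithin] with t ht using ht.1) t2
    exact ⟨hS, tendsto_nhds_unique ((h.continuousAt hS).tendsto.comp t1) t2⟩
  have hop : IsOpen A := by
    rw [isOpen_iff_mem_nhds]
    rintro ⟨s, hs⟩ ⟨hs1, hs2⟩
    have hwS : ∀ᶠ t in 𝓝[Icc a b] s, w t ∉ S :=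
      (hw s hs).continuousWithinAt (h.isClosed.isOpen_compl.mem_nhds hs1)
    have key := eventually_eq_of_hasDerivWithinAt_smul h.contDiff hf (u := fun s => Φ (w s))
      (c := c) hs (by
        filter_upwards [hwS, self_mem_nhdsWithin] with t ht ht'
        exact h.comp_hasDerivWithinAt (hw t ht') ht)
      (by filter_upwards [self_mem_nhdsWithin] with t ht using hc t ht) hs2
    have := hwS.and key
    rw [nhds_subtype_eq_comap_nhdsWithin]
    exact ⟨_, this, fun t ht => ht⟩
  have : PreconnectedSpace (Icc a b) := Subtype.preconnectedSpace isPreconnected_Icc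
  have := IsClopen.eq_univ ⟨hcl, hop⟩ ⟨⟨s₀, hs₀⟩, h0, h0'⟩
  intro s hs
  exact (this ▸ mem_univ (⟨s, hs⟩ : Icc a b) : (⟨s, hs⟩ : Icc a b) ∈ A)

/-- Two solutions that agree at one point agree after a translation of time. -/
lemma _root_.IsComplexSolution.eq_of_eq (h : IsComplexSolution V S Φ)
    (h' : IsComplexSolution V S' Φ') {z z' : ℂ} (hz : z ∉ S)
    (hz' : z' ∉ S') (heq : Φ z = Φ' z') :
    ∀ w, z + w ∉ S → z' + w ∉ S' → Φ (z + w) = Φ' (z' + w) := by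
  set A : Set ℂ := ((fun w => z + w) ⁻¹' S) ∪ ((fun w => z' + w) ⁻¹' S') with hA
  have hAc : A.Countable := (h.countable.preimage (add_right_injective z)).union
    (h'.countable.preimage (add_right_injective z'))
  have hAcl : IsClosed A := (h.isClosed.preimage (by fun_prop)).union
    (h'.isClosed.preimage (by fun_prop))
  have d1 : ∀ w ∈ Aᶜ, HasDerivAt (fun w => Φ (z + w)) (V (Φ (z + w))) w := by
    intro w hw
    have := (h.hasDerivAt (z + w) (fun h => hw (Or.inl h)))
    exact HasDerivAt.comp_const_add z w this
  have d2 : ∀ w ∈ Aᶜ, HasDerivAt (fun w => Φ' (z' + w)) (V (Φ' (z' + w))) w := by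
    intro w hw
    have := (h'.hasDerivAt (z' + w) (fun h => hw (Or.inr h)))
    exact HasDerivAt.comp_const_add z' w this
  have a1 : AnalyticOnNhd ℂ (fun w => Φ (z + w)) Aᶜ :=
    DifferentiableOn.analyticOnNhd
      (fun w hw => (d1 w hw).differentiableAt.differentiableWithinAt) hAcl.isOpen_compl
  have a2 : AnalyticOnNhd ℂ (fun w => Φ' (z' + w)) Aᶜ :=
    DifferentiableOn.analyticOnNhd
      (fun w hw => (d2 w hw).differentiableAt.differentiableWithinAt) hAcl.isOpen_compl
  have h0 : (0 : ℂ) ∈ Aᶜ := by simp [hA, hz, hz']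
  have hnear : ∀ᶠ t : ℝ in 𝓝 0, ((t : ℂ) ∈ Aᶜ) := by
    have : Tendsto (fun t : ℝ => (t : ℂ)) (𝓝 0) (𝓝 0) := by
      simpa using Complex.continuous_ofReal.tendsto 0
    exact this (hAcl.isOpen_compl.mem_nhds h0)
  -- The real theory of differential equations gives agreement for small real times only; the
  -- identity theorem on the connected complement of the countable set A extends it to complex
  -- times.
  have hre : ∀ᶠ t : ℝ in 𝓝 0, Φ (z + t) = Φ' (z' + t) := by
    have key := eventually_eq_of_hasDerivWithinAt_smul h.contDiff (a := -1) (b := 1)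
      (f := fun _ => 1) continuousOn_const (u := fun t : ℝ => Φ (z + t))
      (c := fun t : ℝ => Φ' (z' + t)) (s₀ := 0) (by simp) (by
        filter_upwards [nhdsWithin_le_nhds hnear] with t ht
        have h2 : HasDerivAt (fun t : ℝ => (t : ℂ)) 1 t := by
          simpa using (hasDerivAt_id t).ofReal_comp
        simpa [Function.comp_def] using (HasDerivAt.scomp t (d1 t ht) h2).hasDerivWithinAt)
      (by
        filter_upwards [nhdsWithin_le_nhds hnear] with t ht
        have h2 : HasDerivAt (fun t : ℝ => (t : ℂ)) 1 t := by
          simpa using (hasDerivAt_id t).ofReal_comp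
        simpa [Function.comp_def] using (HasDerivAt.scomp t (d2 t ht) h2).hasDerivWithinAt)
      (by simpa using heq)
    rwa [nhdsWithin_eq_nhds.2 (Icc_mem_nhds (by norm_num) (by norm_num))] at key
  have hfreq : ∃ᶠ w in 𝓝[≠] (0 : ℂ), Φ (z + w) = Φ' (z' + w) := by
    have t : Tendsto (fun t : ℝ => (t : ℂ)) (𝓝[≠] 0) (𝓝[≠] 0) := by
      refine tendsto_nhdsWithin_iff.2 ⟨?_, ?_⟩
      · simpa using (Complex.continuous_ofReal.tendsto 0).mono_left nhdsWithin_le_nhds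
      · filter_upwards [self_mem_nhdsWithin] with t ht
        simpa using ht
    exact t.frequently (hre.filter_mono nhdsWithin_le_nhds).frequently
  have hE : EqOn (fun w => Φ (z + w)) (fun w => Φ' (z' + w)) Aᶜ :=
    a1.eqOn_of_preconnected_of_frequently_eq a2 (countable_isPreconnected_compl hAc) h0 hfreq
  exact fun w h1 h2 => hE (by simp [hA, h1, h2])

/-- Two solutions with poles that agree at one point agree after a translation of time. -/
lemma eq_of_eq (h : IsComplexFlow V S Φ) (h' : IsComplexFlow V S' Φ') {z z' : ℂ} (hz : z ∉ S)
    (hz' : z' ∉ S') (heq : Φ z = Φ' z') :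
    (∀ w, z + w ∈ S ↔ z' + w ∈ S') ∧
      ∀ w, z + w ∉ S → z' + w ∉ S' → Φ (z + w) = Φ' (z' + w) := by
  have hmain := h.toIsComplexSolution.eq_of_eq h'.toIsComplexSolution hz hz' heq
  set A : Set ℂ := ((fun w => z + w) ⁻¹' S) ∪ ((fun w => z' + w) ⁻¹' S') with hA
  have hAc : A.Countable := (h.countable.preimage (add_right_injective z)).union
    (h'.countable.preimage (add_right_injective z'))
  have hE : EqOn (fun w => Φ (z + w)) (fun w => Φ' (z' + w)) Aᶜ := fun w hw =>
    hmain w (fun h => hw (Or.inl h)) fun h => hw (Or.inr h)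
  refine ⟨fun w => ?_, hmain⟩
  have hne := neBot_nhdsWithin_compl_of_countable hAc w
  have tz : Tendsto (fun v => z + v) (𝓝[Aᶜ] w) (𝓝 (z + w)) :=
    (tendsto_const_nhds.add tendsto_id).mono_left nhdsWithin_le_nhds
  have tz' : Tendsto (fun v => z' + v) (𝓝[Aᶜ] w) (𝓝 (z' + w)) :=
    (tendsto_const_nhds.add tendsto_id).mono_left nhdsWithin_le_nhds
  -- If only one of the two solutions were regular at the time w, its finite value there would be a
  -- finite limit of the other one at a pole.
  constructor
  · intro h1
    by_contra h2
    refine h.not_tendsto_nhds h1 tz ?_ (P := Φ' (z' + w)) ?_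
    · filter_upwards [self_mem_nhdsWithin] with v hv using fun h => hv (Or.inl h)
    · refine ((h'.continuousAt h2).tendsto.comp tz').congr' ?_
      filter_upwards [self_mem_nhdsWithin] with v hv using (hE hv).symm
  · intro h1
    by_contra h2
    refine h'.not_tendsto_nhds h1 tz' ?_ (P := Φ (z + w)) ?_
    · filter_upwards [self_mem_nhdsWithin] with v hv using fun h => hv (Or.inr h)
    · refine ((h.continuousAt h2).tendsto.comp tz).congr' ?_
      filter_upwards [self_mem_nhdsWithin] with v hv using (hE hv)

end IsComplexFlow

end

/-! ### The differential equation of ℘ and the parametrization of the Weierstrass cubic. -/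

noncomputable section

namespace PeriodPair

variable (L : PeriodPair)

lemma countable_lattice : (L.lattice : Set ℂ).Countable :=
  countable_coe_iff.1 (inferInstanceAs (Countable L.lattice))

lemma hasDerivAt_weierstrassP {z : ℂ} (hz : z ∉ L.lattice) :
    HasDerivAt L.weierstrassP (L.derivWeierstrassP z) z := by
  rw [← L.deriv_weierstrassP]
  exact ((L.analyticOnNhd_weierstrassP z hz).differentiableAt).hasDerivAt

lemma isPreconnected_compl_lattice : IsPreconnected (L.lattice : Set ℂ)ᶜ :=
  countable_isPreconnected_compl L.countable_lattice

lemma tendsto_weierstrassP {l : ℂ} (hl : l ∈ L.lattice) :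
    Tendsto L.weierstrassP (𝓝[≠] l) (Bornology.cobounded ℂ) := by
  apply tendsto_cobounded_of_meromorphicOrderAt_neg
  rw [L.order_weierstrassP l hl]
  decide

lemma nhdsNE_eventually_notMem_lattice (z : ℂ) : ∀ᶠ w in 𝓝[≠] z, w ∉ L.lattice := by
  filter_upwards [self_mem_nhdsWithin,
    mem_nhdsWithin_of_mem_nhds (L.compl_lattice_sdiff_singleton_mem_nhds z)] with w hw hw' h
  exact hw' ⟨h, hw⟩

/-- Differentiating ℘'² = 4℘³ - g₂℘ - g₃ gives ℘' · (℘'' - 6℘² + g₂/2) = 0. On a connected domain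
one analytic factor vanishes identically, and it is not ℘', since ℘ has a pole and is not constant.
-/
lemma hasDerivAt_derivWeierstrassP {z : ℂ} (hz : z ∉ L.lattice) :
    HasDerivAt L.derivWeierstrassP (6 * L.weierstrassP z ^ 2 - L.g₂ / 2) z := by
  have ho : IsOpen (L.lattice : Set ℂ)ᶜ := L.isClosed_lattice.isOpen_compl
  have hd : ∀ w ∈ (L.lattice : Set ℂ)ᶜ,
      HasDerivAt L.derivWeierstrassP (deriv L.derivWeierstrassP w) w := fun w hw =>
    (L.analyticOnNhd_derivWeierstrassP w hw).differentiableAt.hasDerivAt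
  have hmul : ∀ w ∈ (L.lattice : Set ℂ)ᶜ, L.derivWeierstrassP w *
      (deriv L.derivWeierstrassP w - (6 * L.weierstrassP w ^ 2 - L.g₂ / 2)) = 0 := by
    intro w hw
    have h1 : HasDerivAt (fun w => L.derivWeierstrassP w ^ 2) _ w := (hd w hw).pow 2
    have h2 : HasDerivAt (fun w => 4 * L.weierstrassP w ^ 3 - L.g₂ * L.weierstrassP w - L.g₃) _ w :=
      (((L.hasDerivAt_weierstrassP hw).pow 3 |>.const_mul 4).sub
        ((L.hasDerivAt_weierstrassP hw).const_mul L.g₂)).sub_const L.g₃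
    have h3 : (fun w => L.derivWeierstrassP w ^ 2) =ᶠ[𝓝 w]
        (fun w => 4 * L.weierstrassP w ^ 3 - L.g₂ * L.weierstrassP w - L.g₃) := by
      filter_upwards [ho.mem_nhds hw] with v hv using L.derivWeierstrassP_sq v hv
    have := h1.unique (h2.congr_of_eventuallyEq h3)
    push_cast at this
    linear_combination this / 2
  have ha : AnalyticOnNhd ℂ (fun w => deriv L.derivWeierstrassP w -
      (6 * L.weierstrassP w ^ 2 - L.g₂ / 2)) (L.lattice : Set ℂ)ᶜ := fun w hw => by
    have h1 := (L.analyticOnNhd_derivWeierstrassP w hw).deriv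
    have h2 := L.analyticOnNhd_weierstrassP w hw
    fun_prop
  have hor := L.analyticOnNhd_derivWeierstrassP.eq_zero_or_eq_zero_of_mul_eq_zero ha hmul
    L.isPreconnected_compl_lattice
  suffices h : ∀ w ∈ (L.lattice : Set ℂ)ᶜ, deriv L.derivWeierstrassP w -
      (6 * L.weierstrassP w ^ 2 - L.g₂ / 2) = 0 by
    have := hd z hz
    rwa [sub_eq_zero.1 (h z hz)] at this
  refine hor.resolve_left fun h0 => ?_
  obtain ⟨w₀, hw₀⟩ : ∃ w₀, w₀ ∉ L.lattice := ⟨_, L.ω₁_div_two_notMem_lattice⟩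
  have hconst : ∀ w ∈ (L.lattice : Set ℂ)ᶜ, L.weierstrassP w = L.weierstrassP w₀ := fun w hw =>
    ho.is_const_of_deriv_eq_zero L.isPreconnected_compl_lattice L.differentiableOn_weierstrassP
      (fun v hv => by simpa using h0 v hv) hw hw₀
  have := (L.tendsto_weierstrassP (zero_mem _)).congr'
    (f₂ := fun _ => L.weierstrassP w₀) (by
      filter_upwards [L.nhdsNE_eventually_notMem_lattice 0] with w hw using hconst w hw)
  rw [← tendsto_norm_atTop_iff_cobounded] at this
  exact not_tendsto_atTop_of_tendsto_nhds tendsto_const_nhds this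

/-- The vector field of `p'' = 6 p ^ 2 - g₂ / 2`. -/
def _root_.weierstrassField (a : ℂ) (P : ℂ × ℂ) : ℂ × ℂ := (P.2, 6 * P.1 ^ 2 - a / 2)

/-- The parametrization `(℘, ℘')` of the Weierstrass cubic. -/
def toCubic (z : ℂ) : ℂ × ℂ := (L.weierstrassP z, L.derivWeierstrassP z)

lemma _root_.contDiff_weierstrassField (a : ℂ) : ContDiff ℝ 1 (weierstrassField a) := by
  unfold weierstrassField; fun_prop

lemma tendsto_norm_toCubic {l : ℂ} (hl : l ∈ L.lattice) :
    Tendsto (fun z => ‖L.toCubic z‖) (𝓝[≠] l) atTop := by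
  refine tendsto_atTop_mono (fun z => ?_) (tendsto_norm_atTop_iff_cobounded.2
    (L.tendsto_weierstrassP hl))
  exact norm_fst_le (L.toCubic z)

lemma isComplexFlow_toCubic : IsComplexFlow (weierstrassField L.g₂) L.lattice L.toCubic where
  contDiff := contDiff_weierstrassField _
  isClosed := L.isClosed_lattice
  countable := L.countable_lattice
  hasDerivAt _ hz := (L.hasDerivAt_weierstrassP hz).prodMk (L.hasDerivAt_derivWeierstrassP hz)
  tendsto _ hl := (L.tendsto_norm_toCubic hl).mono_left
    (nhdsWithin_mono _ fun _ hz h => hz (h ▸ hl))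

lemma toCubic_add_coe (z : ℂ) {l : ℂ} (hl : l ∈ L.lattice) : L.toCubic (z + l) = L.toCubic z := by
  lift l to L.lattice using hl
  simp [toCubic, L.weierstrassP_add_coe, L.derivWeierstrassP_add_coe]

/-- The two translates of (℘, ℘') meet, so they have the same poles; the pole of one at 0 is a pole
of the other at z - w. -/
lemma sub_mem_of_toCubic_eq {z w : ℂ} (hz : z ∉ L.lattice) (hw : w ∉ L.lattice)
    (h : L.toCubic z = L.toCubic w) : z - w ∈ L.lattice := by
  have := (L.isComplexFlow_toCubic.eq_of_eq L.isComplexFlow_toCubic hz hw h).1 (-w)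
  simpa [sub_eq_add_neg] using this

lemma sub_mem_or_add_mem_of_weierstrassP_eq {z w : ℂ} (hz : z ∉ L.lattice) (hw : w ∉ L.lattice)
    (h : L.weierstrassP z = L.weierstrassP w) : z - w ∈ L.lattice ∨ z + w ∈ L.lattice := by
  have h1 := L.derivWeierstrassP_sq z hz
  rw [h, ← L.derivWeierstrassP_sq w hw] at h1
  rcases sq_eq_sq_iff_eq_or_eq_neg.1 h1 with h2 | h2
  · exact Or.inl (L.sub_mem_of_toCubic_eq hz hw (Prod.ext h h2))
  · refine Or.inr ?_
    have := L.sub_mem_of_toCubic_eq (z := z) (w := -w) hz (by simpa using hw)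
      (Prod.ext (by simp [toCubic, h, L.weierstrassP_neg])
        (by simp [toCubic, h2, L.derivWeierstrassP_neg]))
    simpa using this

/-- If ℘ omitted the value c, then 1 / (℘ - c), extended by 0 to the lattice, would be entire and
doubly periodic, hence constant by Liouville; but it is 0 at the origin and not at ω₁ / 2. -/
lemma exists_weierstrassP_eq (c : ℂ) : ∃ z ∉ L.lattice, L.weierstrassP z = c := by
  by_contra! hne
  classical
  let f : ℂ → ℂ := fun z => if z ∈ L.lattice then 0 else (L.weierstrassP z - c)⁻¹
  have hoff : ∀ z ∉ L.lattice, DifferentiableAt ℂ f z := by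
    intro z hz
    have h1 : DifferentiableAt ℂ (fun z => (L.weierstrassP z - c)⁻¹) z :=
      ((L.hasDerivAt_weierstrassP hz).differentiableAt.sub_const c).inv (sub_ne_zero.2 (hne z hz))
    refine h1.congr_of_eventuallyEq ?_
    filter_upwards [L.isClosed_lattice.isOpen_compl.mem_nhds hz] with w hw
    exact if_neg hw
  have hfd : Differentiable ℂ f := by
    intro z
    by_cases hz : z ∈ L.lattice
    · refine (Complex.analyticAt_of_differentiable_on_punctured_nhds_of_continuousAt ?_
        ?_).differentiableAt
      · filter_upwards [L.nhdsNE_eventually_notMem_lattice z] with w hw using hoff w hw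
      · rw [continuousAt_iff_punctured_nhds]
        have h0 : f z = 0 := if_pos hz
        rw [h0]
        have h1 : Tendsto (fun w => L.weierstrassP w - c) (𝓝[≠] z) (Bornology.cobounded ℂ) := by
          simpa [sub_eq_add_neg, Function.comp_def] using
            (tendsto_add_const_cobounded (-c)).comp (L.tendsto_weierstrassP hz)
        refine (tendsto_inv₀_cobounded.comp h1).congr' ?_
        filter_upwards [L.nhdsNE_eventually_notMem_lattice z] with w hw
        simp [f, hw]
    · exact hoff z hz
  have hb := (IsZLattice.isCompact_range_of_periodic L.lattice f hfd.continuous fun z w hw => by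
    have : z + w ∈ L.lattice ↔ z ∈ L.lattice := L.lattice.add_mem_iff_left hw
    have h2 := L.weierstrassP_add_coe z ⟨w, hw⟩
    simp only [f, this]
    simp only at h2
    rw [h2]).isBounded
  have hc := hfd.apply_eq_apply_of_bounded hb 0 (L.ω₁ / 2)
  have h0 : f 0 = 0 := if_pos (zero_mem _)
  have h1 : f (L.ω₁ / 2) ≠ 0 := by
    simp only [f, L.ω₁_div_two_notMem_lattice, if_false]
    exact inv_ne_zero (sub_ne_zero.2 (hne _ L.ω₁_div_two_notMem_lattice))
  exact h1 (hc ▸ h0)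

/-- Every point of the affine Weierstrass cubic is of the form `(℘ z, ℘' z)`. -/
lemma exists_toCubic_eq {P : ℂ × ℂ} (hP : P.2 ^ 2 = 4 * P.1 ^ 3 - L.g₂ * P.1 - L.g₃) :
    ∃ z ∉ L.lattice, L.toCubic z = P := by
  obtain ⟨z, hz, h⟩ := L.exists_weierstrassP_eq P.1
  have h1 := L.derivWeierstrassP_sq z hz
  rw [h, ← hP] at h1
  rcases sq_eq_sq_iff_eq_or_eq_neg.1 h1 with h2 | h2
  · exact ⟨z, hz, Prod.ext h h2⟩
  · exact ⟨-z, by simpa using hz, Prod.ext (by simp [toCubic, h, L.weierstrassP_neg])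
        (by simp [toCubic, h2, L.derivWeierstrassP_neg])⟩

/-- A solution of the Weierstrass system on the cubic is a translate of `(℘, ℘')`. -/
lemma exists_eq_toCubic_add {S : Set ℂ} {Φ : ℂ → ℂ × ℂ}
    (h : IsComplexFlow (weierstrassField L.g₂) S Φ) {z₀ : ℂ} (hz₀ : z₀ ∉ S)
    (hP : (Φ z₀).2 ^ 2 = 4 * (Φ z₀).1 ^ 3 - L.g₂ * (Φ z₀).1 - L.g₃) :
    ∃ d, ∀ z, (z ∈ S ↔ z + d ∈ L.lattice) ∧ (z ∉ S → Φ z = L.toCubic (z + d)) := by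
  obtain ⟨w, hw, hwe⟩ := L.exists_toCubic_eq hP
  obtain ⟨h1, h2⟩ := h.eq_of_eq L.isComplexFlow_toCubic hz₀ hw hwe.symm
  refine ⟨w - z₀, fun z => ?_⟩
  have e1 : z₀ + (z - z₀) = z := by ring
  have e2 : w + (z - z₀) = z + (w - z₀) := by ring
  have h3 := h1 (z - z₀)
  have h4 := h2 (z - z₀)
  rw [e1, e2] at h3 h4
  exact ⟨h3, fun hz => h4 hz (mt h3.2 hz)⟩

/-- Both parametrizations solve the same equation on the same cubic, so they are translates of each
other; the pole at 0 shows that the translation is by a lattice element. -/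
lemma lattice_eq_of_invariants_eq {L L' : PeriodPair} (h2 : L.g₂ = L'.g₂) (h3 : L.g₃ = L'.g₃) :
    L.lattice = L'.lattice := by
  obtain ⟨d, hd⟩ := L'.exists_eq_toCubic_add (h2 ▸ L.isComplexFlow_toCubic)
    L.ω₁_div_two_notMem_lattice
    (by rw [← h2, ← h3]; exact L.derivWeierstrassP_sq _ L.ω₁_div_two_notMem_lattice)
  have h0 : d ∈ L'.lattice := by simpa using (hd 0).1
  ext z
  rw [← SetLike.mem_coe, (hd z).1]
  exact L'.lattice.add_mem_iff_left h0

/-- At a double root the vector field would vanish, and the constant solution would pass through the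
same point as (℘, ℘'). But the constant solution has no poles. -/
lemma simple_root {a : ℂ} (ha : a ∉ L.lattice) (h : L.derivWeierstrassP a = 0) :
    12 * L.weierstrassP a ^ 2 - L.g₂ ≠ 0 := by
  intro h0
  have hz : weierstrassField L.g₂ (L.toCubic a) = 0 :=
    Prod.ext h (by simp [weierstrassField, toCubic]; linear_combination h0 / 2)
  have hflow : IsComplexFlow (weierstrassField L.g₂) ∅ (fun _ => L.toCubic a) :=
    { contDiff := contDiff_weierstrassField _
      isClosed := isClosed_empty
      countable := countable_empty
      hasDerivAt := fun z _ => by simpa [hz] using hasDerivAt_const z (L.toCubic a)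
      tendsto := by simp }
  have := (L.isComplexFlow_toCubic.eq_of_eq hflow ha (notMem_empty a) rfl).1 (-a)
  simp at this

lemma discriminant_ne_zero : L.g₂ ^ 3 - 27 * L.g₃ ^ 2 ≠ 0 := by
  intro h
  obtain ⟨b, hb, hb'⟩ : ∃ b, 12 * b ^ 2 = L.g₂ ∧ 4 * b ^ 3 - L.g₂ * b - L.g₃ = 0 := by
    by_cases h2 : L.g₂ = 0
    · have h3 : L.g₃ = 0 := by simpa [h2] using h
      exact ⟨0, by simp [h2], by simp [h3]⟩
    -- Substituting 12 b² = g₂ into 4 b³ - g₂ b - g₃ = 0 leaves -(2/3) g₂ b = g₃, which determines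
    -- the double root b.
    · refine ⟨-3 * L.g₃ / (2 * L.g₂), ?_, ?_⟩
      · field_simp
        linear_combination -4 * h
      · field_simp
        linear_combination 4 * L.g₃ * h
  obtain ⟨a, ha, hab⟩ := L.exists_toCubic_eq (P := (b, 0)) (by simp [hb'])
  have h1 : L.weierstrassP a = b := congrArg Prod.fst hab
  have h2 : L.derivWeierstrassP a = 0 := congrArg Prod.snd hab
  exact L.simple_root ha h2 (by rw [h1, hb, sub_self])

end PeriodPair
end

noncomputable section

/-! ### The space of oriented period pairs -/

open ComplexConjugate in
/-- The space of pairs `(ω₀, ω₁)` with `Im (ω₁ / ω₀) > 0`. -/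
abbrev OrientedPeriods : Type := {ω : ℂ × ℂ // 0 < (conj ω.1 * ω.2).im}

namespace OrientedPeriods

open ComplexConjugate

/-- Im (conj u * v) is the area form; pairing with a basis vector reads off a real coordinate, as in
Cramer's rule. -/
lemma fst_coord (ω : ℂ × ℂ) (a b : ℝ) :
    (conj (a * ω.1 + b * ω.2) * ω.2).im = a * (conj ω.1 * ω.2).im := by
  simp [Complex.mul_im]; ring

lemma snd_coord (ω : ℂ × ℂ) (a b : ℝ) :
    (conj ω.1 * (a * ω.1 + b * ω.2)).im = b * (conj ω.1 * ω.2).im := by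
  simp [Complex.mul_im]; ring

lemma fst_ne_zero (ω : OrientedPeriods) : ω.1.1 ≠ 0 := by
  intro h; have := ω.2; simp [h] at this

/-- The period pair of a point of the space of oriented periods. -/
def toPair (ω : OrientedPeriods) : PeriodPair where
  ω₁ := ω.1.1
  ω₂ := ω.1.2
  indep := by
    rw [LinearIndependent.pair_iff]
    intro s t h
    have h' : (s : ℂ) * ω.1.1 + t * ω.1.2 = 0 := by simpa using h
    have h1 := fst_coord ω.1 s t
    have h2 := snd_coord ω.1 s t
    rw [h'] at h1 h2
    simp only [map_zero, zero_mul, mul_zero, Complex.zero_im] at h1 h2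
    exact ⟨(mul_eq_zero.1 h1.symm).resolve_right ω.2.ne',
      (mul_eq_zero.1 h2.symm).resolve_right ω.2.ne'⟩

/-- The period with given integer coordinates. -/
def period (ω : ℂ × ℂ) (k : ℤ × ℤ) : ℂ := k.1 * ω.1 + k.2 * ω.2

@[simp] lemma period_zero (ω : ℂ × ℂ) : period ω 0 = 0 := by simp [period]

lemma period_mem (ω : OrientedPeriods) (k : ℤ × ℤ) : period ω.1 k ∈ ω.toPair.lattice :=
  PeriodPair.mem_lattice.2 ⟨k.1, k.2, rfl⟩

lemma mem_lattice_iff (ω : OrientedPeriods) {z : ℂ} :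
    z ∈ ω.toPair.lattice ↔ ∃ k, period ω.1 k = z := by
  rw [PeriodPair.mem_lattice]
  exact ⟨fun ⟨m, n, h⟩ => ⟨(m, n), h⟩, fun ⟨k, h⟩ => ⟨k.1, k.2, h⟩⟩

lemma period_injective (ω : OrientedPeriods) : Function.Injective (period ω.1) := by
  intro k k' h
  have h1 := fst_coord ω.1 k.1 k.2
  have h1' := fst_coord ω.1 k'.1 k'.2
  have h2 := snd_coord ω.1 k.1 k.2
  have h2' := snd_coord ω.1 k'.1 k'.2
  simp only [period] at h
  push_cast at h1 h1' h2 h2'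
  rw [h, h1'] at h1
  rw [h, h2'] at h2
  have e1 := mul_right_cancel₀ ω.2.ne' h1
  have e2 := mul_right_cancel₀ ω.2.ne' h2
  exact Prod.ext (by exact_mod_cast e1.symm) (by exact_mod_cast e2.symm)

lemma period_eq_zero_iff (ω : OrientedPeriods) {k : ℤ × ℤ} : period ω.1 k = 0 ↔ k = 0 := by
  rw [← period_zero ω.1, ω.period_injective.eq_iff]

/-- The period lattice is parametrized by the integer coordinates. -/
def latticeEquiv (ω : OrientedPeriods) : ℤ × ℤ ≃ ω.toPair.lattice :=
  Equiv.ofBijective (fun k => ⟨period ω.1 k, ω.period_mem k⟩)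
    ⟨fun _ _ h => ω.period_injective (congrArg Subtype.val h),
      fun ⟨_, hz⟩ => (ω.mem_lattice_iff.1 hz).imp fun _ h => Subtype.ext h⟩

lemma summable_norm_period_rpow (ω : OrientedPeriods) :
    Summable fun k => ‖period ω.1 k‖ ^ (-3 : ℝ) := by
  have := ZLattice.summable_norm_rpow ω.toPair.lattice (-3) (by simp; norm_num)
  exact ω.latticeEquiv.summable_iff.2 this

lemma continuous_period (k : ℤ × ℤ) : Continuous fun ω : ℂ × ℂ => period ω k := by
  unfold period; fun_prop

lemma exists_abs_le (ω : OrientedPeriods) : ∃ C : ℝ, 0 < C ∧ ∀ k : ℤ × ℤ,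
    |(k.1 : ℝ)| ≤ C * ‖period ω.1 k‖ ∧ |(k.2 : ℝ)| ≤ C * ‖period ω.1 k‖ := by
  set D := (conj ω.1.1 * ω.1.2).im with hD
  have hD0 : 0 < D := ω.2
  refine ⟨(‖ω.1.1‖ + ‖ω.1.2‖) / D, ?_, fun k => ⟨?_, ?_⟩⟩
  · have := norm_pos_iff.2 ω.fst_ne_zero
    positivity
  · rw [div_mul_eq_mul_div, le_div_iff₀ hD0]
    have h1 := fst_coord ω.1 k.1 k.2
    push_cast at h1
    have h2 : |(k.1 : ℝ) * D| ≤ ‖period ω.1 k‖ * ‖ω.1.2‖ := by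
      rw [← h1]
      refine (Complex.abs_im_le_norm _).trans ?_
      rw [norm_mul, RCLike.norm_conj]; rfl
    rw [abs_mul, abs_of_pos hD0] at h2
    nlinarith [norm_nonneg ω.1.1, norm_nonneg (period ω.1 k)]
  · rw [div_mul_eq_mul_div, le_div_iff₀ hD0]
    have h1 := snd_coord ω.1 k.1 k.2
    push_cast at h1
    have h2 : |(k.2 : ℝ) * D| ≤ ‖ω.1.1‖ * ‖period ω.1 k‖ := by
      rw [← h1]
      refine (Complex.abs_im_le_norm _).trans ?_
      rw [norm_mul, RCLike.norm_conj]; rfl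
    rw [abs_mul, abs_of_pos hD0] at h2
    nlinarith [norm_nonneg ω.1.2, norm_nonneg (period ω.1 k)]

/-- The coordinates of a period are at most C times its length, so moving each basis vector by at
most 1 / (4C) moves every period by at most half its length. The uniformity in k makes the lattice
sums dominated when the lattice varies. -/
lemma eventually_norm_period_le (ω : OrientedPeriods) : ∀ᶠ ω' in 𝓝 ω, ∀ k,
    ‖period ω.1 k‖ ≤ 2 * ‖period ω'.1 k‖ := by
  obtain ⟨C, hC, h⟩ := ω.exists_abs_le
  have : ∀ᶠ ω' : OrientedPeriods in 𝓝 ω, dist ω' ω < 1 / (4 * C) :=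
    Metric.eventually_nhds_iff.2 ⟨_, by positivity, fun _ h => h⟩
  filter_upwards [this] with ω' hω' k
  have hd : ‖ω'.1 - ω.1‖ < 1 / (4 * C) := by rwa [← dist_eq_norm]
  have h1 : ‖ω'.1.1 - ω.1.1‖ ≤ 1 / (4 * C) := (norm_fst_le (ω'.1 - ω.1)).trans hd.le
  have h2 : ‖ω'.1.2 - ω.1.2‖ ≤ 1 / (4 * C) := (norm_snd_le (ω'.1 - ω.1)).trans hd.le
  have h3 : period ω.1 k = period ω'.1 k - (k.1 * (ω'.1.1 - ω.1.1) + k.2 * (ω'.1.2 - ω.1.2)) := by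
    simp only [period]; ring
  have h4 : ‖(k.1 : ℂ) * (ω'.1.1 - ω.1.1) + k.2 * (ω'.1.2 - ω.1.2)‖ ≤ ‖period ω.1 k‖ / 2 := by
    refine (norm_add_le _ _).trans ?_
    rw [norm_mul, norm_mul, Complex.norm_intCast, Complex.norm_intCast]
    have a1 := mul_le_mul (h k).1 h1 (norm_nonneg _) (by positivity)
    have a2 := mul_le_mul (h k).2 h2 (norm_nonneg _) (by positivity)
    have a3 : C * ‖period ω.1 k‖ * (1 / (4 * C)) = ‖period ω.1 k‖ / 4 := by field_simp
    linarith
  have h5 := norm_sub_le (period ω'.1 k)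
    (k.1 * (ω'.1.1 - ω.1.1) + k.2 * (ω'.1.2 - ω.1.2))
  rw [← h3] at h5
  linarith

lemma finite_norm_period_lt (ω : OrientedPeriods) (R : ℝ) : {k | ‖period ω.1 k‖ < R}.Finite := by
  obtain ⟨C, hC, h⟩ := ω.exists_abs_le
  refine (((Set.finite_Icc (-⌈C * R⌉) ⌈C * R⌉).prod
    (Set.finite_Icc (-⌈C * R⌉) ⌈C * R⌉))).subset ?_
  have key : ∀ m : ℤ, |(m : ℝ)| ≤ C * R → m ∈ Set.Icc (-⌈C * R⌉) ⌈C * R⌉ := by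
    intro m hm
    have h1 : |(m : ℝ)| ≤ (⌈C * R⌉ : ℝ) := hm.trans (Int.le_ceil _)
    rw [abs_le] at h1
    exact ⟨by exact_mod_cast h1.1, by exact_mod_cast h1.2⟩
  intro k hk
  have hk' : C * ‖period ω.1 k‖ ≤ C * R := by gcongr; exact hk.le
  exact ⟨key _ ((h k).1.trans hk'), key _ ((h k).2.trans hk')⟩

/-- Dominated convergence: the finitely many exceptional terms are bounded near x₀ by their norm at
x₀ plus one, because they are continuous there. -/
lemma _root_.continuousAt_tsum_of_le_off_finite {ι X : Type*} [TopologicalSpace X] {x₀ : X}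
    {f : ι → X → ℂ} {bound : ι → ℝ} (hs : Summable bound) {t : Set ι} (ht : t.Finite)
    (hc : ∀ i, ContinuousAt (f i) x₀) (hb : ∀ᶠ x in 𝓝 x₀, ∀ i ∉ t, ‖f i x‖ ≤ bound i) :
    ContinuousAt (fun x => ∑' i, f i x) x₀ := by
  classical
  have hs' : Summable fun i => if i ∈ t then ‖f i x₀‖ + 1 else bound i := by
    refine (summable_congr_cofinite ?_).2 hs
    filter_upwards [ht.compl_mem_cofinite] with i hi
    exact if_neg hi
  refine tendsto_tsum_of_dominated_convergence hs' (fun i => hc i) ?_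
  have h1 : ∀ᶠ x in 𝓝 x₀, ∀ i ∈ t, ‖f i x‖ ≤ ‖f i x₀‖ + 1 := by
    rw [eventually_all_finite ht]
    intro i _
    exact ((hc i).norm.eventually (gt_mem_nhds (lt_add_one _))).mono fun _ h => h.le
  filter_upwards [hb, h1] with x hx hx' i
  split_ifs with h
  · exact hx' i h
  · exact hx i h

/-- The Weierstrass function without its principal part at the origin. -/
def regularP (ω : OrientedPeriods) (z : ℂ) : ℂ :=
  ∑' k : ℤ × ℤ, if k = 0 then 0 else (1 / (z - period ω.1 k) ^ 2 - 1 / period ω.1 k ^ 2)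

lemma weierstrassP_eq (ω : OrientedPeriods) (z : ℂ) :
    ω.toPair.weierstrassP z = 1 / z ^ 2 + regularP ω z := by
  have h := ω.toPair.weierstrassPExcept_add 0 z
  rw [← h]
  have : ω.toPair.weierstrassPExcept ((0 : ω.toPair.lattice) : ℂ) z = regularP ω z := by
    rw [PeriodPair.weierstrassPExcept, ← ω.latticeEquiv.tsum_eq]
    refine tsum_congr fun k => ?_
    simp only [latticeEquiv, ZeroMemClass.coe_zero]
    congr 1
    exact propext ω.period_eq_zero_iff
  rw [this]
  simp [add_comm]

lemma derivWeierstrassP_eq (ω : OrientedPeriods) (z : ℂ) :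
    ω.toPair.derivWeierstrassP z = ∑' k : ℤ × ℤ, -2 / (z - period ω.1 k) ^ 3 := by
  rw [← (ω.toPair.hasSum_derivWeierstrassP z).tsum_eq, ← ω.latticeEquiv.tsum_eq]
  rfl

lemma continuousAt_regularP {ω : OrientedPeriods} {z : ℂ}
    (hz : ∀ k ≠ 0, z ≠ period ω.1 k) :
    ContinuousAt (fun p : OrientedPeriods × ℂ => regularP p.1 p.2) (ω, z) := by
  set r := ‖z‖ + 1 with hr
  have hr0 : 0 < r := by positivity
  refine continuousAt_tsum_of_le_off_finite
    -- For a period of length at least 4r, the nearby period has length at least 2r, as needed for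
    -- `weierstrassP_bound`. A factor 2³ accounts for comparing the cubes of the two lengths.
    (bound := fun k => 80 * r * ‖period ω.1 k‖ ^ (-3 : ℝ))
    (ω.summable_norm_period_rpow.mul_left _) (ω.finite_norm_period_lt (4 * r)) ?_ ?_
  · intro k
    by_cases hk : k = 0
    · simpa [hk] using continuousAt_const
    · simp only [hk, if_false]
      have h1 : ContinuousAt (fun p : OrientedPeriods × ℂ => period p.1.1 k) (ω, z) :=
        ((continuous_period k).comp (continuous_subtype_val.comp continuous_fst)).continuousAt
      refine ContinuousAt.sub ?_ ?_
      · exact continuousAt_const.div ((continuousAt_snd.sub h1).pow 2)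
          (pow_ne_zero 2 (sub_ne_zero.2 (hz k hk)))
      · exact continuousAt_const.div (h1.pow 2)
          (pow_ne_zero 2 (mt ω.period_eq_zero_iff.1 hk))
  · have e1 : ∀ᶠ p : OrientedPeriods × ℂ in 𝓝 (ω, z), ‖p.2‖ < r :=
      (continuous_snd.norm.continuousAt (x := (ω, z))).eventually
        (gt_mem_nhds (lt_add_one ‖z‖))
    have e2 := (continuous_fst.tendsto (ω, z)).eventually ω.eventually_norm_period_le
    filter_upwards [e1, e2] with p hp1 hp2 k hk
    simp only [not_lt] at hk
    have hk2 := hp2 k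
    have hk0 : k ≠ 0 := by
      rintro rfl
      rw [period_zero, norm_zero] at hk; linarith
    rw [if_neg hk0]
    refine (PeriodPair.weierstrassP_bound r hr0 p.2 hp1 _ (by linarith)).trans ?_
    have h0 : 0 < ‖period ω.1 k‖ := by linarith
    have h0' : 0 < ‖period p.1.1 k‖ := by linarith
    have : ‖period p.1.1 k‖ ^ (-3 : ℝ) ≤ 8 * ‖period ω.1 k‖ ^ (-3 : ℝ) := by
      rw [Real.rpow_neg h0'.le, Real.rpow_neg h0.le]
      norm_cast
      rw [← div_eq_mul_inv, le_div_iff₀ (by positivity), inv_mul_le_iff₀ (by positivity)]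
      calc _ ≤ (2 * ‖period p.1.1 k‖) ^ 3 := by gcongr
        _ = _ := by ring
    nlinarith

lemma continuousAt_derivWeierstrassP {ω : OrientedPeriods} {z : ℂ}
    (hz : z ∉ ω.toPair.lattice) :
    ContinuousAt (fun p : OrientedPeriods × ℂ => p.1.toPair.derivWeierstrassP p.2) (ω, z) := by
  simp_rw [derivWeierstrassP_eq]
  set r := ‖z‖ + 1 with hr
  have hr0 : 0 < r := by positivity
  refine continuousAt_tsum_of_le_off_finite
    -- Here 128 = 2 · 4³: past the length 4r, the distance from the argument to the moved period is
    -- at least a quarter of the length of the original period.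
    (bound := fun k => 128 * ‖period ω.1 k‖ ^ (-3 : ℝ))
    (ω.summable_norm_period_rpow.mul_left _) (ω.finite_norm_period_lt (4 * r)) ?_ ?_
  · intro k
    have h1 : ContinuousAt (fun p : OrientedPeriods × ℂ => period p.1.1 k) (ω, z) :=
      ((continuous_period k).comp (continuous_subtype_val.comp continuous_fst)).continuousAt
    exact continuousAt_const.div ((continuousAt_snd.sub h1).pow 3)
      (pow_ne_zero 3 (sub_ne_zero.2 fun (h : z = _) => hz (h ▸ ω.period_mem k)))
  · have e1 : ∀ᶠ p : OrientedPeriods × ℂ in 𝓝 (ω, z), ‖p.2‖ < r :=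
      (continuous_snd.norm.continuousAt (x := (ω, z))).eventually
        (gt_mem_nhds (lt_add_one ‖z‖))
    have e2 := (continuous_fst.tendsto (ω, z)).eventually ω.eventually_norm_period_le
    filter_upwards [e1, e2] with p hp1 hp2 k hk
    simp only [not_lt] at hk
    have hk2 := hp2 k
    have h0 : 0 < ‖period ω.1 k‖ := by linarith
    have h1 : ‖period ω.1 k‖ ≤ 4 * ‖p.2 - period p.1.1 k‖ := by
      have := norm_sub_norm_le (period p.1.1 k) p.2
      rw [norm_sub_rev] at this
      linarith
    have h0' : 0 < ‖p.2 - period p.1.1 k‖ := by linarith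
    rw [norm_div, norm_neg, norm_pow, Real.rpow_neg h0.le]
    norm_cast
    rw [← div_eq_mul_inv, div_le_div_iff₀ (by positivity) (by positivity)]
    have := pow_le_pow_left₀ h0.le h1 3
    rw [mul_pow] at this
    norm_num at this ⊢
    linarith

lemma continuousAt_toCubic {ω : OrientedPeriods} {z : ℂ} (hz : z ∉ ω.toPair.lattice) :
    ContinuousAt (fun p : OrientedPeriods × ℂ => p.1.toPair.toCubic p.2) (ω, z) := by
  refine ContinuousAt.prodMk ?_ (continuousAt_derivWeierstrassP hz)
  simp_rw [weierstrassP_eq]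
  refine ContinuousAt.add (continuousAt_const.div (continuousAt_snd.pow 2) ?_)
    (continuousAt_regularP fun k _ h => hz (h ▸ ω.period_mem k))
  exact pow_ne_zero 2 fun (h : z = 0) => hz (h ▸ zero_mem _)

/-- The regular part of ℘ is bounded near (ω, 0) jointly in the lattice and the argument, so 1 / z²
dominates on a disc that is uniform in the lattice. Points of bounded abscissa thus have parameters
away from the origin, which is needed for compactness. -/
lemma eventually_lt_norm_weierstrassP (ω : OrientedPeriods) (R : ℝ) :
    ∃ δ > 0, ∀ᶠ ω' : OrientedPeriods in 𝓝 ω, ∀ z ≠ 0, ‖z‖ < δ →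
      R < ‖ω'.toPair.weierstrassP z‖ := by
  have hc : ContinuousAt (fun p : OrientedPeriods × ℂ => regularP p.1 p.2) (ω, 0) :=
    continuousAt_regularP fun k hk h => hk (ω.period_eq_zero_iff.1 h.symm)
  set B := ‖regularP ω 0‖ + 1 with hB
  have h1 : ∀ᶠ p : OrientedPeriods × ℂ in 𝓝 (ω, 0), ‖regularP p.1 p.2‖ < B :=
    hc.norm.eventually (gt_mem_nhds (lt_add_one _))
  have h2 : ∀ᶠ z : ℂ in 𝓝 0, ‖z‖ ^ 2 * (B + |R| + 1) < 1 := by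
    have : ContinuousAt (fun z : ℂ => ‖z‖ ^ 2 * (B + |R| + 1)) 0 := by fun_prop
    exact this.eventually (gt_mem_nhds (by simp))
  rw [nhds_prod_eq] at h1
  obtain ⟨pa, hpa, pb, hpb, h⟩ := eventually_prod_iff.1 h1
  obtain ⟨δ, hδ, hδ'⟩ := Metric.eventually_nhds_iff.1 (hpb.and h2)
  refine ⟨δ, hδ, hpa.mono fun ω' hω' z hz hzδ => ?_⟩
  obtain ⟨hz1, hz2⟩ := hδ' (y := z) (by simpa using hzδ)
  have h3 := h hω' hz1
  rw [weierstrassP_eq]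
  have h4 : B + |R| + 1 < ‖1 / z ^ 2‖ := by
    rw [norm_div, norm_one, norm_pow, lt_div_iff₀ (by positivity), mul_comm]
    exact hz2
  have h5 := norm_sub_norm_le (1 / z ^ 2) (-regularP ω' z)
  rw [sub_neg_eq_add, norm_neg] at h5
  have := le_abs_self R
  simp only at h3
  linarith

end OrientedPeriods
end

noncomputable section

/-! ### Existence of lattices with given invariants -/

section Modular

open UpperHalfPlane ModularForm EisensteinSeries MatrixGroups ModularFormClass OnePoint

lemma tendsto_E_atImInfty {k : ℕ} (hk : 3 ≤ k) (hk2 : Even k) :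
    Tendsto (E hk) atImInfty (𝓝 1) := by
  have hanal := ModularFormClass.analyticAt_cuspFunction_zero (E hk) one_pos
    one_mem_strictPeriods_SL
  have h1 := (hanal.continuousAt.tendsto.comp (qParam_tendsto_atImInfty one_pos)).congr
    (SlashInvariantFormClass.eq_cuspFunction (E hk) · one_mem_strictPeriods_SL one_ne_zero)
  have h2 := E_qExpansion_coeff_zero hk hk2
  rw [qExpansion_coeff_zero one_pos hanal
    (SlashInvariantFormClass.periodic_comp_ofComplex (E hk) one_mem_strictPeriods_SL),
    ← cuspFunction_apply_zero one_pos hanal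
    (SlashInvariantFormClass.periodic_comp_ofComplex (E hk) one_mem_strictPeriods_SL)] at h2
  rwa [h2] at h1

lemma isBounded_discriminant_div {f : ℍ → ℂ} {c : ℂ} (hc : c ≠ 0)
    (hf : Tendsto f atImInfty (𝓝 c)) :
    Tendsto (fun z => ModularForm.discriminant z / f z) atImInfty (𝓝 0) := by
  simpa [Pi.div_def] using discriminant_isZeroAtImInfty.div hf hc

/-- A level one form of weight `12` that does not vanish at infinity has a zero. -/
lemma exists_eq_zero_of_weight_twelve (f : ModularForm 𝒮ℒ 12) {c : ℂ} (hc : c ≠ 0)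
    (hf : Tendsto f atImInfty (𝓝 c)) : ∃ z, f z = 0 := by
  -- Without zeros of f, the quotient Δ / f would be a level one form of weight 0, hence constant.
  -- As Δ is a cusp form, the constant is 0, although Δ has no zeros.
  by_contra! h0
  have hsl : ∀ γ : SL(2, ℤ), (fun z ↦ ModularForm.discriminant z / f z) ∣[(0 : ℤ)] γ =
      fun z ↦ ModularForm.discriminant z / f z := by
    intro γ
    have hγ : (γ : GL (Fin 2) ℝ) ∈ 𝒮ℒ := ⟨γ, rfl⟩
    change (⇑CuspForm.discriminant / ⇑f) ∣[(12 - 12 : ℤ)] γ = ⇑CuspForm.discriminant / ⇑f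
    simp_rw [div_slash_SL2, SL_slash, SlashInvariantForm.slash_action_eqn _ _ hγ]
  let F : ModularForm 𝒮ℒ 0 :=
    { toFun z := ModularForm.discriminant z / f z
      slash_action_eq' := fun _ ⟨γ, hγ⟩ ↦ hγ ▸ hsl γ
      holo' := CuspForm.discriminant.holo'.div f.holo' h0
      bdd_at_cusps' {c} hc' := by
        rw [Subgroup.IsArithmetic.isCusp_iff_isCusp_SL2Z] at hc'
        rw [isBoundedAt_iff_forall_SL2Z hc']
        intro γ _
        rw [hsl γ, IsBoundedAtImInfty, BoundedAtFilter]
        exact (isBounded_discriminant_div hc hf).isBigO_one ℝ }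
  obtain ⟨d, hd⟩ := levelOne_weight_zero_const F
  have h1 : Tendsto F atImInfty (𝓝 0) := isBounded_discriminant_div hc hf
  rw [hd] at h1
  have hd0 : d = 0 := tendsto_nhds_unique tendsto_const_nhds h1
  have h2 : ModularForm.discriminant I / f I = 0 := by
    have h3 : F I = 0 := by rw [hd, hd0]; rfl
    exact h3
  exact (div_ne_zero (discriminant_ne_zero I) (h0 I)) h2

/-- The form b E₄³ - a E₆² has weight 12 and the nonzero value b - a at infinity, so it has a zero.
This is the surjectivity of the j-invariant in homogeneous form. -/
lemma exists_E₄_cube_eq_E₆_sq {a b : ℂ} (hab : a ≠ b) :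
    ∃ z, b * E₄ z ^ 3 = a * E₆ z ^ 2 := by
  let f : ModularForm 𝒮ℒ 12 :=
    b • ModularForm.mcast (by decide) (E₄.pow 3) - a • ModularForm.mcast (by decide) (E₆.pow 2)
  have hfa : ∀ z, f z = b * E₄ z ^ 3 - a * E₆ z ^ 2 := fun z => by
    simp only [f, coe_mcast, coe_pow, sub_apply, Pi.pow_apply, smul_apply, smul_eq_mul]
  have hlim : Tendsto f atImInfty (𝓝 (b * 1 ^ 3 - a * 1 ^ 2)) := by
    rw [show (f : ℍ → ℂ) = fun z => b * E₄ z ^ 3 - a * E₆ z ^ 2 from funext hfa]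
    exact (((tendsto_E_atImInfty _ ⟨2, rfl⟩).pow 3).const_mul b).sub
      (((tendsto_E_atImInfty _ ⟨3, rfl⟩).pow 2).const_mul a)
  obtain ⟨z, hz⟩ := exists_eq_zero_of_weight_twelve f
    (by simpa [sub_eq_zero] using hab.symm) hlim
  exact ⟨z, sub_eq_zero.1 (by rw [← hfa, hz])⟩

end Modular

namespace OrientedPeriods
open UpperHalfPlane ModularForm EisensteinSeries MatrixGroups ComplexConjugate Real

lemma im_div_eq (ω : ℂ × ℂ) : (ω.2 / ω.1).im = (conj ω.1 * ω.2).im / Complex.normSq ω.1 := by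
  rw [div_eq_mul_inv, Complex.inv_def, ← mul_assoc, mul_comm ω.2, Complex.im_mul_ofReal,
    div_eq_mul_inv]

/-- The ratio of the periods. -/
def tau (ω : OrientedPeriods) : ℍ :=
  ⟨ω.1.2 / ω.1.1, by
    rw [im_div_eq]; exact div_pos ω.2 (Complex.normSq_pos.2 ω.fst_ne_zero)⟩

lemma coe_tau (ω : OrientedPeriods) : (ω.tau : ℂ) = ω.1.2 / ω.1.1 := rfl

lemma continuous_tau : Continuous tau := by
  refine UpperHalfPlane.isEmbedding_coe.continuous_iff.2 ?_
  exact (continuous_snd.comp continuous_subtype_val).div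
    (continuous_fst.comp continuous_subtype_val) fun ω => OrientedPeriods.fst_ne_zero ω

lemma G_eq (ω : OrientedPeriods) {n : ℕ} (hn : 3 ≤ n) :
    ω.toPair.G n = (ω.1.1 ^ n)⁻¹ * (2 * riemannZeta n * E hn ω.tau) := by
  have h1 : ω.toPair.G n = ∑' k, (period ω.1 k ^ n)⁻¹ := by
    rw [PeriodPair.G, ← ω.latticeEquiv.tsum_eq]; rfl
  -- The coordinates are exchanged: a period is k.1 ω₀ + k.2 ω₁, whereas the summand of the
  -- Eisenstein series is a power of v 0 · τ + v 1.
  let e : ℤ × ℤ ≃ (Fin 2 → ℤ) := (Equiv.prodComm ℤ ℤ).trans (finTwoArrowEquiv ℤ).symm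
  have h2 : ∀ k, (period ω.1 k ^ n)⁻¹ = (ω.1.1 ^ n)⁻¹ * eisSummand n (e k) ω.tau := by
    intro k
    have := ω.fst_ne_zero
    simp only [eisSummand, e, zpow_neg, zpow_natCast, coe_tau]
    rw [← mul_inv, ← mul_pow]
    congr 2
    simp [period, finTwoArrowEquiv]
    field_simp
    ring
  have h3 : E hn ω.tau = 1 / 2 * eisensteinSeries (N := 1) 0 n ω.tau := rfl
  rw [h1, tsum_congr h2, tsum_mul_left, e.tsum_eq (fun v => eisSummand n v ω.tau),
    tsum_eisSummand_eq_riemannZeta_mul_eisensteinSeries hn, h3]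
  ring

lemma riemannZeta_six : riemannZeta 6 = π ^ 6 / 945 := by
  have := riemannZeta_two_mul_nat (k := 3) (by norm_num)
  have hb : bernoulli 6 = 1 / 42 := by
    have h5 : bernoulli' 5 = 0 := bernoulli'_eq_zero_of_odd (by decide) (by norm_num)
    have h4 : Nat.choose 6 2 = 15 := by decide
    have h6 : Nat.choose 6 4 = 15 := by decide
    rw [bernoulli_eq_bernoulli'_of_ne_one (by norm_num), bernoulli'_def]
    norm_num [Finset.sum_range_succ, h5, h4, h6]
  norm_num [Nat.factorial, hb] at this
  rw [this]; ring

lemma g₂_eq (ω : OrientedPeriods) :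
    ω.toPair.g₂ = (ω.1.1 ^ 4)⁻¹ * (4 * π ^ 4 / 3 * E₄ ω.tau) := by
  rw [PeriodPair.g₂, ω.G_eq (n := 4) (by norm_num)]
  push_cast
  rw [riemannZeta_four]
  ring

lemma g₃_eq (ω : OrientedPeriods) :
    ω.toPair.g₃ = (ω.1.1 ^ 6)⁻¹ * (8 * π ^ 6 / 27 * E₆ ω.tau) := by
  rw [PeriodPair.g₃, ω.G_eq (n := 6) (by norm_num)]
  push_cast
  rw [riemannZeta_six]
  ring

end OrientedPeriods
end

noncomputable section

/-! ### The covering of the space of nonsingular cubics by the space of oriented periods -/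

/-- Closedness of a set is local, and locally the set is the image of a closed part of a compact
set, which is closed in a Hausdorff space. This weak properness supplies the quotient topology of
the coverings below without an open mapping argument. -/
lemma isQuotientMap_of_exists_isCompact {E X : Type*} [TopologicalSpace E] [TopologicalSpace X]
    [T2Space X] {f : E → X} (hf : Continuous f) (hs : Function.Surjective f)
    (h : ∀ y, ∃ K, IsCompact K ∧ ∃ U ∈ 𝓝 y, U ⊆ f '' K) : IsQuotientMap f := by
  refine isQuotientMap_iff_isClosed.2 ⟨hs, fun s => ⟨fun h => h.preimage hf, fun hc => ?_⟩⟩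
  refine isClosed_of_closure_subset fun y hy => ?_
  obtain ⟨K, hK, U, hU, hUK⟩ := h y
  have h1 : IsClosed (f '' (K ∩ f ⁻¹' s)) := ((hK.inter_right hc).image hf).isClosed
  have h2 : U ∩ s ⊆ f '' (K ∩ f ⁻¹' s) := by
    rintro z ⟨hz, hzs⟩
    obtain ⟨e, he, rfl⟩ := hUK hz
    exact ⟨e, ⟨he, hzs⟩, rfl⟩
  have h3 : y ∈ closure (U ∩ s) := by
    rw [mem_closure_iff_nhds] at hy ⊢
    intro t ht
    obtain ⟨z, hz1, hz2⟩ := hy (t ∩ U) (inter_mem ht hU)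
    exact ⟨z, hz1.1, hz1.2, hz2⟩
  obtain ⟨e, he, rfl⟩ := h1.closure_subset_iff.2 h2 h3
  exact he.2

namespace OrientedPeriods
open UpperHalfPlane ModularForm MatrixGroups ComplexConjugate

lemma im_conj_period_mul_period (ω : ℂ × ℂ) (k l : ℤ × ℤ) :
    (conj (period ω k) * period ω l).im =
      ((k.1 * l.2 - k.2 * l.1 : ℤ) : ℝ) * (conj ω.1 * ω.2).im := by
  simp [period, Complex.mul_im, Complex.mul_re]
  ring

/-- The matrix with rows (a, b) and (c, d) sends (ω₀, ω₁) to (d ω₀ + c ω₁, b ω₀ + a ω₁), so that the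
ratio ω₁ / ω₀ undergoes the usual Möbius transformation. -/
instance : MulAction SL(2, ℤ) OrientedPeriods where
  smul γ ω := ⟨(period ω.1 (γ 1 1, γ 1 0), period ω.1 (γ 0 1, γ 0 0)), by
    have hdet := γ.det_coe
    rw [Matrix.det_fin_two] at hdet
    rw [im_conj_period_mul_period]
    refine mul_pos ?_ ω.2
    rw [show γ 1 1 * γ 0 0 - γ 1 0 * γ 0 1 = 1 by linarith]
    norm_num⟩
  one_smul ω := Subtype.ext (Prod.ext
    (by change period _ _ = _; simp [period]) (by change period _ _ = _; simp [period]))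
  mul_smul γ γ' ω := Subtype.ext (Prod.ext
    (by
      change period _ _ = period (period _ _, period _ _) _
      simp [period, Matrix.mul_apply, Fin.sum_univ_two]; ring)
    (by
      change period _ _ = period (period _ _, period _ _) _
      simp [period, Matrix.mul_apply, Fin.sum_univ_two]; ring))

lemma smul_fst (γ : SL(2, ℤ)) (ω : OrientedPeriods) :
    (γ • ω).1.1 = period ω.1 (γ 1 1, γ 1 0) := rfl

lemma smul_snd (γ : SL(2, ℤ)) (ω : OrientedPeriods) :
    (γ • ω).1.2 = period ω.1 (γ 0 1, γ 0 0) := rfl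

lemma period_period (ω : ℂ × ℂ) (k l m : ℤ × ℤ) :
    period (period ω k, period ω l) m = period ω (m.1 * k.1 + m.2 * l.1, m.1 * k.2 + m.2 * l.2) := by
  simp [period]; ring

lemma tau_smul (γ : SL(2, ℤ)) (ω : OrientedPeriods) : (γ • ω).tau = γ • ω.tau := by
  have h := ω.fst_ne_zero
  have h2 : (γ 1 0 : ℂ) * (ω.1.2 / ω.1.1) + γ 1 1 ≠ 0 := by
    have := (γ • ω).fst_ne_zero
    rw [smul_fst] at this
    intro h3
    apply this
    field_simp at h3
    simp only [period]
    linear_combination h3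
  apply UpperHalfPlane.ext
  rw [UpperHalfPlane.specialLinearGroup_apply]
  simp only [coe_tau, smul_fst, smul_snd, period]
  simp only [algebraMap_int_eq, eq_intCast, Complex.ofReal_intCast]
  have h3 : (γ 1 1 : ℂ) * ω.1.1 + γ 1 0 * ω.1.2 ≠ 0 := (γ • ω).fst_ne_zero
  rw [div_eq_div_iff h3 h2]
  field_simp
  ring

lemma lattice_smul_le (γ : SL(2, ℤ)) (ω : OrientedPeriods) :
    (γ • ω).toPair.lattice ≤ ω.toPair.lattice := by
  intro z hz
  obtain ⟨k, rfl⟩ := (mem_lattice_iff _).1 hz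
  change period (period _ _, period _ _) k ∈ _
  rw [period_period]
  exact ω.period_mem _

lemma lattice_smul (γ : SL(2, ℤ)) (ω : OrientedPeriods) :
    (γ • ω).toPair.lattice = ω.toPair.lattice :=
  le_antisymm (lattice_smul_le γ ω) (by simpa using lattice_smul_le γ⁻¹ (γ • ω))

/-- Two oriented bases of the same lattice are related by `SL(2, ℤ)`. -/
lemma exists_smul_eq_of_lattice_eq {ω ω' : OrientedPeriods}
    (h : ω.toPair.lattice = ω'.toPair.lattice) : ∃ γ : SL(2, ℤ), γ • ω' = ω := by
  have key : ∀ {ω ω' : OrientedPeriods}, ω.toPair.lattice = ω'.toPair.lattice →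
      ∃ k l : ℤ × ℤ, period ω'.1 k = ω.1.1 ∧ period ω'.1 l = ω.1.2 ∧
        (conj ω.1.1 * ω.1.2).im = ((k.1 * l.2 - k.2 * l.1 : ℤ) : ℝ) * (conj ω'.1.1 * ω'.1.2).im := by
    intro ω ω' h
    have h1 : ω.1.1 ∈ ω'.toPair.lattice := h ▸ (mem_lattice_iff _).2 ⟨(1, 0), by simp [period]⟩
    have h2 : ω.1.2 ∈ ω'.toPair.lattice := h ▸ (mem_lattice_iff _).2 ⟨(0, 1), by simp [period]⟩
    obtain ⟨k, hk⟩ := (mem_lattice_iff _).1 h1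
    obtain ⟨l, hl⟩ := (mem_lattice_iff _).1 h2
    refine ⟨k, l, hk, hl, ?_⟩
    rw [← hk, ← hl, im_conj_period_mul_period]
  obtain ⟨k, l, hk, hl, h1⟩ := key h
  obtain ⟨k', l', -, -, h2⟩ := key h.symm
  -- The determinants of the two changes of basis multiply to 1, and the orientations make D
  -- positive; being integers, both are 1.
  set D := k.1 * l.2 - k.2 * l.1
  set D' := k'.1 * l'.2 - k'.2 * l'.1
  have hp := ω.2
  have hp' := ω'.2
  have hD : 0 < D := by
    have : (0 : ℝ) < D := by
      by_contra hn
      push Not at hn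
      nlinarith
    exact_mod_cast this
  have hDD : D * D' = 1 := by
    have : ((D * D' : ℤ) : ℝ) = 1 := by
      rw [h2] at h1
      push_cast
      have h3 : ((D : ℝ) * D' - 1) * (conj ω.1.1 * ω.1.2).im = 0 := by linarith
      rcases mul_eq_zero.1 h3 with h4 | h4
      · linarith
      · exact absurd h4 hp.ne'
    exact_mod_cast this
  have hD1 : D = 1 := Int.eq_one_or_neg_one_of_mul_eq_one hDD |>.resolve_right (by omega)
  refine ⟨⟨!![l.2, l.1; k.2, k.1], ?_⟩, Subtype.ext (Prod.ext ?_ ?_)⟩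
  · rw [Matrix.det_fin_two_of, ← hD1]; ring
  · exact hk
  · exact hl

lemma continuous_const_smul' (γ : SL(2, ℤ)) : Continuous fun ω : OrientedPeriods => γ • ω :=
  Continuous.subtype_mk (((continuous_period _).comp continuous_subtype_val).prodMk
    ((continuous_period _).comp continuous_subtype_val)) _

lemma exists_pos_le_norm_period (ω : OrientedPeriods) :
    ∃ m > 0, ∀ k ≠ 0, m ≤ ‖period ω.1 k‖ := by
  obtain ⟨C, hC, h⟩ := ω.exists_abs_le
  refine ⟨1 / C, by positivity, fun k hk => ?_⟩
  rw [div_le_iff₀ hC, mul_comm]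
  by_cases h1 : k.1 = 0
  · have h2 : k.2 ≠ 0 := fun h2 => hk (Prod.ext h1 h2)
    refine le_trans ?_ (h k).2
    exact_mod_cast Int.one_le_abs h2
  · refine le_trans ?_ (h k).1
    exact_mod_cast Int.one_le_abs h1

/-- Two nearby bases of one lattice differ by short periods. With m a lower bound for the nonzero
periods of ω, nearby nonzero periods have length at least m / 2, while within balls of radius m / 8
the differences are shorter than m / 4 and hence zero. -/
lemma exists_nhds_disjoint_smul (ω : OrientedPeriods) :
    ∃ U ∈ 𝓝 ω, ∀ γ : SL(2, ℤ), ((γ • ·) '' U ∩ U).Nonempty → γ = 1 := by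
  obtain ⟨m, hm, h⟩ := ω.exists_pos_le_norm_period
  refine ⟨_, inter_mem ω.eventually_norm_period_le
    (Metric.ball_mem_nhds ω (show 0 < m / 8 by positivity)), ?_⟩
  rintro γ ⟨_, ⟨ω', ⟨hω, hd⟩, rfl⟩, ⟨-, hd'⟩⟩
  have hd2 : dist (γ • ω') ω' < m / 4 := by
    refine (dist_triangle_right _ _ ω).trans_lt ?_
    linarith [Metric.mem_ball.1 hd, Metric.mem_ball.1 hd']
  have hd3 : ‖(γ • ω').1 - ω'.1‖ < m / 4 := by rwa [← dist_eq_norm]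
  have key : ∀ k : ℤ × ℤ, ‖period ω'.1 k‖ < m / 4 → k = 0 := by
    intro k hk
    by_contra hk0
    have := h k hk0
    have := hω k
    linarith
  have h1 := key (γ 1 1 - 1, γ 1 0) (by
    refine lt_of_le_of_lt (le_of_eq ?_) ((norm_fst_le _).trans_lt hd3)
    rw [Prod.fst_sub, smul_fst]
    congr 1
    simp [period]; ring)
  have h2 := key (γ 0 1, γ 0 0 - 1) (by
    refine lt_of_le_of_lt (le_of_eq ?_) ((norm_snd_le _).trans_lt hd3)
    rw [Prod.snd_sub, smul_snd]
    congr 1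
    simp [period]; ring)
  rw [Prod.ext_iff] at h1 h2
  ext i j
  fin_cases i <;> fin_cases j <;> simp at h1 h2 ⊢ <;> omega

/-- The space of invariants of nonsingular cubics. -/
abbrev _root_.CubicInvariants : Type := {p : ℂ × ℂ // p.1 ^ 3 - 27 * p.2 ^ 2 ≠ 0}

/-- The invariants of the lattice spanned by a pair of periods. -/
def invariants (ω : OrientedPeriods) : CubicInvariants :=
  ⟨(ω.toPair.g₂, ω.toPair.g₃), ω.toPair.discriminant_ne_zero⟩

lemma continuous_invariants : Continuous invariants := by
  have h4 : Continuous E₄ := (ModularFormClass.holo E₄).continuous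
  have h6 : Continuous E₆ := (ModularFormClass.holo E₆).continuous
  have h : Continuous fun ω : OrientedPeriods => ω.1.1 :=
    continuous_fst.comp continuous_subtype_val
  refine Continuous.subtype_mk (Continuous.prodMk ?_ ?_) _
  · simp only [g₂_eq]
    exact ((h.pow 4).inv₀ fun ω => pow_ne_zero _ (OrientedPeriods.fst_ne_zero ω)).mul
      (continuous_const.mul (h4.comp continuous_tau))
  · simp only [g₃_eq]
    exact ((h.pow 6).inv₀ fun ω => pow_ne_zero _ (OrientedPeriods.fst_ne_zero ω)).mul
      (continuous_const.mul (h6.comp continuous_tau))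

lemma invariants_eq_of_lattice_eq {ω ω' : OrientedPeriods}
    (h : ω.toPair.lattice = ω'.toPair.lattice) : ω.invariants = ω'.invariants := by
  have hG : ∀ n, ω.toPair.G n = ω'.toPair.G n := by
    intro n; simp only [PeriodPair.G]; rw [h]
  refine Subtype.ext (Prod.ext ?_ ?_)
  · simp [invariants, PeriodPair.g₂, hG]
  · simp [invariants, PeriodPair.g₃, hG]

/-- The discriminant of the lattice in terms of the modular discriminant. -/
lemma discriminant_eq (ω : OrientedPeriods) :
    ω.toPair.g₂ ^ 3 - 27 * ω.toPair.g₃ ^ 2 =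
      (ω.1.1 ^ 12)⁻¹ * (4096 * Real.pi ^ 12 * ModularForm.discriminant ω.tau) := by
  rw [g₂_eq, g₃_eq, discriminant_eq_E₄_cube_sub_E₆_sq]
  have := ω.fst_ne_zero
  field_simp
  ring

/-- The period pair `(w, w τ)`. -/
def ofTau (w : ℂ) (hw : w ≠ 0) (τ : ℍ) : OrientedPeriods :=
  ⟨(w, w * τ), by
    have h := im_div_eq (w, w * τ)
    simp only [mul_div_cancel_left₀ _ hw] at h
    rw [eq_div_iff (Complex.normSq_pos.2 hw).ne'] at h
    rw [← h]
    exact mul_pos τ.im_pos (Complex.normSq_pos.2 hw)⟩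

lemma tau_ofTau (w : ℂ) (hw : w ≠ 0) (τ : ℍ) : (ofTau w hw τ).tau = τ := by
  apply UpperHalfPlane.ext
  rw [coe_tau]
  exact mul_div_cancel_left₀ _ hw

/-- Nonsingular cubics with equal j-invariant, written as B² c³ = A³ d², agree up to the scaling
with weights (s², s³). Generically s = dA / (cB); at j = 0 and j = 1728 only one invariant survives,
and s is a cube root or a square root. -/
lemma exists_scaling {A B c d : ℂ} (hAB : A ^ 3 - 27 * B ^ 2 ≠ 0) (hcd : c ^ 3 - 27 * d ^ 2 ≠ 0)
    (h : B ^ 2 * c ^ 3 = A ^ 3 * d ^ 2) : ∃ s ≠ 0, c = s ^ 2 * A ∧ d = s ^ 3 * B := by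
  by_cases hA : A = 0
  · subst hA
    have hB : B ≠ 0 := by rintro rfl; simp at hAB
    have hc : c = 0 := by simpa [hB] using h
    subst hc
    have hd : d ≠ 0 := by rintro rfl; simp at hcd
    obtain ⟨s, hs⟩ := IsAlgClosed.exists_pow_nat_eq (d / B) (n := 3) (by norm_num)
    exact ⟨s, by rintro rfl; simp [hd, hB, eq_comm] at hs, by simp, by rw [hs]; field_simp⟩
  by_cases hB : B = 0
  · subst hB
    have hd : d = 0 := by simpa [hA] using h.symm
    subst hd
    have hc : c ≠ 0 := by rintro rfl; simp at hcd
    obtain ⟨s, hs⟩ := IsAlgClosed.exists_pow_nat_eq (c / A) (n := 2) (by norm_num)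
    exact ⟨s, by rintro rfl; simp [hc, hA, eq_comm] at hs, by rw [hs]; field_simp, by simp⟩
  have hc : c ≠ 0 := by
    rintro rfl
    have : d = 0 := by simpa [hA] using h.symm
    subst this
    simp at hcd
  have hd : d ≠ 0 := by
    rintro rfl
    simp [hB, hc] at h
  refine ⟨d * A / (c * B), by positivity, ?_, ?_⟩
  · field_simp
    linear_combination h
  · field_simp
    linear_combination h

lemma surjective_invariants : Function.Surjective invariants := by
  rintro ⟨⟨A, B⟩, hAB⟩
  simp only at hAB
  obtain ⟨τ, hτ⟩ := exists_E₄_cube_eq_E₆_sq (a := A ^ 3) (b := 27 * B ^ 2) (sub_ne_zero.1 hAB)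
  have hpi : (Real.pi : ℂ) ≠ 0 := by exact_mod_cast Real.pi_ne_zero
  have hD := ModularForm.discriminant_ne_zero τ
  rw [discriminant_eq_E₄_cube_sub_E₆_sq] at hD
  obtain ⟨s, hs0, h1, h2⟩ := exists_scaling (c := 4 * Real.pi ^ 4 / 3 * E₄ τ)
    (d := 8 * Real.pi ^ 6 / 27 * E₆ τ) hAB (by
      have : ((4 : ℂ) * Real.pi ^ 4 / 3 * E₄ τ) ^ 3 - 27 * (8 * Real.pi ^ 6 / 27 * E₆ τ) ^ 2 =
        4096 * Real.pi ^ 12 * ((E₄ τ ^ 3 - E₆ τ ^ 2) / 1728) := by ring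
      rw [this]
      exact mul_ne_zero (mul_ne_zero (by norm_num) (pow_ne_zero _ hpi)) hD) (by
      linear_combination (64 * Real.pi ^ 12 / 729 : ℂ) * hτ)
  -- The invariants g₂ and g₃ are homogeneous of degrees -4 and -6 in the basis, so the homothety by
  -- w with w² = s absorbs the factors s² and s³.
  obtain ⟨w, hw⟩ := IsAlgClosed.exists_pow_nat_eq s (n := 2) (by norm_num)
  have hw0 : w ≠ 0 := by rintro rfl; exact hs0 (by simpa using hw.symm)
  refine ⟨ofTau w hw0 τ, Subtype.ext (Prod.ext ?_ ?_)⟩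
  · change (ofTau w hw0 τ).toPair.g₂ = A
    rw [g₂_eq, tau_ofTau, h1, ← hw]
    change (w ^ 4)⁻¹ * _ = _
    field_simp
  · change (ofTau w hw0 τ).toPair.g₃ = B
    rw [g₃_eq, tau_ofTau, h2, ← hw]
    change (w ^ 6)⁻¹ * _ = _
    field_simp
end OrientedPeriods
end

/-! ### Compactness modulo SL(2, ℤ) and the covering property. -/

noncomputable section

namespace OrientedPeriods
open UpperHalfPlane ModularForm MatrixGroups ComplexConjugate ModularGroup

lemma isCompact_setOf_tau_mem (r R : ℝ) (hr : 0 < r) {D : Set ℍ} (hD : IsCompact D) :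
    IsCompact {ω : OrientedPeriods | r ≤ ‖ω.1.1‖ ∧ ‖ω.1.1‖ ≤ R ∧ ω.tau ∈ D} := by
  have hA : IsCompact {w : ℂ | r ≤ ‖w‖ ∧ ‖w‖ ≤ R} := by
    refine (isCompact_closedBall (0 : ℂ) R).of_isClosed_subset ?_ fun w hw => by simpa using hw.2
    exact (isClosed_le continuous_const continuous_norm).inter
      (isClosed_le continuous_norm continuous_const)
  have hK : IsCompact ((fun p : ℂ × ℍ => (p.1, p.1 * (p.2 : ℂ))) ''
      ({w : ℂ | r ≤ ‖w‖ ∧ ‖w‖ ≤ R} ×ˢ D)) :=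
    (hA.prod hD).image (by fun_prop)
  rw [Subtype.isCompact_iff]
  convert hK using 1
  ext p
  constructor
  · rintro ⟨(ω : OrientedPeriods), ⟨h1, h2, h3⟩, rfl⟩
    refine ⟨(ω.1.1, OrientedPeriods.tau ω), ⟨⟨h1, h2⟩, h3⟩, Prod.ext rfl ?_⟩
    change ω.1.1 * (OrientedPeriods.tau ω : ℂ) = _
    rw [coe_tau, mul_div_cancel₀ _ (OrientedPeriods.fst_ne_zero ω)]
  · rintro ⟨⟨w, τ⟩, ⟨⟨h1, h2⟩, h3⟩, rfl⟩
    have hw : w ≠ 0 := norm_pos_iff.1 (hr.trans_le h1)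
    exact ⟨ofTau w hw τ, ⟨h1, h2, by rw [tau_ofTau]; exact h3⟩, rfl⟩

/-- Every lattice has a basis whose ratio τ lies in the fundamental domain. Near y the invariant g₂
is bounded and the discriminant is bounded and bounded away from 0; this bounds Im τ, and then ω₀
from above and below. -/
lemma exists_isCompact_nhds_subset_image (y : CubicInvariants) :
    ∃ K, IsCompact K ∧ ∃ U ∈ 𝓝 y, U ⊆ invariants '' K := by
  set disc : CubicInvariants → ℂ := fun p => p.1.1 ^ 3 - 27 * p.1.2 ^ 2 with hdisc
  have hcd : Continuous disc := by fun_prop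
  set C := ‖y.1.1‖ + 1
  have hy : 0 < ‖disc y‖ := norm_pos_iff.2 y.2
  set δ := ‖disc y‖ / 2 with hδ
  have hδ0 : 0 < δ := by positivity
  set U : Set CubicInvariants := {p | ‖p.1.1‖ < C ∧ δ < ‖disc p‖ ∧ ‖disc p‖ < 4 * δ} with hU
  have hUy : U ∈ 𝓝 y := by
    refine inter_mem ?_ (inter_mem ?_ ?_)
    · exact (by fun_prop : Continuous fun p : CubicInvariants => ‖p.1.1‖).continuousAt.eventually_lt
        continuousAt_const (by simp [C])
    · exact continuousAt_const.eventually_lt hcd.norm.continuousAt (by rw [hδ]; linarith)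
    · exact hcd.norm.continuousAt.eventually_lt continuousAt_const (by rw [hδ]; linarith)
  -- Since g₂³ · 1728 Δ(τ) = disc · E₄(τ)³, points of U satisfy C³ |1728 Δ(τ)| ≥ δ |E₄(τ)|³. Near
  -- the cusp this fails, because Δ → 0 and E₄ → 1.
  have hlim : ∀ᶠ τ in atImInfty,
      C ^ 3 * (1728 * ‖ModularForm.discriminant τ‖) < δ * ‖E₄ τ‖ ^ 3 := by
    have h1 : Tendsto (fun τ => C ^ 3 * (1728 * ‖ModularForm.discriminant τ‖)) atImInfty
        (𝓝 (C ^ 3 * (1728 * ‖(0 : ℂ)‖))) :=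
      ((Tendsto.norm discriminant_isZeroAtImInfty).const_mul _).const_mul _
    have h2 : Tendsto (fun τ => δ * ‖E₄ τ‖ ^ 3) atImInfty (𝓝 (δ * ‖(1 : ℂ)‖ ^ 3)) :=
      ((tendsto_E_atImInfty _ ⟨2, rfl⟩).norm.pow 3).const_mul _
    exact h1.eventually_lt h2 (by simpa using hδ0)
  obtain ⟨Y, hY⟩ := UpperHalfPlane.atImInfty_mem _ |>.1 hlim
  have hcomp := isCompact_truncatedFundamentalDomain Y
  have hcont : Continuous ModularForm.discriminant :=
    (CuspForm.discriminant.holo').continuous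
  obtain ⟨M, hM⟩ := hcomp.exists_bound_of_continuousOn hcont.continuousOn
  obtain ⟨M', hM'⟩ := hcomp.exists_bound_of_continuousOn
    (hcont.inv₀ ModularForm.discriminant_ne_zero).continuousOn
  set c : ℝ := 4096 * Real.pi ^ 12
  have hc : 0 < c := by positivity
  -- The bounds for |ω₀| come from |disc| · |ω₀|¹² = c |Δ(τ)|. The twelfth power is compared with
  -- the first power below or above 1, whence the minimum and the maximum with 1.
  refine ⟨_, isCompact_setOf_tau_mem (min 1 (c / (4 * δ * (|M'| + 1)))) (max 1 (c * |M| / δ))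
    (lt_min one_pos (by positivity)) hcomp, U, hUy, fun p hp => ?_⟩
  obtain ⟨ω, rfl⟩ := surjective_invariants p
  obtain ⟨γ, hγ⟩ := exists_smul_mem_fd ω.tau
  have hinv : (γ • ω).invariants = ω.invariants := invariants_eq_of_lattice_eq (lattice_smul γ ω)
  refine ⟨γ • ω, ?_, hinv⟩
  rw [← tau_smul] at hγ
  rw [← hinv] at hp
  set ω' := γ • ω
  obtain ⟨h1, h2, h3⟩ := hp
  have hd : disc ω'.invariants = (ω'.1.1 ^ 12)⁻¹ *
      (4096 * Real.pi ^ 12 * ModularForm.discriminant ω'.tau) := ω'.discriminant_eq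
  have hwn : 0 < ‖ω'.1.1‖ := norm_pos_iff.2 ω'.fst_ne_zero
  have hτ : ω'.tau ∈ truncatedFundamentalDomain Y := by
    refine ⟨hγ, ?_⟩
    by_contra hlt
    have h4 := hY _ (not_le.1 hlt).le
    change C ^ 3 * (1728 * ‖ModularForm.discriminant ω'.tau‖) < δ * ‖E₄ ω'.tau‖ ^ 3 at h4
    have h5 : ω'.invariants.1.1 ^ 3 * (1728 * ModularForm.discriminant ω'.tau) =
        disc ω'.invariants * E₄ ω'.tau ^ 3 := by
      rw [hd]
      change ω'.toPair.g₂ ^ 3 * _ = _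
      rw [g₂_eq]
      have := ω'.fst_ne_zero
      field_simp
      ring
    have h6 := congrArg norm h5
    simp only [norm_mul, norm_pow, Complex.norm_ofNat] at h6
    have h7 : ‖ω'.invariants.1.1‖ ^ 3 * (1728 * ‖ModularForm.discriminant ω'.tau‖) ≤
        C ^ 3 * (1728 * ‖ModularForm.discriminant ω'.tau‖) := by gcongr
    have h8 : δ * ‖E₄ ω'.tau‖ ^ 3 ≤ ‖disc ω'.invariants‖ * ‖E₄ ω'.tau‖ ^ 3 := by gcongr
    linarith
  have hM1 := (hM _ hτ).trans (le_abs_self M)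
  have hM2 := (hM' _ hτ).trans (le_abs_self M')
  have hn : ‖disc ω'.invariants‖ * ‖ω'.1.1‖ ^ 12 = c * ‖ModularForm.discriminant ω'.tau‖ := by
    rw [hd]
    simp only [norm_mul, norm_pow, norm_inv, Complex.norm_ofNat, Complex.norm_real,
      Real.norm_of_nonneg Real.pi_pos.le]
    field_simp
    exact mul_comm _ _
  have hΔ : 0 < ‖ModularForm.discriminant ω'.tau‖ :=
    norm_pos_iff.2 (ModularForm.discriminant_ne_zero _)
  refine ⟨?_, ?_, hτ⟩
  · rw [min_le_iff]
    by_cases h1w : 1 ≤ ‖ω'.1.1‖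
    · exact Or.inl h1w
    refine Or.inr ?_
    have h9 : ‖ω'.1.1‖ ^ 12 ≤ ‖ω'.1.1‖ := pow_le_of_le_one hwn.le (not_le.1 h1w).le (by norm_num)
    rw [div_le_iff₀ (by positivity)]
    rw [Pi.inv_apply, norm_inv, inv_le_iff_one_le_mul₀ hΔ] at hM2
    have h10 : c ≤ c * ‖ModularForm.discriminant ω'.tau‖ * (|M'| + 1) := by
      have : 1 ≤ ‖ModularForm.discriminant ω'.tau‖ * (|M'| + 1) := by nlinarith
      nlinarith
    rw [← hn] at h10
    refine h10.trans ?_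
    have : ‖disc ω'.invariants‖ * ‖ω'.1.1‖ ^ 12 ≤ 4 * δ * ‖ω'.1.1‖ := by gcongr
    calc _ ≤ 4 * δ * ‖ω'.1.1‖ * (|M'| + 1) := by gcongr
      _ = _ := by ring
  · rw [le_max_iff]
    by_cases h1w : ‖ω'.1.1‖ ≤ 1
    · exact Or.inl h1w
    refine Or.inr ?_
    have h9 : ‖ω'.1.1‖ ≤ ‖ω'.1.1‖ ^ 12 := le_self_pow₀ (not_le.1 h1w).le (by norm_num)
    rw [le_div_iff₀ hδ0]
    calc ‖ω'.1.1‖ * δ ≤ ‖ω'.1.1‖ ^ 12 * ‖disc ω'.invariants‖ := by gcongr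
      _ = c * ‖ModularForm.discriminant ω'.tau‖ := by rw [← hn]; ring
      _ ≤ c * |M| := by gcongr

/-- The space of oriented periods is a covering space of the space of nonsingular cubics. -/
lemma isQuotientCoveringMap_invariants : IsQuotientCoveringMap invariants SL(2, ℤ) where
  toIsQuotientMap := isQuotientMap_of_exists_isCompact continuous_invariants surjective_invariants
    exists_isCompact_nhds_subset_image
  continuous_const_smul := continuous_const_smul'
  apply_eq_iff_mem_orbit {ω ω'} := by
    refine ⟨fun h => ?_, ?_⟩
    · have h1 : ω.toPair.g₂ = ω'.toPair.g₂ := congrArg (fun p => p.1.1) h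
      have h2 : ω.toPair.g₃ = ω'.toPair.g₃ := congrArg (fun p => p.1.2) h
      exact exists_smul_eq_of_lattice_eq (PeriodPair.lattice_eq_of_invariants_eq h1 h2)
    · rintro ⟨γ, rfl⟩
      exact invariants_eq_of_lattice_eq (lattice_smul γ ω')
  disjoint := exists_nhds_disjoint_smul

lemma isCoveringMap_invariants : IsCoveringMap invariants :=
  isQuotientCoveringMap_invariants.isCoveringMap

end OrientedPeriods
end

noncomputable section

/-! ### The universal covering of the family of cubics over the space of oriented periods -/

namespace OrientedPeriods
open ComplexConjugate

instance : LocallyCompactSpace OrientedPeriods :=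
  (isOpen_lt continuous_const (by fun_prop :
    Continuous fun ω : ℂ × ℂ => (conj ω.1 * ω.2).im)).locallyCompactSpace

/-- Points of the complex line that are not lattice points, with the lattice varying. -/
abbrev Places : Type := {x : OrientedPeriods × ℂ // x.2 ∉ x.1.toPair.lattice}

/-- Points of the Weierstrass cubics, with the lattice varying. -/
abbrev CubicPoints : Type := {x : OrientedPeriods × (ℂ × ℂ) //
  x.2.2 ^ 2 = 4 * x.2.1 ^ 3 - x.1.toPair.g₂ * x.2.1 - x.1.toPair.g₃}

/-- The family of the uniformizations of the Weierstrass cubics. -/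
def uniformization (x : Places) : CubicPoints :=
  ⟨(x.1.1, x.1.1.toPair.toCubic x.1.2), x.1.1.toPair.derivWeierstrassP_sq x.1.2 x.2⟩

/-- Periods are indexed by their integer coordinates, so that a single discrete group acts on the
fibres over all lattices at once. -/
instance : AddAction (ℤ × ℤ) Places where
  vadd k x := ⟨(x.1.1, x.1.2 + period x.1.1.1 k), fun h => x.2 (by
    simpa using sub_mem h (x.1.1.period_mem k))⟩
  zero_vadd x := Subtype.ext (Prod.ext rfl (by change x.1.2 + period _ _ = _; simp))
  add_vadd k l x := Subtype.ext (Prod.ext rfl (by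
    change x.1.2 + period x.1.1.1 _ = (x.1.2 + period x.1.1.1 _) + period x.1.1.1 _
    simp [period]; ring))

lemma vadd_snd (k : ℤ × ℤ) (x : Places) : (k +ᵥ x).1.2 = x.1.2 + period x.1.1.1 k := rfl

lemma continuous_uniformization : Continuous uniformization := by
  refine Continuous.subtype_mk (Continuous.prodMk (by fun_prop) ?_) _
  refine continuous_iff_continuousAt.2 fun x => ?_
  exact ContinuousAt.comp (f := Subtype.val) (x := x)
    (g := fun p : OrientedPeriods × ℂ => p.1.toPair.toCubic p.2) (continuousAt_toCubic x.2)
    continuous_subtype_val.continuousAt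

lemma exists_coords (ω : OrientedPeriods) (z : ℂ) : ∃ a b : ℝ, z = a * ω.1.1 + b * ω.1.2 := by
  have hI := ω.2.ne'
  refine ⟨(conj z * ω.1.2).im / (conj ω.1.1 * ω.1.2).im,
    (conj ω.1.1 * z).im / (conj ω.1.1 * ω.1.2).im, ?_⟩
  have : ((conj ω.1.1 * ω.1.2).im : ℂ) ≠ 0 := by exact_mod_cast hI
  refine mul_left_cancel₀ this ?_
  rw [mul_add, Complex.ofReal_div, Complex.ofReal_div, ← mul_assoc, ← mul_assoc,
    mul_div_cancel₀ _ this, mul_div_cancel₀ _ this]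
  apply Complex.ext <;> simp [Complex.mul_im, Complex.mul_re] <;> ring

lemma coords_unique (ω : OrientedPeriods) {a b a' b' : ℝ}
    (h : (a : ℂ) * ω.1.1 + b * ω.1.2 = a' * ω.1.1 + b' * ω.1.2) : a = a' ∧ b = b' := by
  have h1 := fst_coord ω.1 a b
  have h1' := fst_coord ω.1 a' b'
  have h2 := snd_coord ω.1 a b
  have h2' := snd_coord ω.1 a' b'
  rw [h] at h1 h2
  exact ⟨mul_right_cancel₀ ω.2.ne' (h1.symm.trans h1'),
    mul_right_cancel₀ ω.2.ne' (h2.symm.trans h2')⟩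

/-- Every complex number is congruent to one in the centred fundamental parallelogram. -/
lemma exists_add_period (ω : OrientedPeriods) (z : ℂ) : ∃ k : ℤ × ℤ, ∃ a ∈ Icc (-(1 / 2) : ℝ) (1 / 2),
    ∃ b ∈ Icc (-(1 / 2) : ℝ) (1 / 2), z + period ω.1 k = a * ω.1.1 + b * ω.1.2 := by
  obtain ⟨a, b, rfl⟩ := ω.exists_coords z
  have key : ∀ a : ℝ, a - round a ∈ Icc (-(1 / 2) : ℝ) (1 / 2) := fun a =>
    abs_le.1 (abs_sub_round a)
  refine ⟨(-round a, -round b), _, key a, _, key b, ?_⟩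
  simp [period]; ring

lemma notMem_lattice_of_coords (ω : OrientedPeriods) {a b : ℝ} (ha : a ∈ Icc (-(1 / 2) : ℝ) (1 / 2))
    (hb : b ∈ Icc (-(1 / 2) : ℝ) (1 / 2)) (h : (a : ℂ) * ω.1.1 + b * ω.1.2 ≠ 0) :
    (a : ℂ) * ω.1.1 + b * ω.1.2 ∉ ω.toPair.lattice := by
  intro hm
  obtain ⟨k, hk⟩ := ω.mem_lattice_iff.1 hm
  obtain ⟨h1, h2⟩ := ω.coords_unique (a := k.1) (b := k.2) (by simpa [period] using hk)
  have key : ∀ (a : ℝ) (m : ℤ), a ∈ Icc (-(1 / 2) : ℝ) (1 / 2) → (m : ℝ) = a → m = 0 := by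
    intro a m ha hm
    rw [← hm] at ha
    have h1 : (-1 : ℝ) < m := by linarith [ha.1]
    have h2 : (m : ℝ) < 1 := by linarith [ha.2]
    have h1' : -1 < m := by exact_mod_cast h1
    have h2' : m < 1 := by exact_mod_cast h2
    omega
  apply h
  rw [← h1, ← h2, key _ _ ha h1, key _ _ hb h2]
  simp

/-- The parameter can be moved into the centred parallelogram, where 0 is the only lattice point;
the bound on ℘ keeps it at distance δ from there, uniformly for lattices in the compact set N. -/
lemma exists_isCompact_subset_image_uniformization (y : CubicPoints) :
    ∃ K, IsCompact K ∧ ∃ U ∈ 𝓝 y, U ⊆ uniformization '' K := by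
  obtain ⟨δ, hδ, h⟩ := eventually_lt_norm_weierstrassP y.1.1 (‖y.1.2.1‖ + 1)
  obtain ⟨N, hN, hNs, hNc⟩ := local_compact_nhds h
  set I : Set ℝ := Icc (-(1 / 2) : ℝ) (1 / 2)
  set f : OrientedPeriods × ℝ × ℝ → OrientedPeriods × ℂ :=
    fun x => (x.1, x.2.1 * x.1.1.1 + x.2.2 * x.1.1.2) with hf
  have hfc : Continuous f := by fun_prop
  have hC : IsCompact ((N ×ˢ (I ×ˢ I)) ∩ {x | δ ≤ ‖(f x).2‖}) :=
    (hNc.prod (isCompact_Icc.prod isCompact_Icc)).inter_right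
      (isClosed_le continuous_const (by fun_prop))
  have hval : ∀ x ∈ (N ×ˢ (I ×ˢ I)) ∩ {x | δ ≤ ‖(f x).2‖}, (f x).2 ∉ (f x).1.toPair.lattice := by
    rintro x ⟨⟨-, h1, h2⟩, h3⟩
    exact x.1.notMem_lattice_of_coords h1 h2 (norm_pos_iff.1 (hδ.trans_le h3))
  refine ⟨Subtype.val ⁻¹' (f '' ((N ×ˢ (I ×ˢ I)) ∩ {x | δ ≤ ‖(f x).2‖})), ?_,
    {p | p.1.1 ∈ N ∧ ‖p.1.2.1‖ < ‖y.1.2.1‖ + 1}, ?_, ?_⟩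
  · rw [Topology.IsEmbedding.subtypeVal.isInducing.isCompact_preimage_iff]
    · exact hC.image hfc
    · rintro _ ⟨x, hx, rfl⟩
      exact ⟨⟨f x, hval x hx⟩, rfl⟩
  · refine inter_mem ?_ ?_
    · exact (by fun_prop : Continuous fun p : CubicPoints => p.1.1).continuousAt hN
    · exact (by fun_prop : Continuous fun p : CubicPoints => ‖p.1.2.1‖).continuousAt.eventually_lt
        continuousAt_const (by simp)
  · rintro ⟨⟨ω, P⟩, hP⟩ ⟨hω, hn⟩
    obtain ⟨z, hz, hzP⟩ := ω.toPair.exists_toCubic_eq hP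
    obtain ⟨k, a, ha, b, hb, hk⟩ := ω.exists_add_period z
    have hz' : z + period ω.1 k ∉ ω.toPair.lattice := fun h' =>
      hz (by simpa using sub_mem h' (ω.period_mem k))
    have hzP' : ω.toPair.toCubic (z + period ω.1 k) = P := by
      rw [ω.toPair.toCubic_add_coe z (ω.period_mem k), hzP]
    have hz0 : z + period ω.1 k ≠ 0 := fun h0 => hz' (h0 ▸ zero_mem _)
    refine ⟨⟨(ω, z + period ω.1 k), hz'⟩, ⟨(ω, a, b), ⟨⟨hω, ha, hb⟩, ?_⟩, ?_⟩, ?_⟩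
    · by_contra hlt
      change ¬ δ ≤ ‖(a : ℂ) * ω.1.1 + b * ω.1.2‖ at hlt
      rw [← hk] at hlt
      have h1 := hNs hω _ hz0 (not_le.1 hlt)
      have h2 : ω.toPair.weierstrassP (z + period ω.1 k) = P.1 := congrArg Prod.fst hzP'
      rw [h2] at h1
      exact lt_asymm h1 hn
    · exact Prod.ext rfl hk.symm
    · exact Subtype.ext (Prod.ext rfl hzP')

/-- This covering lifts continuous families of points on varying cubics to continuous families of
parameters, which is how both the torsion point and the loops are transported. -/
lemma isAddQuotientCoveringMap_uniformization :
    IsAddQuotientCoveringMap uniformization (ℤ × ℤ) where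
  toIsQuotientMap := by
    refine isQuotientMap_of_exists_isCompact continuous_uniformization ?_
      exists_isCompact_subset_image_uniformization
    rintro ⟨⟨ω, P⟩, hP⟩
    obtain ⟨z, hz, hzP⟩ := ω.toPair.exists_toCubic_eq hP
    exact ⟨⟨(ω, z), hz⟩, Subtype.ext (Prod.ext rfl hzP)⟩
  continuous_const_vadd k := by
    refine Continuous.subtype_mk (Continuous.prodMk (by fun_prop) ?_) _
    exact (by fun_prop : Continuous fun x : Places => x.1.2).add
      ((continuous_period k).comp (by fun_prop))
  apply_eq_iff_mem_orbit {x x'} := by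
    constructor
    · intro h
      obtain ⟨⟨ω, z⟩, hz⟩ := x
      obtain ⟨⟨ω', z'⟩, hz'⟩ := x'
      have h1 : ω = ω' := congrArg (fun p => p.1.1) h
      subst h1
      have h2 : ω.toPair.toCubic z = ω.toPair.toCubic z' := congrArg (fun p => p.1.2) h
      obtain ⟨k, hk⟩ := ω.mem_lattice_iff.1 (ω.toPair.sub_mem_of_toCubic_eq hz hz' h2)
      refine ⟨k, Subtype.ext (Prod.ext rfl ?_)⟩
      change z' + period _ _ = z
      rw [hk]; ring
    · rintro ⟨k, rfl⟩
      exact Subtype.ext (Prod.ext rfl (x'.1.1.toPair.toCubic_add_coe _ (x'.1.1.period_mem k)))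
  disjoint x := by
    obtain ⟨m, hm, h⟩ := x.1.1.exists_pos_le_norm_period
    refine ⟨Subtype.val ⁻¹' (_ ×ˢ Metric.ball x.1.2 (m / 8)),
      continuous_subtype_val.continuousAt (prod_mem_nhds x.1.1.eventually_norm_period_le
        (Metric.ball_mem_nhds _ (by positivity))), ?_⟩
    rintro k ⟨_, ⟨x', ⟨hω, hd⟩, rfl⟩, ⟨-, hd'⟩⟩
    have hd2 : dist (k +ᵥ x').1.2 x'.1.2 < m / 4 := by
      refine (dist_triangle_right _ _ x.1.2).trans_lt ?_
      linarith [Metric.mem_ball.1 hd, Metric.mem_ball.1 hd']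
    rw [vadd_snd, dist_eq_norm, add_sub_cancel_left] at hd2
    by_contra hk0
    have := h k hk0
    have := hω k
    linarith

lemma isCoveringMap_uniformization : IsCoveringMap uniformization :=
  isAddQuotientCoveringMap_uniformization.isCoveringMap

end OrientedPeriods
end

noncomputable section

/-! ### The Weierstrass zeta function and the addition formula -/

namespace PeriodPair

variable (L : PeriodPair)

/-- The Weierstrass zeta function without its pole at the origin. -/
def zetaRegular (z : ℂ) : ℂ :=
  ∑' l : L.lattice, if (l : ℂ) = 0 then 0 else 1 / (z - l) + 1 / (l : ℂ) + z / (l : ℂ) ^ 2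

lemma norm_zeta_term_le {r : ℝ} (hr : 0 < r) {s : ℂ} (hs : ‖s‖ < r) {l : ℂ} (h : 2 * r ≤ ‖l‖) :
    ‖1 / (s - l) + 1 / l + s / l ^ 2‖ ≤ 2 * r ^ 2 * ‖l‖ ^ (-3 : ℝ) := by
  have hl : 0 < ‖l‖ := by linarith
  have hl0 : l ≠ 0 := norm_pos_iff.1 hl
  have hsl : ‖l‖ / 2 ≤ ‖s - l‖ := by
    rw [norm_sub_rev]
    exact .trans (by linarith) (norm_sub_norm_le l s)
  have hsl0 : s - l ≠ 0 := norm_pos_iff.1 (by linarith)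
  -- The three fractions cancel up to order |l|⁻³, which is summable over a plane lattice.
  have : 1 / (s - l) + 1 / l + s / l ^ 2 = s ^ 2 / ((s - l) * l ^ 2) := by
    field_simp; ring
  rw [this, norm_div, norm_mul, norm_pow, norm_pow]
  calc ‖s‖ ^ 2 / (‖s - l‖ * ‖l‖ ^ 2) ≤ r ^ 2 / (‖l‖ / 2 * ‖l‖ ^ 2) := by gcongr
    _ = 2 * r ^ 2 / ‖l‖ ^ 3 := by field
    _ = _ := by norm_cast

lemma hasSumLocallyUniformly_zetaRegular :
    HasSumLocallyUniformly (fun (l : L.lattice) (z : ℂ) ↦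
      if (l : ℂ) = 0 then 0 else 1 / (z - l) + 1 / (l : ℂ) + z / (l : ℂ) ^ 2) L.zetaRegular := by
  refine L.hasSumLocallyUniformly_aux (u := fun r l => 2 * r ^ 2 * ‖l‖ ^ (-3 : ℝ)) _
    (fun _ _ ↦ (ZLattice.summable_norm_rpow _ _ (by simp; norm_num)).mul_left _) fun r hr ↦
    Filter.eventually_atTop.mpr ⟨2 * r, ?_⟩
  rintro _ h s hs l rfl
  split_ifs
  · simp only [norm_zero]; positivity
  · exact norm_zeta_term_le hr hs h

lemma weierstrassZeta_eq (z : ℂ) : L.weierstrassZeta z = 1 / z + L.zetaRegular z := by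
  have h1 : HasSum (fun l : L.lattice => if l = 0 then 1 / z else 0) (1 / z) :=
    hasSum_ite_eq 0 (1 / z)
  have h2 := (L.hasSumLocallyUniformly_zetaRegular.hasSum (x := z)).add h1
  rw [weierstrassZeta, add_comm, ← h2.tsum_eq]
  refine tsum_congr fun l => ?_
  by_cases hl : l = 0
  · subst hl; simp
  · have : (l : ℂ) ≠ 0 := by simpa using hl
    simp [hl]

lemma hasDerivAt_zeta_term {l z : ℂ} (h : z ≠ l) :
    HasDerivAt (fun z => 1 / (z - l) + 1 / l + z / l ^ 2) (-(1 / (z - l) ^ 2 - 1 / l ^ 2)) z := by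
  have h0 : z - l ≠ 0 := sub_ne_zero.2 h
  have h1 := ((hasDerivAt_id z).sub_const l).inv h0
  have h2 := (h1.add_const (1 / l)).add ((hasDerivAt_id z).div_const (l ^ 2))
  refine (h2.congr_deriv (by simp; ring)).congr_of_eventuallyEq (.of_forall fun w => ?_)
  simp

lemma hasDerivAt_zetaRegular {z : ℂ} (hz : z ∉ (L.lattice : Set ℂ) \ {0}) :
    HasDerivAt L.zetaRegular (-L.weierstrassPExcept 0 z) z := by
  have hterm : ∀ (l : L.lattice) (w : ℂ), w ∈ ((L.lattice : Set ℂ) \ {0})ᶜ →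
      HasDerivAt (fun z : ℂ => if (l : ℂ) = 0 then 0 else
        1 / (z - l) + 1 / (l : ℂ) + z / (l : ℂ) ^ 2)
        (-(if (l : ℂ) = 0 then 0 else (1 / (w - l) ^ 2 - 1 / (l : ℂ) ^ 2))) w := by
    intro l w hw
    by_cases hl : (l : ℂ) = 0
    · simp only [hl, if_true, neg_zero]; exact hasDerivAt_const _ _
    · simp only [hl, if_false]
      exact hasDerivAt_zeta_term fun h => hw ⟨h ▸ l.2, by simpa [h] using hl⟩
  refine hasDerivAt_of_tendstoLocallyUniformlyOn (l := atTop) L.isOpen_compl_lattice_sdiff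
    (f := fun (s : Finset L.lattice) (z : ℂ) => ∑ l ∈ s, if (l : ℂ) = 0 then 0 else
      1 / (z - l) + 1 / (l : ℂ) + z / (l : ℂ) ^ 2)
    (f' := fun (s : Finset L.lattice) (w : ℂ) => ∑ l ∈ s,
      -(if (l : ℂ) = 0 then 0 else (1 / (w - l) ^ 2 - 1 / (l : ℂ) ^ 2)))
    (g' := fun z => -L.weierstrassPExcept 0 z) ?_
    (.of_forall fun s w hw => HasDerivAt.fun_sum fun l _ => hterm l w hw)
    (fun w _ => L.hasSumLocallyUniformly_zetaRegular.hasSum) hz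
  have h2 := (L.hasSumLocallyUniformly_weierstrassPExcept 0).tendstoLocallyUniformlyOn
    (s := ((L.lattice : Set ℂ) \ {0})ᶜ)
  refine h2.neg.congr fun s w _ => ?_
  simp

lemma differentiableAt_zetaRegular {z : ℂ} (hz : z ∉ (L.lattice : Set ℂ) \ {0}) :
    DifferentiableAt ℂ L.zetaRegular z := (L.hasDerivAt_zetaRegular hz).differentiableAt

lemma zetaRegular_zero : L.zetaRegular 0 = 0 := by
  simp [zetaRegular]

lemma hasDerivAt_weierstrassZeta {z : ℂ} (hz : z ∉ L.lattice) :
    HasDerivAt L.weierstrassZeta (-L.weierstrassP z) z := by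
  have hz0 : z ≠ 0 := fun h => hz (h ▸ zero_mem _)
  have h1 := (hasDerivAt_inv hz0).add (L.hasDerivAt_zetaRegular fun h => hz h.1)
  have h3 := L.weierstrassPExcept_add 0 z
  refine (h1.congr_deriv ?_).congr_of_eventuallyEq (.of_forall fun w => ?_)
  · rw [← h3]
    simp
  · rw [weierstrassZeta_eq, one_div]; rfl

lemma weierstrassZeta_neg (z : ℂ) : L.weierstrassZeta (-z) = -L.weierstrassZeta z := by
  rw [weierstrassZeta, weierstrassZeta, ← (Equiv.neg L.lattice).tsum_eq, ← tsum_neg]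
  refine tsum_congr fun l => ?_
  simp only [Equiv.neg_apply, NegMemClass.coe_neg]
  rw [show -z - -(l : ℂ) = -(z - l) by ring, one_div, inv_neg]
  simp only [one_div, inv_neg, even_two, Even.neg_pow, neg_div]
  ring

end PeriodPair
end

noncomputable section

/-! ### The addition formula -/

namespace PeriodPair

variable (L : PeriodPair)

/-- Half of the slope of the line through the points of the cubic with parameters `z` and `-a`. -/
def halfSlope (a z : ℂ) : ℂ :=
  1 / 2 * (L.derivWeierstrassP z + L.derivWeierstrassP a) / (L.weierstrassP z - L.weierstrassP a)

/-- The lattice points and the places where `℘` takes the value `℘ a`. -/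
def slopePoles (a : ℂ) : Set ℂ := {z | z ∈ L.lattice ∨ z - a ∈ L.lattice ∨ z + a ∈ L.lattice}

lemma isClosed_slopePoles (a : ℂ) : IsClosed (L.slopePoles a) :=
  L.isClosed_lattice.union ((L.isClosed_lattice.preimage (by fun_prop : Continuous (· - a))).union
    (L.isClosed_lattice.preimage (by fun_prop : Continuous (· + a))))

lemma countable_slopePoles (a : ℂ) : (L.slopePoles a).Countable :=
  L.countable_lattice.union ((L.countable_lattice.preimage (sub_left_injective)).union
    (L.countable_lattice.preimage (add_left_injective a)))

variable {L} {a : ℂ}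

lemma weierstrassP_ne_of_notMem (ha : a ∉ L.lattice) {z : ℂ} (hz : z ∉ L.slopePoles a) :
    L.weierstrassP z - L.weierstrassP a ≠ 0 := fun h =>
  hz (Or.inr (L.sub_mem_or_add_mem_of_weierstrassP_eq (fun h => hz (Or.inl h)) ha
    (sub_eq_zero.1 h)))

lemma two_mul_halfSlope (ha : a ∉ L.lattice) {z : ℂ} (hz : z ∉ L.slopePoles a) :
    2 * L.halfSlope a z * (L.weierstrassP z - L.weierstrassP a) =
      L.derivWeierstrassP z + L.derivWeierstrassP a := by
  have := weierstrassP_ne_of_notMem ha hz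
  rw [halfSlope]
  field_simp

/-- The difference of the equations of the cubic at z and at a is divisible by ℘(z) - ℘(a).
Cancelling this factor leaves a relation that is still informative in the limit z → a. -/
lemma halfSlope_sq_mul (ha : a ∉ L.lattice) {z : ℂ} (hz : z ∉ L.slopePoles a) :
    L.halfSlope a z ^ 2 * (L.weierstrassP z - L.weierstrassP a) =
      L.halfSlope a z * L.derivWeierstrassP a + L.weierstrassP z ^ 2 +
        L.weierstrassP z * L.weierstrassP a + L.weierstrassP a ^ 2 - L.g₂ / 4 := by
  refine mul_right_cancel₀ (weierstrassP_ne_of_notMem ha hz) ?_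
  have h1 := two_mul_halfSlope ha hz
  have h2 := L.derivWeierstrassP_sq z fun h => hz (Or.inl h)
  have h3 := L.derivWeierstrassP_sq a ha
  linear_combination (1 / 4 * (L.derivWeierstrassP z + L.derivWeierstrassP a) +
    1 / 2 * L.halfSlope a z * (L.weierstrassP z - L.weierstrassP a) -
      1 / 2 * L.derivWeierstrassP a) * h1 + 1 / 4 * h2 - 1 / 4 * h3

/-- A Riccati equation. Once the addition formula is known, its right side is ℘(z) - ℘(z - a), so
the half slope is a primitive that can be compared with zeta functions. -/
lemma hasDerivAt_halfSlope (ha : a ∉ L.lattice) {z : ℂ} (hz : z ∉ L.slopePoles a) :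
    HasDerivAt (L.halfSlope a)
      (2 * L.weierstrassP z + L.weierstrassP a - L.halfSlope a z ^ 2) z := by
  have hzL : z ∉ L.lattice := fun h => hz (Or.inl h)
  have h0 := weierstrassP_ne_of_notMem ha hz
  have h1 := (((L.hasDerivAt_derivWeierstrassP hzL).add_const (L.derivWeierstrassP a)).const_mul
    (1 / 2)).div ((L.hasDerivAt_weierstrassP hzL).sub_const (L.weierstrassP a)) h0
  refine h1.congr_deriv ?_
  rw [div_eq_iff (pow_ne_zero 2 h0)]
  have h1 := two_mul_halfSlope ha hz
  have h2 := L.derivWeierstrassP_sq z hzL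
  have h3 := L.derivWeierstrassP_sq a ha
  linear_combination (1 / 2 * L.halfSlope a z * (L.weierstrassP z - L.weierstrassP a) +
    1 / 4 * (L.derivWeierstrassP z + L.derivWeierstrassP a)) * h1 - 1 / 4 * h2 + 1 / 4 * h3

/-- The third point of intersection of the line with slope `2 * halfSlope` with the cubic. -/
def thirdPoint (L : PeriodPair) (a z : ℂ) : ℂ × ℂ :=
  (L.halfSlope a z ^ 2 - L.weierstrassP z - L.weierstrassP a,
    2 * L.halfSlope a z * (2 * L.weierstrassP z + L.weierstrassP a - L.halfSlope a z ^ 2) -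
      L.derivWeierstrassP z)

/-- By the Riccati equation the second coordinate of the third point is the derivative of the first;
only the second order equation needs the relations of the secant line. -/
lemma isComplexSolution_thirdPoint (ha : a ∉ L.lattice) :
    IsComplexSolution (weierstrassField L.g₂) (L.slopePoles a) (L.thirdPoint a) where
  contDiff := contDiff_weierstrassField _
  isClosed := L.isClosed_slopePoles a
  countable := L.countable_slopePoles a
  hasDerivAt z hz := by
    have hzL : z ∉ L.lattice := fun h => hz (Or.inl h)
    have hs := hasDerivAt_halfSlope ha hz
    have hp := L.hasDerivAt_weierstrassP hzL
    have hp' := L.hasDerivAt_derivWeierstrassP hzL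
    have h1 := ((hs.pow 2).sub hp).sub_const (L.weierstrassP a)
    have h2 := ((hs.const_mul 2).mul (((hp.const_mul 2).add_const (L.weierstrassP a)).sub
      (hs.pow 2))).sub hp'
    have e1 := two_mul_halfSlope ha hz
    have e2 := halfSlope_sq_mul ha hz
    refine (h1.prodMk h2).congr_deriv (Prod.ext ?_ ?_)
    · simp [weierstrassField, thirdPoint]
    · simp [weierstrassField, thirdPoint]
      linear_combination 4 * e2 - 4 * L.halfSlope a z * e1

lemma thirdPoint_mem (ha : a ∉ L.lattice) {z : ℂ} (hz : z ∉ L.slopePoles a) :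
    (L.thirdPoint a z).2 ^ 2 =
      4 * (L.thirdPoint a z).1 ^ 3 - L.g₂ * (L.thirdPoint a z).1 - L.g₃ := by
  have e1 := two_mul_halfSlope ha hz
  have e2 := halfSlope_sq_mul ha hz
  have e3 := L.derivWeierstrassP_sq a ha
  simp only [thirdPoint]
  -- The relations are linear in ℘'(z), g₂ and g₃. After elimination the claim is a polynomial
  -- identity in ℘(z), ℘(a), ℘'(a) and the half slope.
  have h1 : L.derivWeierstrassP z = 2 * L.halfSlope a z *
    (L.weierstrassP z - L.weierstrassP a) - L.derivWeierstrassP a := by linear_combination -e1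
  have h2 : L.g₂ = 4 * (L.halfSlope a z * L.derivWeierstrassP a + L.weierstrassP z ^ 2 +
    L.weierstrassP z * L.weierstrassP a + L.weierstrassP a ^ 2 -
      L.halfSlope a z ^ 2 * (L.weierstrassP z - L.weierstrassP a)) := by linear_combination 4 * e2
  have h3 : L.g₃ = 4 * L.weierstrassP a ^ 3 - L.g₂ * L.weierstrassP a -
    L.derivWeierstrassP a ^ 2 := by linear_combination e3
  rw [h3, h2, h1]
  ring

lemma nhdsNE_eventually_notMem_slopePoles (a z : ℂ) : ∀ᶠ w in 𝓝[≠] z, w ∉ L.slopePoles a := by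
  have key : ∀ c : ℂ, ∀ᶠ w in 𝓝[≠] z, w + c ∉ L.lattice := by
    intro c
    have h1 : Tendsto (fun w => w + c) (𝓝[≠] z) (𝓝[≠] (z + c)) := by
      refine tendsto_nhdsWithin_iff.2 ⟨?_, ?_⟩
      · exact (by fun_prop : Continuous fun w => w + c).continuousAt.tendsto.mono_left
          nhdsWithin_le_nhds
      · filter_upwards [self_mem_nhdsWithin] with w hw
        simpa using hw
    exact h1.eventually (L.nhdsNE_eventually_notMem_lattice _)
  filter_upwards [key 0, key (-a), key a] with w h1 h2 h3
  rintro (h | h | h)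
  · exact h1 (by simpa using h)
  · exact h2 (by simpa [sub_eq_add_neg] using h)
  · exact h3 h

/-- A finite limit would force ℘'(a) = 0, as ℘(z) - ℘(a) → 0, and then 12 ℘(a)² = g₂ by the
cancelled relation `halfSlope_sq_mul`, that is, a double root of the cubic. -/
lemma not_tendsto_halfSlope_sq (ha : a ∉ L.lattice) (m : ℂ) :
    ¬ Tendsto (fun z => L.halfSlope a z ^ 2) (𝓝[≠] a) (𝓝 m) := by
  intro h
  have hp : Tendsto L.weierstrassP (𝓝[≠] a) (𝓝 (L.weierstrassP a)) :=
    (L.hasDerivAt_weierstrassP ha).continuousAt.tendsto.mono_left nhdsWithin_le_nhds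
  have hp' : Tendsto L.derivWeierstrassP (𝓝[≠] a) (𝓝 (L.derivWeierstrassP a)) :=
    (L.hasDerivAt_derivWeierstrassP ha).continuousAt.tendsto.mono_left nhdsWithin_le_nhds
  have hev := nhdsNE_eventually_notMem_slopePoles (L := L) a a
  have h1 : Tendsto (fun z => (L.derivWeierstrassP z + L.derivWeierstrassP a) ^ 2) (𝓝[≠] a)
      (𝓝 (4 * m * (L.weierstrassP a - L.weierstrassP a) ^ 2)) := by
    refine ((h.const_mul 4).mul ((hp.sub_const (L.weierstrassP a)).pow 2)).congr' ?_
    filter_upwards [hev] with z hz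
    rw [← two_mul_halfSlope ha hz]
    ring
  have h2 := tendsto_nhds_unique h1 ((hp'.add_const (L.derivWeierstrassP a)).pow 2)
  have hB : L.derivWeierstrassP a = 0 := by
    have h3 : (L.derivWeierstrassP a + L.derivWeierstrassP a) ^ 2 = 0 := by rw [← h2]; ring
    have := pow_eq_zero_iff (two_ne_zero) |>.1 h3
    linear_combination this / 2
  have h3 : Tendsto (fun z => L.weierstrassP z ^ 2 + L.weierstrassP z * L.weierstrassP a +
      L.weierstrassP a ^ 2 - L.g₂ / 4) (𝓝[≠] a)
      (𝓝 (m * (L.weierstrassP a - L.weierstrassP a))) := by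
    refine (h.mul (hp.sub_const (L.weierstrassP a))).congr' ?_
    filter_upwards [hev] with z hz
    rw [halfSlope_sq_mul ha hz, hB]
    ring
  have h4 := tendsto_nhds_unique h3 ((((hp.pow 2).add (hp.mul_const (L.weierstrassP a))).add_const
    (L.weierstrassP a ^ 2)).sub_const (L.g₂ / 4))
  exact L.simple_root ha hB (by linear_combination -4 * h4)

/-- The addition formula for the Weierstrass function. -/
lemma thirdPoint_eq (ha : a ∉ L.lattice) {z : ℂ} (hz : z ∉ L.slopePoles a) :
    L.thirdPoint a z = L.toCubic (z - a) := by
  obtain ⟨z₀, hz₀⟩ : (L.slopePoles a)ᶜ.Nonempty :=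
    ((L.countable_slopePoles a).dense_compl ℝ).nonempty
  obtain ⟨w, hw, hwe⟩ := L.exists_toCubic_eq (thirdPoint_mem ha hz₀)
  have h1 : ∀ z ∉ L.slopePoles a, z + (w - z₀) ∉ L.lattice →
      L.thirdPoint a z = L.toCubic (z + (w - z₀)) := by
    intro z hz hz'
    have := (isComplexSolution_thirdPoint ha).eq_of_eq L.isComplexFlow_toCubic.toIsComplexSolution
      hz₀ hw hwe.symm (z - z₀) (by simpa using hz) (by rwa [show w + (z - z₀) = z + (w - z₀) by ring])
    rwa [add_sub_cancel, show w + (z - z₀) = z + (w - z₀) by ring] at this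
  set c := w - z₀
  -- The third point is (℘, ℘') translated by some c. At z = a its abscissa has no finite limit, so
  -- a + c must be a pole, which fixes c modulo the lattice.
  have hc : a + c ∈ L.lattice := by
    by_contra hc
    have t0 : Tendsto (fun z : ℂ => z + c) (𝓝[≠] a) (𝓝 (a + c)) :=
      (by fun_prop : Continuous fun z : ℂ => z + c).continuousAt.tendsto.mono_left
        nhdsWithin_le_nhds
    have t1 := (L.hasDerivAt_weierstrassP hc).continuousAt.tendsto.comp t0
    have hp : Tendsto L.weierstrassP (𝓝[≠] a) (𝓝 (L.weierstrassP a)) :=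
      (L.hasDerivAt_weierstrassP ha).continuousAt.tendsto.mono_left nhdsWithin_le_nhds
    refine not_tendsto_halfSlope_sq ha _ (((t1.add hp).add_const (L.weierstrassP a)).congr' ?_)
    filter_upwards [nhdsNE_eventually_notMem_slopePoles (L := L) a a,
      t0.eventually (L.isClosed_lattice.isOpen_compl.mem_nhds hc)] with z hz hz'
    have := congrArg Prod.fst (h1 z hz hz')
    simp only [thirdPoint, toCubic] at this
    simp only [Function.comp_apply]
    linear_combination -this
  have e : z + c = z - a + (a + c) := by ring
  rw [h1 z hz, e, L.toCubic_add_coe _ hc]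
  rw [e]
  exact fun h => hz (Or.inr (Or.inl ((L.lattice.add_mem_iff_left hc).1 h)))

/-- The difference of two translates of the zeta function, vanishing in the limit at the poles
after removal of the principal part. -/
def zetaDiff (L : PeriodPair) (a z : ℂ) : ℂ :=
  L.weierstrassZeta z - L.weierstrassZeta (z - a) - L.weierstrassZeta a

lemma hasDerivAt_zetaDiff {z : ℂ} (hz : z ∉ L.lattice) (hza : z - a ∉ L.lattice) :
    HasDerivAt (L.zetaDiff a) (-L.weierstrassP z + L.weierstrassP (z - a)) z := by
  have h1 := ((L.hasDerivAt_weierstrassZeta hz).sub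
    ((L.hasDerivAt_weierstrassZeta hza).comp_sub_const z a)).sub_const (L.weierstrassZeta a)
  exact h1.congr_deriv (by ring)

/-- From ℘ ≈ z⁻² and ℘' ≈ -2 z⁻³ the half slope is -1 / z without a constant term. This fixes the
constant of integration in the comparison with the zeta function. -/
lemma tendsto_inv_add_halfSlope (L : PeriodPair) (a : ℂ) :
    Tendsto (fun z => 1 / z + L.halfSlope a z) (𝓝[≠] 0) (𝓝 0) := by
  have hmem := L.compl_lattice_sdiff_singleton_mem_nhds 0
  have hr : ContinuousAt (L.weierstrassPExcept 0) 0 :=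
    ((L.differentiableOn_weierstrassPExcept 0).differentiableAt hmem).continuousAt
  have hr' : ContinuousAt (L.derivWeierstrassPExcept 0) 0 :=
    ((L.differentiableOn_derivWeierstrassPExcept 0).differentiableAt hmem).continuousAt
  set b := L.weierstrassP a
  set B := L.derivWeierstrassP a
  have hd : ContinuousAt (fun z => 1 + z ^ 2 * (L.weierstrassPExcept 0 z - b)) 0 := by fun_prop
  have h1 : ContinuousAt (fun z => (z * (L.weierstrassPExcept 0 z - b) +
      1 / 2 * z ^ 2 * (L.derivWeierstrassPExcept 0 z + B)) /
      (1 + z ^ 2 * (L.weierstrassPExcept 0 z - b))) 0 :=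
    ContinuousAt.div (by fun_prop) hd (by simp)
  have h2 := h1.tendsto.mono_left (nhdsWithin_le_nhds (s := {0}ᶜ))
  have h3 : ∀ᶠ z in 𝓝[≠] (0 : ℂ), 1 + z ^ 2 * (L.weierstrassPExcept 0 z - b) ≠ 0 :=
    nhdsWithin_le_nhds (hd.eventually_ne (by simp))
  simp only [zero_mul, ne_eq, OfNat.ofNat_ne_zero, not_false_eq_true, zero_pow, mul_zero, add_zero,
    zero_div] at h2
  refine h2.congr' ?_
  filter_upwards [h3, self_mem_nhdsWithin] with z hz hz0
  have hz0 : z ≠ 0 := hz0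
  have e1 := L.weierstrassPExcept_add 0 z
  have e2 := L.derivWeierstrassPExcept_sub 0 z
  simp only [ZeroMemClass.coe_zero, sub_zero] at e1 e2
  have e3 : L.weierstrassP z - b = (1 + z ^ 2 * (L.weierstrassPExcept 0 z - b)) / z ^ 2 := by
    rw [← e1]; field_simp; ring
  rw [halfSlope, e3, ← e2]
  field_simp
  ring

/-- The zeta function expresses the slope of a line through two points of the cubic. -/
lemma zetaDiff_eq (ha : a ∉ L.lattice) {z : ℂ} (hz : z ∉ L.slopePoles a) :
    L.zetaDiff a z = -L.halfSlope a z := by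
  -- The Riccati equation and the addition formula make the derivative of the sum vanish.
  have hd : ∀ z ∉ L.slopePoles a,
      HasDerivAt (fun z => L.zetaDiff a z + L.halfSlope a z) 0 z := by
    intro z hz
    have h1 := (hasDerivAt_zetaDiff (a := a) (fun h => hz (Or.inl h))
      fun h => hz (Or.inr (Or.inl h))).add (hasDerivAt_halfSlope ha hz)
    refine h1.congr_deriv ?_
    have := congrArg Prod.fst (thirdPoint_eq ha hz)
    simp only [thirdPoint, toCubic] at this
    linear_combination -this
  obtain ⟨m, hm⟩ := (L.isClosed_slopePoles a).isOpen_compl.exists_is_const_of_deriv_eq_zero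
    (countable_isPreconnected_compl (L.countable_slopePoles a))
    (fun z hz => (hd z hz).differentiableAt.differentiableWithinAt) (fun z hz => (hd z hz).deriv)
  have h0 : Tendsto (fun z => L.zetaDiff a z + L.halfSlope a z) (𝓝[≠] 0) (𝓝 0) := by
    have hc1 : ContinuousAt L.zetaRegular 0 :=
      (L.differentiableAt_zetaRegular (by simp)).continuousAt
    have hc2 : ContinuousAt (fun z => L.weierstrassZeta (z - a)) 0 := by
      have : (-a) ∉ L.lattice := by simpa using ha
      refine ContinuousAt.comp (f := fun z : ℂ => z - a) (g := L.weierstrassZeta) (x := (0 : ℂ))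
        ?_ (by fun_prop)
      rw [zero_sub]
      exact (L.hasDerivAt_weierstrassZeta this).continuousAt
    have h1 : Tendsto (fun z => L.zetaRegular z - L.weierstrassZeta (z - a) - L.weierstrassZeta a)
        (𝓝[≠] 0) (𝓝 0) := by
      have := ((hc1.sub hc2).tendsto.sub_const (L.weierstrassZeta a)).mono_left
        (nhdsWithin_le_nhds (s := {0}ᶜ))
      simpa [zetaRegular_zero, weierstrassZeta_neg] using this
    have h2 := h1.add (L.tendsto_inv_add_halfSlope a)
    rw [add_zero] at h2
    refine h2.congr fun z => ?_
    rw [zetaDiff, L.weierstrassZeta_eq z]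
    ring
  have hm0 : m = 0 := by
    refine tendsto_nhds_unique (tendsto_const_nhds.congr' ?_) h0
    filter_upwards [nhdsNE_eventually_notMem_slopePoles (L := L) a 0] with z hz
    exact (hm z hz).symm
  have := hm z hz
  rw [hm0] at this
  linear_combination this

/-- The addition formula extended by continuity to z ≡ -a, where the quotient defining the half
slope is 0 / 0 while the zeta expression stays meaningful. -/
lemma zetaDiff_sq (ha : a ∉ L.lattice) {z : ℂ} (hz : z ∉ L.lattice) (hza : z - a ∉ L.lattice) :
    L.zetaDiff a z ^ 2 = L.weierstrassP z + L.weierstrassP a + L.weierstrassP (z - a) := by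
  have h1 : ContinuousAt (fun z => L.zetaDiff a z ^ 2 -
      (L.weierstrassP z + L.weierstrassP a + L.weierstrassP (z - a))) z := by
    have c1 := (hasDerivAt_zetaDiff hz hza).continuousAt
    have c2 := (L.hasDerivAt_weierstrassP hz).continuousAt
    have c3 := ((L.hasDerivAt_weierstrassP hza).comp_sub_const z a).continuousAt
    fun_prop
  refine sub_eq_zero.1 (tendsto_nhds_unique (h1.tendsto.mono_left
    (nhdsWithin_le_nhds (s := {z}ᶜ))) (tendsto_const_nhds.congr' ?_))
  filter_upwards [nhdsNE_eventually_notMem_slopePoles (L := L) a z] with w hw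
  have := congrArg Prod.fst (thirdPoint_eq ha hw)
  simp only [thirdPoint, toCubic] at this
  rw [zetaDiff_eq ha hw]
  linear_combination -this

lemma two_mul_zetaDiff (ha : a ∉ L.lattice) {z : ℂ} (hz : z ∉ L.lattice)
    (hza : z - a ∉ L.lattice) : 2 * L.zetaDiff a z * (L.weierstrassP z - L.weierstrassP a) =
      -(L.derivWeierstrassP z + L.derivWeierstrassP a) := by
  by_cases h : z + a ∈ L.lattice
  · have h1 : L.toCubic z = L.toCubic (-a) := by
      rw [← L.toCubic_add_coe (-a) h]; congr 1; ring
    rw [Prod.ext_iff] at h1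
    simp only [toCubic, L.weierstrassP_neg, L.derivWeierstrassP_neg] at h1
    rw [h1.1, h1.2]
    ring
  · have h1 : z ∉ L.slopePoles a := by rintro (h' | h' | h') <;> contradiction
    rw [zetaDiff_eq ha h1]
    linear_combination -two_mul_halfSlope ha h1

/-- The slope at the place where the line is tangent to the cubic. -/
lemma two_mul_zetaDiff_neg (ha : a ∉ L.lattice) (h2a : 2 * a ∉ L.lattice) :
    2 * L.zetaDiff a (-a) * L.derivWeierstrassP a = 6 * L.weierstrassP a ^ 2 - L.g₂ / 2 := by
  have hz : -a ∉ L.lattice := by simpa using ha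
  have hza : -a - a ∉ L.lattice := by
    rw [show -a - a = -(2 * a) by ring]; simpa using h2a
  -- At z = -a the factor ℘(z) - ℘(a) vanishes, so the slope is recovered by differentiating the
  -- relation there.
  have hd1 := ((hasDerivAt_zetaDiff hz hza).const_mul 2).mul
    ((L.hasDerivAt_weierstrassP hz).sub_const (L.weierstrassP a))
  have hd2 := ((L.hasDerivAt_derivWeierstrassP hz).add_const (L.derivWeierstrassP a)).neg
  have heq : (fun z => 2 * L.zetaDiff a z * (L.weierstrassP z - L.weierstrassP a)) =ᶠ[𝓝 (-a)]
      fun z => -(L.derivWeierstrassP z + L.derivWeierstrassP a) := by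
    filter_upwards [L.isClosed_lattice.isOpen_compl.mem_nhds hz,
      (by fun_prop : Continuous fun z : ℂ => z - a).continuousAt
        (L.isClosed_lattice.isOpen_compl.mem_nhds hza)] with z h1 h2
    exact two_mul_zetaDiff ha h1 h2
  have := hd1.unique (hd2.congr_of_eventuallyEq heq)
  rw [L.weierstrassP_neg, L.derivWeierstrassP_neg] at this
  linear_combination -this

end PeriodPair
end

noncomputable section

/-! ### The vector field dual to the residue form -/

namespace EllipticFamily

variable {T : DihedralType} {g P v : ℂ × ℂ}

/-- The vector field `(∂F/∂y, -∂F/∂x)`. -/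
def hamiltonianField : DihedralType → ℂ × ℂ → ℂ × ℂ → ℂ × ℂ
  | .A2, g, P => (2 * P.2, 12 * P.1 ^ 2 - g.1)
  | .B2, g, P => (2 * P.2, 4 * P.1 ^ 3 - 2 * g.1 * P.1)
  | .G2, g, P => (2 * (P.1 + g.1) * P.2, 3 * P.1 ^ 2 - P.2 ^ 2 - 6 * g.1 * P.1)

lemma contDiff_hamiltonianField (T : DihedralType) (g : ℂ × ℂ) :
    ContDiff ℝ 1 (hamiltonianField T g) := by
  cases T <;> unfold hamiltonianField <;> fun_prop

lemma hasFDerivAt_F (T : DihedralType) (g P : ℂ × ℂ) :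
    HasFDerivAt (𝕜 := ℂ) (fun Q : ℂ × ℂ => F T Q.1 Q.2 g)
      ((-(hamiltonianField T g P).2) • ContinuousLinearMap.fst ℂ ℂ ℂ +
        (hamiltonianField T g P).1 • ContinuousLinearMap.snd ℂ ℂ ℂ) P := by
  have hx : HasFDerivAt (𝕜 := ℂ) (fun Q : ℂ × ℂ => Q.1) (ContinuousLinearMap.fst ℂ ℂ ℂ) P :=
    hasFDerivAt_fst
  have hy : HasFDerivAt (𝕜 := ℂ) (fun Q : ℂ × ℂ => Q.2) (ContinuousLinearMap.snd ℂ ℂ ℂ) P :=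
    hasFDerivAt_snd
  cases T
  · refine ((hy.pow 2).sub ((((hx.pow 3).const_mul 4).sub (hx.const_mul g.1)).sub_const
      g.2)).congr_fderiv ?_
    ext <;> (simp [hamiltonianField]; try ring)
  · refine ((hy.pow 2).sub ((((hx.pow 4).sub ((hx.pow 2).const_mul g.1)).add_const g.2).add_const
      (g.1 ^ 2 / 8))).congr_fderiv ?_
    ext <;> (simp [hamiltonianField]; try ring)
  · refine (((hx.mul ((hy.pow 2).sub (hx.pow 2))).add ((((hx.pow 2).const_mul 3).add
      (hy.pow 2)).const_mul g.1)).sub_const g.2 |>.sub_const (2 * g.1 ^ 3)).congr_fderiv ?_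
    ext <;> (simp [hamiltonianField]; try ring)

lemma dFy_eq (T : DihedralType) (g P : ℂ × ℂ) : dFy T g P = (hamiltonianField T g P).1 := by
  have h := (hasFDerivAt_F T g P).comp_hasDerivAt P.2
    ((hasDerivAt_const P.2 P.1).prodMk (hasDerivAt_id P.2))
  refine (show deriv _ _ = _ from h.deriv).trans ?_
  simp

lemma dFx_eq (T : DihedralType) (g P : ℂ × ℂ) : dFx T g P = -(hamiltonianField T g P).2 := by
  have h := (hasFDerivAt_F T g P).comp_hasDerivAt P.1
    ((hasDerivAt_id P.1).prodMk (hasDerivAt_const P.1 P.2))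
  refine (show deriv _ _ = _ from h.deriv).trans ?_
  simp

/-- The curves off the discriminant are smooth. -/
lemma hamiltonianField_ne_zero (hg : discriminant T g ≠ 0) (hP : P ∈ curve T g) :
    hamiltonianField T g P ≠ 0 := by
  intro h
  obtain ⟨x, y⟩ := P
  obtain ⟨gs, gl⟩ := g
  rw [Prod.ext_iff] at h
  apply hg
  cases T
  · simp only [hamiltonianField, curve, F, mem_ofPred_eq, discriminant, Prod.fst_zero,
      Prod.snd_zero] at h hP ⊢
    have hy : y = 0 := by linear_combination h.1 / 2
    have hs : gs = 12 * x ^ 2 := by linear_combination -h.2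
    have hl : gl = -8 * x ^ 3 := by
      rw [hy, hs] at hP; linear_combination hP
    rw [hs, hl]; ring
  · simp only [hamiltonianField, curve, F, mem_ofPred_eq, discriminant, Prod.fst_zero,
      Prod.snd_zero] at h hP ⊢
    have hy : y = 0 := by linear_combination h.1 / 2
    rw [hy] at hP
    have h2 : x * (2 * x ^ 2 - gs) = 0 := by linear_combination h.2 / 2
    rcases mul_eq_zero.1 h2 with h3 | h3
    · rw [h3] at hP
      have : 8 * gl + gs ^ 2 = 0 := by linear_combination -8 * hP
      rw [this, zero_mul]
    · have hs : gs = 2 * x ^ 2 := by linear_combination -h3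
      have : -8 * gl + gs ^ 2 = 0 := by
        rw [hs] at hP ⊢; linear_combination 8 * hP
      rw [this]; ring
  -- The critical points are (-g_s, ±3 g_s), (0, 0) and (2 g_s, 0). The first two and the last lie
  -- on the same level, which accounts for the cube in the discriminant.
  · simp only [hamiltonianField, curve, F, mem_ofPred_eq, discriminant, Prod.fst_zero,
      Prod.snd_zero] at h hP ⊢
    have h1 : (x + gs) * y = 0 := by linear_combination h.1 / 2
    have h2 := h.2
    rcases mul_eq_zero.1 h1 with h3 | h3
    · have hx : x = -gs := by linear_combination h3
      have : -gl + 2 * gs ^ 3 = 0 := by rw [hx] at hP; linear_combination hP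
      rw [this]; ring
    · rw [h3] at hP h2
      have h4 : x * (x - 2 * gs) = 0 := by linear_combination h2 / 3
      rcases mul_eq_zero.1 h4 with h5 | h5
      · rw [h5] at hP
        have : gl + 2 * gs ^ 3 = 0 := by linear_combination -hP
        rw [this]; ring
      · have hx : x = 2 * gs := by linear_combination h5
        have : -gl + 2 * gs ^ 3 = 0 := by rw [hx] at hP; linear_combination hP
        rw [this]; ring

/-- The residue form is 1 on the vector field, so complex time of the flow is the integral of the
form. -/
lemma primitiveForm_smul (h : hamiltonianField T g P ≠ 0) (c : ℂ) :
    primitiveForm T g P (c • hamiltonianField T g P) = c := by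
  rw [primitiveForm, dFy_eq, dFx_eq]
  split_ifs with h1
  · simp [h1]
  · have h2 : (hamiltonianField T g P).2 ≠ 0 := fun h2 => h (Prod.ext (by simpa using h1) h2)
    simp [h2]

/-- A tangent vector is determined by its value under the residue form. -/
lemma primitiveForm_smul_eq (h : hamiltonianField T g P ≠ 0)
    (hv : (hamiltonianField T g P).1 * v.2 = (hamiltonianField T g P).2 * v.1) :
    primitiveForm T g P v • hamiltonianField T g P = v := by
  rw [primitiveForm, dFy_eq, dFx_eq]
  split_ifs with h1
  · refine Prod.ext ?_ ?_
    · simp [h1]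
    · simp only [Prod.smul_snd, smul_eq_mul]; field_simp; linear_combination -hv
  · have h1' : (hamiltonianField T g P).1 = 0 := by simpa using h1
    have h2 : (hamiltonianField T g P).2 ≠ 0 := fun h2 => h (Prod.ext h1' h2)
    rw [h1', zero_mul, eq_comm, mul_eq_zero] at hv
    have h3 := hv.resolve_left h2
    refine Prod.ext ?_ ?_
    · simp [h1', h3]
    · simp [h2]

-- An expression of the residue form by orthogonal projection onto the field, free of the case
-- distinction in the definition; it makes the form visibly continuous along paths.
open ComplexConjugate in
lemma primitiveForm_eq_div (h : hamiltonianField T g P ≠ 0)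
    (hv : (hamiltonianField T g P).1 * v.2 = (hamiltonianField T g P).2 * v.1) :
    primitiveForm T g P v =
      (v.1 * conj (hamiltonianField T g P).1 + v.2 * conj (hamiltonianField T g P).2) /
        ((hamiltonianField T g P).1 * conj (hamiltonianField T g P).1 +
          (hamiltonianField T g P).2 * conj (hamiltonianField T g P).2) := by
  have h1 := primitiveForm_smul_eq h hv
  set V := hamiltonianField T g P
  have h0 : V.1 * conj V.1 + V.2 * conj V.2 ≠ 0 := by
    rw [Complex.mul_conj, Complex.mul_conj]
    norm_cast
    intro h2
    apply h
    have a1 := Complex.normSq_nonneg V.1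
    have a2 := Complex.normSq_nonneg V.2
    exact Prod.ext (Complex.normSq_eq_zero.1 (by linarith))
      (Complex.normSq_eq_zero.1 (by linarith))
  rw [eq_div_iff h0]
  nth_rewrite 2 [← h1]
  nth_rewrite 3 [← h1]
  simp only [Prod.smul_fst, Prod.smul_snd, smul_eq_mul]
  ring

/-- Velocities of paths in the curve are tangent to the curve. -/
lemma tangent_of_hasDerivWithinAt {c : ℝ → ℂ × ℂ} {s : ℝ} {I : Set ℝ}
    (hI : UniqueDiffWithinAt ℝ I s) (hs : s ∈ I) (hc : ∀ t ∈ I, c t ∈ curve T g)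
    (h : HasDerivWithinAt c v I s) :
    (hamiltonianField T g (c s)).1 * v.2 = (hamiltonianField T g (c s)).2 * v.1 := by
  have h1 := ((hasFDerivAt_F T g (c s)).restrictScalars ℝ).comp_hasDerivWithinAt s h
  have h2 : HasDerivWithinAt (fun t => F T (c t).1 (c t).2 g) 0 I s :=
    (hasDerivWithinAt_const s I (0 : ℂ)).congr (fun t ht => hc t ht) (hc s hs)
  have h3 := hI.eq_deriv _ h1 h2
  simp at h3
  linear_combination h3

end EllipticFamily
end

noncomputable section

/-! ### The uniformization of the curves -/

namespace EllipticFamily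

variable {T : DihedralType} {g P : ℂ × ℂ} {L : PeriodPair} {a : ℂ}

/-- The invariants of the Weierstrass cubic isogenous to the curve. -/
def cubicInvariants : DihedralType → ℂ × ℂ → ℂ × ℂ
  | .A2, g => (16 * g.1, 64 * g.2)
  | .B2, g => (10 / 3 * g.1 ^ 2 + 16 * g.2, -(28 / 27) * g.1 ^ 3 - 32 / 3 * g.1 * g.2)
  | .G2, g => (60 * g.1 ^ 4 + 24 * g.1 * g.2,
      -88 * g.1 ^ 6 - 56 * g.1 ^ 3 * g.2 - 4 * g.2 ^ 2)

lemma cubicInvariants_discriminant (hg : discriminant T g ≠ 0) :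
    (cubicInvariants T g).1 ^ 3 - 27 * (cubicInvariants T g).2 ^ 2 ≠ 0 := by
  have h : ∃ c : ℂ, c ≠ 0 ∧ (cubicInvariants T g).1 ^ 3 - 27 * (cubicInvariants T g).2 ^ 2 =
      c * discriminant T g := by
    cases T
    · exact ⟨4096, by norm_num, by simp only [cubicInvariants, discriminant]; ring⟩
    · exact ⟨8, by norm_num, by simp only [cubicInvariants, discriminant]; ring⟩
    · exact ⟨432, by norm_num, by simp only [cubicInvariants, discriminant]; ring⟩
  obtain ⟨c, hc, h⟩ := h
  rw [h]
  exact mul_ne_zero hc hg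

lemma continuous_cubicInvariants (T : DihedralType) : Continuous (cubicInvariants T) := by
  cases T <;> unfold cubicInvariants <;> fun_prop

/-- The map from the curve to the Weierstrass cubic. -/
def cubicMap : DihedralType → ℂ × ℂ → ℂ × ℂ → ℂ × ℂ
  | .A2, _, P => (4 * P.1, 8 * P.2)
  | .B2, g, P => (2 * P.1 ^ 2 - 2 * P.2 - g.1 / 3,
      -4 * P.1 * (2 * P.1 ^ 2 - 2 * P.2 - g.1))
  | .G2, g, P => (2 * (P.1 + g.1) * (P.1 - P.2 - 2 * g.1) + 3 * g.1 ^ 2,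
      2 * (P.1 + g.1) * (P.1 - P.2 - 2 * g.1) * (P.2 - 3 * P.1))

lemma continuous_cubicMap (T : DihedralType) :
    Continuous fun x : (ℂ × ℂ) × (ℂ × ℂ) => cubicMap T x.1 x.2 := by
  cases T <;> unfold cubicMap <;> fun_prop

/-- The map `cubicMap` is obtained by solving the formulas of `uniformization` for ℘ and ℘'. For
type B₂ the half slope is -2x; for type G₂ the half slopes for a and -a are g_s - 2x and y - x -
g_s. -/
lemma cubicMap_mem (hP : P ∈ curve T g) : (cubicMap T g P).2 ^ 2 =
    4 * (cubicMap T g P).1 ^ 3 - (cubicInvariants T g).1 * (cubicMap T g P).1 -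
      (cubicInvariants T g).2 := by
  obtain ⟨x, y⟩ := P
  obtain ⟨gs, gl⟩ := g
  cases T <;> simp only [curve, F, mem_ofPred_eq, cubicMap, cubicInvariants] at hP ⊢
  · linear_combination 64 * hP
  · linear_combination -16 * (2 * x ^ 2 - 2 * y - gs) * hP
  · linear_combination (4 * gl + 4 * ((x + gs) * (y ^ 2 - (x - 2 * gs) ^ 2) + 2 * gs ^ 3) -
      24 * gs * (2 * (x + gs) * (x - y - 2 * gs) + 3 * gs ^ 2) + 56 * gs ^ 3) * hP

/-- The torsion point of the Weierstrass cubic that generates the kernel of the dual isogeny. -/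
def torsionPoint (T : DihedralType) (g : ℂ × ℂ) : ℂ × ℂ :=
  match T with
  | .A2 => 0
  | .B2 => (2 / 3 * g.1, 0)
  | .G2 => (3 * g.1 ^ 2, 2 * (g.2 - 2 * g.1 ^ 3))

lemma continuous_torsionPoint (T : DihedralType) : Continuous (torsionPoint T) := by
  cases T <;> unfold torsionPoint <;> fun_prop

lemma torsionPoint_mem (hT : T ≠ .A2) : (torsionPoint T g).2 ^ 2 =
    4 * (torsionPoint T g).1 ^ 3 - (cubicInvariants T g).1 * (torsionPoint T g).1 -
      (cubicInvariants T g).2 := by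
  cases T
  · exact absurd rfl hT
  · simp only [torsionPoint, cubicInvariants]; ring
  · simp only [torsionPoint, cubicInvariants]; ring

/-- `Φ` uniformizes the affine curve by the complement of the set `S` of the places at infinity,
`0` being a place of `∞₁`, and the isogeny to the Weierstrass cubic of `L` is the identity in
terms of the parameters. -/
structure IsUniformization (T : DihedralType) (g : ℂ × ℂ) (L : PeriodPair) (S : Set ℂ)
    (Φ : ℂ → ℂ × ℂ) : Prop extends IsComplexFlow (hamiltonianField T g) S Φ where
  mem_curve : ∀ z ∉ S, Φ z ∈ curve T g
  exists_eq : ∀ P ∈ curve T g, ∃ z ∉ S, Φ z = P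
  cubicMap_eq : ∀ z ∉ S, cubicMap T g (Φ z) = L.toCubic z
  lattice_subset : ∀ z ∈ L.lattice, z ∈ S
  add_mem_iff : ∀ z, ∀ l ∈ L.lattice, z + l ∈ S ↔ z ∈ S
  apply_add : ∀ z, ∀ l ∈ L.lattice, Φ (z + l) = Φ z
  tendsto_zero : Tendsto Φ (𝓝[Sᶜ] 0) (nhdsInfinityOne T)
  disjoint : ∀ s ∈ S, s ∉ L.lattice → Disjoint (map Φ (𝓝[Sᶜ] s)) (nhdsInfinityOne T)

/-- The lattice of `L` and the parameter `a` belong to the curve. -/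
structure IsCompatible (T : DihedralType) (g : ℂ × ℂ) (L : PeriodPair) (a : ℂ) : Prop where
  invariants : (L.g₂, L.g₃) = cubicInvariants T g
  torsion : T ≠ .A2 → a ∉ L.lattice ∧ L.toCubic a = torsionPoint T g

/-- The places at infinity. -/
def poles (T : DihedralType) (L : PeriodPair) (a : ℂ) : Set ℂ :=
  match T with
  | .A2 => L.lattice
  | _ => L.slopePoles a

/-- The uniformization of the curve. -/
def uniformization (T : DihedralType) (g : ℂ × ℂ) (L : PeriodPair) (a z : ℂ) : ℂ × ℂ :=
  match T with
  | .A2 => (1 / 4 * L.weierstrassP z, 1 / 8 * L.derivWeierstrassP z)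
  | .B2 => (-(1 / 2) * L.halfSlope a z,
      1 / 4 * (L.halfSlope a z ^ 2 - 2 * L.weierstrassP z - L.weierstrassP a))
  | .G2 => (-(1 / 2) * L.halfSlope a z + 1 / 2 * g.1,
      -(1 / 2) * L.halfSlope a z + L.halfSlope (-a) z + 3 / 2 * g.1)

lemma slopePoles_neg (L : PeriodPair) (a : ℂ) : L.slopePoles (-a) = L.slopePoles a := by
  ext z
  change (z ∈ _ ∨ z - -a ∈ _ ∨ z + -a ∈ _) ↔ (z ∈ _ ∨ z - a ∈ _ ∨ z + a ∈ _)
  rw [sub_neg_eq_add, ← sub_eq_add_neg, or_comm (a := z + a ∈ L.lattice)]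

lemma halfSlope_add_coe {l : ℂ} (hl : l ∈ L.lattice) (a z : ℂ) :
    L.halfSlope a (z + l) = L.halfSlope a z := by
  have := Prod.ext_iff.1 (L.toCubic_add_coe z hl)
  simp only [PeriodPair.toCubic] at this
  rw [PeriodPair.halfSlope, PeriodPair.halfSlope, this.1, this.2]

lemma add_mem_slopePoles_iff {l : ℂ} (hl : l ∈ L.lattice) (a z : ℂ) :
    z + l ∈ L.slopePoles a ↔ z ∈ L.slopePoles a := by
  change (z + l ∈ _ ∨ z + l - a ∈ _ ∨ z + l + a ∈ _) ↔ (z ∈ _ ∨ z - a ∈ _ ∨ z + a ∈ _)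
  rw [add_sub_right_comm, add_right_comm z l a, L.lattice.add_mem_iff_left hl,
    L.lattice.add_mem_iff_left hl, L.lattice.add_mem_iff_left hl]

lemma poles_add_mem_iff (z : ℂ) {l : ℂ} (hl : l ∈ L.lattice) :
    z + l ∈ poles T L a ↔ z ∈ poles T L a := by
  cases T
  · exact L.lattice.add_mem_iff_left hl
  · exact add_mem_slopePoles_iff hl a z
  · exact add_mem_slopePoles_iff hl a z

lemma uniformization_add (z : ℂ) {l : ℂ} (hl : l ∈ L.lattice) :
    uniformization T g L a (z + l) = uniformization T g L a z := by
  have := Prod.ext_iff.1 (L.toCubic_add_coe z hl)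
  simp only [PeriodPair.toCubic] at this
  cases T <;> simp only [uniformization, halfSlope_add_coe hl, this.1, this.2]

lemma mem_poles_of_mem_lattice {z : ℂ} (hz : z ∈ L.lattice) : z ∈ poles T L a := by
  cases T
  · exact hz
  · exact Or.inl hz
  · exact Or.inl hz

lemma tendsto_weierstrassP_nhdsWithin {S : Set ℂ} {l c : ℂ}
    (hl : l + c ∈ L.lattice) (hc : ∀ z ∉ S, z + c ∉ L.lattice) :
    Tendsto (fun z => ‖L.weierstrassP (z + c)‖) (𝓝[Sᶜ] l) atTop := by
  have h1 : Tendsto (fun z => z + c) (𝓝[Sᶜ] l) (𝓝[≠] (l + c)) := by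
    refine tendsto_nhdsWithin_iff.2 ⟨?_, ?_⟩
    · exact (by fun_prop : Continuous fun z => z + c).continuousAt.tendsto.mono_left
        nhdsWithin_le_nhds
    · filter_upwards [self_mem_nhdsWithin] with w hw h
      exact hc w hw (h ▸ hl)
  exact tendsto_norm_cobounded_atTop.comp ((L.tendsto_weierstrassP hl).comp h1)

/-- The square of the half slope is ℘(z) + ℘(a) + ℘(z - a), and exactly one of the terms ℘(z) and
℘(z - a) has a pole at l. -/
lemma tendsto_norm_halfSlope (ha : a ∉ L.lattice) {l : ℂ}
    (hl : l ∈ L.lattice ∨ l - a ∈ L.lattice) :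
    Tendsto (fun z => ‖L.halfSlope a z‖) (𝓝[(L.slopePoles a)ᶜ] l) atTop := by
  have hsq : Tendsto (fun z => ‖L.halfSlope a z ^ 2‖) (𝓝[(L.slopePoles a)ᶜ] l) atTop := by
    have hsum : ∀ z ∉ L.slopePoles a, L.halfSlope a z ^ 2 =
        L.weierstrassP z + L.weierstrassP a + L.weierstrassP (z - a) := by
      intro z hz
      have := congrArg Prod.fst (PeriodPair.thirdPoint_eq ha hz)
      simp only [PeriodPair.thirdPoint, PeriodPair.toCubic] at this
      linear_combination this
    have key : ∀ f h : ℂ → ℂ, Tendsto (fun z => ‖f z‖) (𝓝[(L.slopePoles a)ᶜ] l) atTop →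
        ContinuousAt h l → Tendsto (fun z => ‖f z + h z‖) (𝓝[(L.slopePoles a)ᶜ] l) atTop := by
      intro f h hf hh
      have h1 : Tendsto (fun z => ‖f z‖ + -‖h z‖) (𝓝[(L.slopePoles a)ᶜ] l) atTop :=
        hf.atTop_add (hh.norm.neg.tendsto.mono_left nhdsWithin_le_nhds)
      refine tendsto_atTop_mono (fun z => ?_) h1
      have := norm_sub_norm_le (f z) (-h z)
      rw [norm_neg, sub_neg_eq_add] at this
      linarith
    rcases hl with hl | hl
    · have hla : l - a ∉ L.lattice := fun h => ha (by simpa using sub_mem hl h)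
      refine (key L.weierstrassP (fun z => L.weierstrassP a + L.weierstrassP (z - a)) ?_ ?_).congr'
        ?_
      · simpa using tendsto_weierstrassP_nhdsWithin (L := L) (S := L.slopePoles a) (c := 0)
          (by simpa using hl) (fun z hz h => hz (Or.inl (by simpa using h)))
      · exact continuousAt_const.add
          ((L.hasDerivAt_weierstrassP hla).comp_sub_const l a).continuousAt
      · filter_upwards [self_mem_nhdsWithin] with z hz
        rw [hsum z hz, add_assoc]
    · have hll : l ∉ L.lattice := fun h => ha (by simpa using sub_mem h hl)
      refine (key (fun z => L.weierstrassP (z + -a))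
        (fun z => L.weierstrassP a + L.weierstrassP z) ?_ ?_).congr' ?_
      · exact tendsto_weierstrassP_nhdsWithin (S := L.slopePoles a) hl (fun z hz h => hz (Or.inr (Or.inl h)))
      · exact continuousAt_const.add (L.hasDerivAt_weierstrassP hll).continuousAt
      · filter_upwards [self_mem_nhdsWithin] with z hz
        rw [hsum z hz, ← sub_eq_add_neg]
        congr 1
        ring
  refine tendsto_atTop.2 fun R => ?_
  filter_upwards [hsq.eventually_ge_atTop (R ^ 2)] with z hz
  rw [norm_pow] at hz
  exact (le_abs_self R).trans (abs_le_of_sq_le_sq hz (norm_nonneg _))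

/-- The relation between the slopes of the lines through a point of order three and its
opposite. -/
lemma halfSlope_relation (h : IsCompatible .G2 g L a) {z : ℂ} (hz : z ∉ L.slopePoles a) :
    (L.halfSlope a z - L.halfSlope (-a) z) * (L.weierstrassP z - L.weierstrassP a) =
      L.derivWeierstrassP a ∧
    (L.halfSlope a z - 3 * g.1) * (L.halfSlope (-a) z + 3 * g.1) =
      L.weierstrassP z - L.weierstrassP a := by
  obtain ⟨ha, ht⟩ := h.torsion nofun
  have hinv := (Prod.ext_iff.1 h.invariants).1
  have ha' : -a ∉ L.lattice := by simpa using ha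
  have hz' : z ∉ L.slopePoles (-a) := by rwa [slopePoles_neg]
  have e0 := PeriodPair.weierstrassP_ne_of_notMem ha hz
  have e1 := PeriodPair.two_mul_halfSlope ha hz
  have e2 := PeriodPair.halfSlope_sq_mul ha hz
  have e1' := PeriodPair.two_mul_halfSlope ha' hz'
  have ht := Prod.ext_iff.1 ht
  simp only [PeriodPair.toCubic, torsionPoint] at ht
  simp only [cubicInvariants] at hinv
  rw [L.weierstrassP_neg, L.derivWeierstrassP_neg] at e1'
  have e3 : (L.halfSlope a z - L.halfSlope (-a) z) * (L.weierstrassP z - L.weierstrassP a) =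
    L.derivWeierstrassP a := by linear_combination (e1 - e1') / 2
  refine ⟨e3, mul_right_cancel₀ e0 ?_⟩
  rw [ht.1, ht.2] at e2 e3
  rw [hinv] at e2
  rw [ht.1]
  -- The special invariants enter here: 3 g_s is half the slope of the tangent at the flex -a.
  linear_combination e2 + (3 * g.1 - L.halfSlope a z) * e3

/-- For types B₂ and G₂ the equation for x is the Riccati equation of the half slope. The equation
for y follows from the slope relation for B₂ and from the product of the two half slopes for G₂. -/
lemma hasDerivAt_uniformization (h : IsCompatible T g L a) {z : ℂ} (hz : z ∉ poles T L a) :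
    HasDerivAt (uniformization T g L a) (hamiltonianField T g (uniformization T g L a z)) z := by
  have hzL : z ∉ L.lattice := fun h => hz (mem_poles_of_mem_lattice h)
  have hp := L.hasDerivAt_weierstrassP hzL
  have hp' := L.hasDerivAt_derivWeierstrassP hzL
  have hinv := Prod.ext_iff.1 h.invariants
  cases T
  · refine ((hp.const_mul (1 / 4)).prodMk (hp'.const_mul (1 / 8))).congr_deriv (Prod.ext ?_ ?_)
    · simp only [hamiltonianField, uniformization]; ring
    · simp only [hamiltonianField, uniformization, cubicInvariants] at hinv ⊢
      rw [hinv.1]; ring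
  · obtain ⟨ha, ht⟩ := h.torsion nofun
    have hs := PeriodPair.hasDerivAt_halfSlope ha hz
    have e1 := PeriodPair.two_mul_halfSlope ha hz
    have ht := Prod.ext_iff.1 ht
    simp only [PeriodPair.toCubic, torsionPoint] at ht
    refine ((hs.const_mul (-(1 / 2))).prodMk ((((hs.pow 2).sub (hp.const_mul 2)).sub_const
      (L.weierstrassP a)).const_mul (1 / 4))).congr_deriv (Prod.ext ?_ ?_)
    · simp only [hamiltonianField, uniformization]; ring
    · simp only [hamiltonianField, uniformization]
      rw [ht.2, ht.1] at e1
      rw [ht.1]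
      push_cast
      linear_combination (1 / 2) * e1
  · obtain ⟨ha, ht⟩ := h.torsion nofun
    have ha' : -a ∉ L.lattice := by simpa using ha
    have hz' : z ∉ L.slopePoles (-a) := by rwa [slopePoles_neg]
    have hs := PeriodPair.hasDerivAt_halfSlope ha hz
    have hs' := PeriodPair.hasDerivAt_halfSlope ha' hz'
    have ht := Prod.ext_iff.1 ht
    simp only [PeriodPair.toCubic, torsionPoint] at ht
    rw [L.weierstrassP_neg] at hs'
    have e4 := (halfSlope_relation h hz).2
    refine (((hs.const_mul (-(1 / 2))).add_const (1 / 2 * g.1)).prodMk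
      (((hs.const_mul (-(1 / 2))).add hs').add_const (3 / 2 * g.1))).congr_deriv (Prod.ext ?_ ?_)
    · simp only [hamiltonianField, uniformization]
      rw [ht.1] at e4 ⊢
      linear_combination e4
    · simp only [hamiltonianField, uniformization]
      rw [ht.1] at e4 ⊢
      linear_combination -e4

lemma uniformization_mem_curve (h : IsCompatible T g L a) {z : ℂ} (hz : z ∉ poles T L a) :
    uniformization T g L a z ∈ curve T g := by
  have hzL : z ∉ L.lattice := fun h => hz (mem_poles_of_mem_lattice h)
  have hinv := Prod.ext_iff.1 h.invariants
  have hsq := L.derivWeierstrassP_sq z hzL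
  simp only [cubicInvariants] at hinv
  cases T
  · simp only [curve, F, mem_ofPred_eq, uniformization]
    rw [hinv.1, hinv.2] at hsq
    linear_combination hsq / 64
  · obtain ⟨ha, ht⟩ := h.torsion nofun
    have e2 := PeriodPair.halfSlope_sq_mul ha hz
    have ht := Prod.ext_iff.1 ht
    simp only [PeriodPair.toCubic, torsionPoint] at ht
    simp only [curve, F, mem_ofPred_eq, uniformization]
    rw [hinv.1, ht.1, ht.2] at e2
    rw [ht.1]
    linear_combination -e2 / 4
  · obtain ⟨ha, ht⟩ := h.torsion nofun
    have ht := Prod.ext_iff.1 ht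
    simp only [PeriodPair.toCubic, torsionPoint] at ht
    obtain ⟨e3, e4⟩ := halfSlope_relation h hz
    -- The cubic is three lines up to a constant: F = (x + g_s)(y - x + 2g_s)(y + x - 2g_s) - g_l +
    -- 2g_s³. Up to constants the three factors here are these linear forms.
    have e5 : (L.halfSlope a z - L.halfSlope (-a) z) *
        ((L.halfSlope a z - 3 * g.1) * (L.halfSlope (-a) z + 3 * g.1)) =
        2 * (g.2 - 2 * g.1 ^ 3) := by rw [e4, e3, ht.2]
    simp only [curve, F, mem_ofPred_eq, uniformization]
    linear_combination e5 / 2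

end EllipticFamily
end

/-! ### Surjectivity of the uniformization and its behaviour at the places at infinity. -/

noncomputable section

namespace EllipticFamily

variable {T : DihedralType} {g P : ℂ × ℂ} {L : PeriodPair} {a : ℂ}

lemma isClosed_poles (T : DihedralType) (L : PeriodPair) (a : ℂ) : IsClosed (poles T L a) := by
  cases T
  · exact L.isClosed_lattice
  · exact L.isClosed_slopePoles a
  · exact L.isClosed_slopePoles a

lemma countable_poles (T : DihedralType) (L : PeriodPair) (a : ℂ) : (poles T L a).Countable := by
  cases T
  · exact L.countable_lattice
  · exact L.countable_slopePoles a
  · exact L.countable_slopePoles a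

lemma two_mul_mem_of_isCompatible (h : IsCompatible .B2 g L a) : 2 * a ∈ L.lattice := by
  obtain ⟨ha, ht⟩ := h.torsion nofun
  have h0 : L.derivWeierstrassP a = 0 := congrArg Prod.snd ht
  have := L.sub_mem_of_toCubic_eq ha (w := -a) (by simpa using ha) (by
    simp [PeriodPair.toCubic, L.weierstrassP_neg, L.derivWeierstrassP_neg, h0])
  rwa [sub_neg_eq_add, ← two_mul] at this

lemma weierstrassP_eq_of_mem {z : ℂ} (h : z - a ∈ L.lattice ∨ z + a ∈ L.lattice) :
    L.weierstrassP z = L.weierstrassP a := by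
  rcases h with h | h
  · have := congrArg Prod.fst (L.toCubic_add_coe a h)
    rwa [add_sub_cancel] at this
  · have := congrArg Prod.fst (L.toCubic_add_coe (-a) h)
    rw [neg_add_cancel_comm_assoc] at this
    simpa [PeriodPair.toCubic, L.weierstrassP_neg] using this

lemma cubicMap_eq (h : IsCompatible T g L a) {z : ℂ} (hz : z ∉ poles T L a) :
    cubicMap T g (uniformization T g L a z) = L.toCubic z := by
  cases T
  · refine Prod.ext ?_ ?_
    · simp only [cubicMap, uniformization, PeriodPair.toCubic]; ring
    · simp only [cubicMap, uniformization, PeriodPair.toCubic]; ring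
  · obtain ⟨ha, ht⟩ := h.torsion nofun
    have e1 := PeriodPair.two_mul_halfSlope ha hz
    have ht := Prod.ext_iff.1 ht
    simp only [PeriodPair.toCubic, torsionPoint] at ht
    rw [ht.1, ht.2] at e1
    refine Prod.ext ?_ ?_
    · simp only [cubicMap, uniformization, PeriodPair.toCubic]
      rw [ht.1]; ring
    · simp only [cubicMap, uniformization, PeriodPair.toCubic]
      rw [ht.1]; linear_combination e1
  · obtain ⟨ha, ht⟩ := h.torsion nofun
    have hz' : z ∉ L.slopePoles (-a) := by rwa [slopePoles_neg]
    have e1 := PeriodPair.two_mul_halfSlope ha hz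
    have e1' := PeriodPair.two_mul_halfSlope (by simpa using ha) hz'
    obtain ⟨e3, e4⟩ := halfSlope_relation h hz
    have ht := Prod.ext_iff.1 ht
    simp only [PeriodPair.toCubic, torsionPoint] at ht
    rw [L.weierstrassP_neg, L.derivWeierstrassP_neg] at e1'
    refine Prod.ext ?_ ?_
    · simp only [cubicMap, uniformization, PeriodPair.toCubic]
      rw [ht.1] at e4
      linear_combination e4
    · simp only [cubicMap, uniformization, PeriodPair.toCubic]
      linear_combination (L.halfSlope a z + L.halfSlope (-a) z) * e4 + (e1 + e1') / 2

/-- Equality of the abscissas puts P on the parabola y = x² - g_s / 2 for B₂, or on one of the lines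
x = -g_s, y = x - 2g_s for G₂. There F is constant, and its value is a multiple of a factor of the
discriminant. -/
lemma cubicMap_ne_torsionPoint (hg : discriminant T g ≠ 0) (hT : T ≠ .A2)
    (hP : P ∈ curve T g) : (cubicMap T g P).1 - (torsionPoint T g).1 ≠ 0 := by
  obtain ⟨x, y⟩ := P
  obtain ⟨gs, gl⟩ := g
  intro h
  apply hg
  cases T
  · exact absurd rfl hT
  · simp only [curve, F, mem_ofPred_eq, cubicMap, torsionPoint, discriminant] at h hP ⊢
    have hy : y = x ^ 2 - gs / 2 := by linear_combination -h / 2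
    have : -8 * gl + gs ^ 2 = 0 := by rw [hy] at hP; linear_combination 8 * hP
    rw [this]; ring
  · simp only [curve, F, mem_ofPred_eq, cubicMap, torsionPoint, discriminant] at h hP ⊢
    have h1 : (x + gs) * (x - y - 2 * gs) = 0 := by linear_combination h / 2
    have : -gl + 2 * gs ^ 3 = 0 := by linear_combination hP + (x + y - 2 * gs) * h1
    rw [this]; ring

/-- A parameter z of the image of P on the cubic works: P does not map to the torsion abscissa, so
division by ℘(z) - ℘(a) recovers the half slopes and hence the coordinates of P. -/
lemma exists_uniformization_eq (h : IsCompatible T g L a) (hg : discriminant T g ≠ 0)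
    (hP : P ∈ curve T g) : ∃ z ∉ poles T L a, uniformization T g L a z = P := by
  have hinv := Prod.ext_iff.1 h.invariants
  simp only at hinv
  obtain ⟨z, hz, hzP⟩ := L.exists_toCubic_eq (P := cubicMap T g P) (by
    rw [hinv.1, hinv.2]; exact cubicMap_mem hP)
  have hzP' := Prod.ext_iff.1 hzP
  simp only [PeriodPair.toCubic] at hzP'
  have hT : T ≠ .A2 → z ∉ L.slopePoles a := by
    intro hT hzS
    obtain ⟨ha, ht⟩ := h.torsion hT
    refine cubicMap_ne_torsionPoint hg hT hP ?_
    rw [← hzP, ← ht]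
    exact sub_eq_zero.2 (weierstrassP_eq_of_mem (hzS.resolve_left hz))
  have hne : T ≠ .A2 → (cubicMap T g P).1 - (torsionPoint T g).1 ≠ 0 := fun hT =>
    cubicMap_ne_torsionPoint hg hT hP
  cases T
  · refine ⟨z, hz, ?_⟩
    simp only [cubicMap] at hzP'
    refine Prod.ext ?_ ?_
    · simp only [uniformization]; rw [hzP'.1]; ring
    · simp only [uniformization]; rw [hzP'.2]; ring
  · obtain ⟨ha, ht⟩ := h.torsion nofun
    have hzS := hT nofun
    have hne := hne nofun
    have ht := Prod.ext_iff.1 ht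
    refine ⟨z, hzS, ?_⟩
    simp only [PeriodPair.toCubic, torsionPoint] at ht
    simp only [cubicMap, torsionPoint] at hzP' hne
    have e1 := PeriodPair.two_mul_halfSlope ha hzS
    rw [ht.1, ht.2, hzP'.1, hzP'.2] at e1
    have e2 : L.halfSlope a z = -2 * P.1 := by
      refine mul_right_cancel₀ hne ?_
      linear_combination e1 / 2
    refine Prod.ext ?_ ?_
    · simp only [uniformization]; rw [e2]; ring
    · simp only [uniformization]; rw [e2, ht.1, hzP'.1]; ring
  · obtain ⟨ha, ht⟩ := h.torsion nofun
    have hzS := hT nofun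
    have hne := hne nofun
    have hz' : z ∉ L.slopePoles (-a) := by rwa [slopePoles_neg]
    have ht := Prod.ext_iff.1 ht
    refine ⟨z, hzS, ?_⟩
    simp only [PeriodPair.toCubic, torsionPoint] at ht
    simp only [cubicMap, torsionPoint] at hzP' hne
    have e1 := PeriodPair.two_mul_halfSlope ha hzS
    have e1' := PeriodPair.two_mul_halfSlope (by simpa using ha) hz'
    rw [L.weierstrassP_neg, L.derivWeierstrassP_neg] at e1'
    rw [ht.1, ht.2, hzP'.1, hzP'.2] at e1 e1'
    simp only [curve, F, mem_ofPred_eq] at hP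
    have e2 : L.halfSlope a z = g.1 - 2 * P.1 := by
      refine mul_right_cancel₀ hne ?_
      linear_combination e1 / 2 - hP
    have e3 : L.halfSlope (-a) z = P.2 - P.1 - g.1 := by
      refine mul_right_cancel₀ hne ?_
      linear_combination e1' / 2 + hP
    refine Prod.ext ?_ ?_
    · simp only [uniformization]; rw [e2]; ring
    · simp only [uniformization]; rw [e2, e3]; ring

lemma tendsto_norm_add_atTop {ι : Type*} {l : Filter ι} {f : ι → ℂ} {c k : ℂ} (hc : c ≠ 0)
    (hf : Tendsto (fun z => ‖f z‖) l atTop) : Tendsto (fun z => ‖c * f z + k‖) l atTop := by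
  have h1 : Tendsto (fun z => ‖c‖ * ‖f z‖ + -‖k‖) l atTop :=
    tendsto_atTop_add_const_right _ _ (hf.const_mul_atTop (norm_pos_iff.2 hc))
  refine tendsto_atTop_mono (fun z => ?_) h1
  have := norm_sub_norm_le (c * f z) (-k)
  rw [norm_neg, sub_neg_eq_add, norm_mul] at this
  linarith

lemma tendsto_div_of_norm_atTop {ι : Type*} {l : Filter ι} {f h : ι → ℂ} {c : ℂ}
    (hf : Tendsto (fun z => ‖f z‖) l atTop) (hh : Tendsto h l (𝓝 c)) :
    Tendsto (fun z => h z / f z) l (𝓝 0) := by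
  have h1 : Tendsto (fun z => (f z)⁻¹) l (𝓝 0) :=
    (Filter.tendsto_inv₀_cobounded).comp (tendsto_norm_atTop_iff_cobounded.1 hf)
  simpa [div_eq_mul_inv] using hh.mul h1

lemma halfSlope_sq_eq (ha : a ∉ L.lattice) {z : ℂ} (hz : z ∉ L.slopePoles a) :
    L.halfSlope a z ^ 2 = L.weierstrassP z + L.weierstrassP a + L.weierstrassP (z - a) := by
  have := congrArg Prod.fst (PeriodPair.thirdPoint_eq ha hz)
  simp only [PeriodPair.thirdPoint, PeriodPair.toCubic] at this
  linear_combination this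

/-- The limits of the slopes of the lines through points of order three. -/
lemma tendsto_halfSlope_of_neg (h : IsCompatible .G2 g L a) {s : ℂ}
    (hs : s - a ∈ L.lattice ∨ s + a ∈ L.lattice) :
    (s - a ∈ L.lattice → Tendsto (L.halfSlope (-a)) (𝓝[(L.slopePoles a)ᶜ] s) (𝓝 (-3 * g.1))) ∧
    (s + a ∈ L.lattice → Tendsto (L.halfSlope a) (𝓝[(L.slopePoles a)ᶜ] s) (𝓝 (3 * g.1))) := by
  obtain ⟨ha, ht⟩ := h.torsion nofun
  have ha' : -a ∉ L.lattice := by simpa using ha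
  have hsL : s ∉ L.lattice := by
    intro hsL
    rcases hs with h1 | h1
    · exact ha (by simpa using sub_mem hsL h1)
    · exact ha (by simpa using sub_mem h1 hsL)
  have hp : Tendsto (fun z => L.weierstrassP z - L.weierstrassP a) (𝓝[(L.slopePoles a)ᶜ] s)
      (𝓝 0) := by
    have := ((L.hasDerivAt_weierstrassP hsL).continuousAt.tendsto.sub_const
      (L.weierstrassP a)).mono_left (nhdsWithin_le_nhds (s := (L.slopePoles a)ᶜ))
    rwa [weierstrassP_eq_of_mem hs, sub_self] at this
  constructor
  · intro h1
    -- The product of the shifted half slopes is ℘(z) - ℘(a) → 0. One factor is unbounded, so the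
    -- other one tends to 0.
    have h2 := tendsto_norm_add_atTop (k := -3 * g.1) one_ne_zero
      (tendsto_norm_halfSlope ha (Or.inr h1))
    have h3 := (tendsto_div_of_norm_atTop h2 hp).sub_const (3 * g.1)
    rw [zero_sub, ← neg_mul] at h3
    refine h3.congr' ?_
    filter_upwards [self_mem_nhdsWithin, h2.eventually_ne_atTop 0] with z hz hz0
    rw [← (halfSlope_relation h hz).2]
    have : L.halfSlope a z - 3 * g.1 ≠ 0 := by
      intro h; exact hz0 (by rw [norm_eq_zero]; linear_combination h)
    rw [show 1 * L.halfSlope a z + -3 * g.1 = L.halfSlope a z - 3 * g.1 by ring]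
    field_simp
    ring
  · intro h1
    have h2 := tendsto_norm_add_atTop (k := 3 * g.1) one_ne_zero
      (tendsto_norm_halfSlope ha' (l := s) (Or.inr (by simpa using h1)))
    rw [slopePoles_neg] at h2
    have h3 := (tendsto_div_of_norm_atTop h2 hp).add_const (3 * g.1)
    rw [zero_add] at h3
    refine h3.congr' ?_
    filter_upwards [self_mem_nhdsWithin, h2.eventually_ne_atTop 0] with z hz hz0
    rw [← (halfSlope_relation h hz).2]
    have : L.halfSlope (-a) z + 3 * g.1 ≠ 0 := by
      intro h; exact hz0 (by rw [norm_eq_zero]; linear_combination h)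
    rw [one_mul]
    field_simp
    ring

lemma tendsto_norm_uniformization (h : IsCompatible T g L a) {s : ℂ} (hs : s ∈ poles T L a) :
    Tendsto (fun z => ‖uniformization T g L a z‖) (𝓝[(poles T L a)ᶜ] s) atTop := by
  have hfst : Tendsto (fun z => ‖(uniformization T g L a z).1‖) (𝓝[(poles T L a)ᶜ] s) atTop →
      Tendsto (fun z => ‖uniformization T g L a z‖) (𝓝[(poles T L a)ᶜ] s) atTop := fun h =>
    tendsto_atTop_mono (fun z => norm_fst_le _) h
  cases T
  · refine hfst ?_
    have h1 := tendsto_weierstrassP_nhdsWithin (L := L) (S := L.lattice) (l := s) (c := 0)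
      (by rw [add_zero]; exact hs) (fun z hz => by simpa using hz)
    simp only [add_zero] at h1
    exact (tendsto_norm_add_atTop (c := 1 / 4) (k := 0) (by norm_num) h1).congr fun z => by
      simp [uniformization]
  · obtain ⟨ha, ht⟩ := h.torsion nofun
    have h2 := two_mul_mem_of_isCompatible h
    have hs' : s ∈ L.lattice ∨ s - a ∈ L.lattice := by
      rcases hs with h1 | h1 | h1
      · exact Or.inl h1
      · exact Or.inr h1
      · refine Or.inr ?_
        have := sub_mem h1 h2
        rwa [show s + a - 2 * a = s - a by ring] at this
    refine hfst ?_
    exact (tendsto_norm_add_atTop (c := -(1 / 2)) (k := 0) (by norm_num)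
      (tendsto_norm_halfSlope ha hs')).congr fun z => by simp [uniformization]
  · obtain ⟨ha, ht⟩ := h.torsion nofun
    have key : ∀ hs' : s ∈ L.lattice ∨ s - a ∈ L.lattice,
        Tendsto (fun z => ‖uniformization .G2 g L a z‖) (𝓝[(L.slopePoles a)ᶜ] s) atTop :=
      fun hs' => hfst (tendsto_norm_add_atTop (c := -(1 / 2)) (k := 1 / 2 * g.1) (by norm_num)
        (tendsto_norm_halfSlope ha hs'))
    rcases hs with h1 | h1 | h1
    · exact key (Or.inl h1)
    · exact key (Or.inr h1)
    -- At -a the coordinate x stays finite. It is y - x, the half slope for -a plus g_s, that blows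
    -- up, and its norm is at most twice the maximum norm of (x, y).
    · have h2 := tendsto_norm_halfSlope (a := -a) (by simpa using ha) (l := s)
        (Or.inr (by simpa using h1))
      rw [slopePoles_neg] at h2
      have h3 := (tendsto_norm_add_atTop (k := g.1) one_ne_zero h2).const_mul_atTop
        (show (0 : ℝ) < 1 / 2 by norm_num)
      refine tendsto_atTop_mono (fun z => ?_) h3
      set Q := uniformization .G2 g L a z
      have h4 : 1 * L.halfSlope (-a) z + g.1 = Q.2 - Q.1 := by
        simp only [Q, uniformization]; ring
      rw [h4]
      have := norm_sub_le Q.2 Q.1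
      have := norm_fst_le Q
      have := norm_snd_le Q
      linarith

/-- For B₂ the addition formula turns y / x² into -1 + (2℘(z - a) + ℘(a)) / m² with m the half
slope. For G₂ the two half slopes have the same principal part, so x + y stays bounded while x blows
up. -/
lemma tendsto_uniformization_zero (h : IsCompatible T g L a) :
    Tendsto (uniformization T g L a) (𝓝[(poles T L a)ᶜ] 0) (nhdsInfinityOne T) := by
  cases T
  · refine tendsto_comap_iff.2 ?_
    have h1 := tendsto_weierstrassP_nhdsWithin (L := L) (S := L.lattice) (l := 0) (c := 0)
      (by simp) (fun z hz => by simpa using hz)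
    simp only [add_zero] at h1
    exact (tendsto_norm_add_atTop (c := 1 / 4) (k := 0) (by norm_num) h1).congr fun z => by
      simp [uniformization]
  · obtain ⟨ha, ht⟩ := h.torsion nofun
    have h1 := tendsto_norm_halfSlope ha (l := 0) (Or.inl (zero_mem _))
    refine tendsto_inf.2 ⟨tendsto_comap_iff.2 ?_, tendsto_comap_iff.2 ?_⟩
    · exact (tendsto_norm_add_atTop (c := -(1 / 2)) (k := 0) (by norm_num) h1).congr fun z => by
        simp [uniformization]
    · have ha' : (0 : ℂ) - a ∉ L.lattice := by simpa using ha
      have h2 : Tendsto (fun z => 2 * L.weierstrassP (z - a) + L.weierstrassP a)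
          (𝓝[(L.slopePoles a)ᶜ] 0) (𝓝 (2 * L.weierstrassP (0 - a) + L.weierstrassP a)) :=
        ((((L.hasDerivAt_weierstrassP ha').comp_sub_const 0 a).continuousAt.tendsto.const_mul
          2).add_const _).mono_left nhdsWithin_le_nhds
      have h3 := (tendsto_div_of_norm_atTop h1 (tendsto_div_of_norm_atTop h1 h2)).sub_const 1
      rw [zero_sub] at h3
      refine h3.congr' ?_
      filter_upwards [self_mem_nhdsWithin, h1.eventually_ne_atTop 0] with z hz hz0
      have hz0 : L.halfSlope a z ≠ 0 := norm_ne_zero_iff.1 hz0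
      have := halfSlope_sq_eq ha hz
      simp only [Function.comp_apply, uniformization]
      field_simp
      linear_combination (-8) * this
  · obtain ⟨ha, ht⟩ := h.torsion nofun
    have h1 := tendsto_norm_halfSlope ha (l := 0) (Or.inl (zero_mem _))
    have h2 := tendsto_norm_add_atTop (c := -(1 / 2)) (k := 1 / 2 * g.1) (by norm_num) h1
    refine tendsto_inf.2 ⟨tendsto_comap_iff.2 h2, tendsto_comap_iff.2 ?_⟩
    have hp := tendsto_weierstrassP_nhdsWithin (L := L) (S := L.slopePoles a) (l := 0) (c := 0)
      (by simp) (fun z hz h => hz (Or.inl (by simpa using h)))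
    simp only [add_zero] at hp
    have hp' := tendsto_norm_add_atTop (c := 1) (k := -L.weierstrassP a) one_ne_zero hp
    have h3 : Tendsto (fun z => L.halfSlope (-a) z - L.halfSlope a z) (𝓝[(L.slopePoles a)ᶜ] 0)
        (𝓝 0) := by
      refine (tendsto_div_of_norm_atTop hp' (tendsto_const_nhds
        (x := -L.derivWeierstrassP a))).congr' ?_
      filter_upwards [self_mem_nhdsWithin] with z hz
      have e0 := PeriodPair.weierstrassP_ne_of_notMem ha hz
      rw [one_mul, ← sub_eq_add_neg, div_eq_iff e0]
      linear_combination (halfSlope_relation h hz).1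
    have h4 := (tendsto_div_of_norm_atTop h2 (h3.add_const (2 * g.1))).sub_const 1
    rw [zero_sub] at h4
    refine h4.congr' ?_
    filter_upwards [h2.eventually_ne_atTop 0] with z hz0
    have hz0 := norm_ne_zero_iff.1 hz0
    simp only [Function.comp_apply, uniformization]
    rw [div_sub_one hz0]
    congr 1
    ring

/-- At the places a of B₂ and G₂ the ratio tends to +1 instead of -1; at the place -a of G₂ the
coordinate x stays bounded. -/
lemma disjoint_uniformization (h : IsCompatible T g L a) {s : ℂ} (hs : s ∈ poles T L a)
    (hsL : s ∉ L.lattice) :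
    Disjoint (map (uniformization T g L a) (𝓝[(poles T L a)ᶜ] s)) (nhdsInfinityOne T) := by
  have key : ∀ {f : ℂ × ℂ → ℂ}, nhdsInfinityOne T ≤ comap f (𝓝 (-1)) →
      Tendsto (fun z => f (uniformization T g L a z)) (𝓝[(poles T L a)ᶜ] s) (𝓝 1) →
      Disjoint (map (uniformization T g L a) (𝓝[(poles T L a)ᶜ] s)) (nhdsInfinityOne T) := by
    intro f h1 h2
    refine Disjoint.mono (map_le_iff_le_comap.2 ?_) h1 (disjoint_comap
      (disjoint_nhds_nhds.2 (by norm_num : (1 : ℂ) ≠ -1)))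
    rw [comap_comap]
    exact h2.le_comap
  cases T
  · exact absurd hs hsL
  · obtain ⟨ha, ht⟩ := h.torsion nofun
    have h2 := two_mul_mem_of_isCompatible h
    have hs2 := hs.resolve_left hsL
    have hs' : s - a ∈ L.lattice := by
      rcases hs2 with h1 | h1
      · exact h1
      · have := sub_mem h1 h2
        rwa [show s + a - 2 * a = s - a by ring] at this
    have h1 := tendsto_norm_halfSlope ha (l := s) (Or.inr hs')
    refine key inf_le_right ?_
    have h2 : Tendsto (fun z => 2 * L.weierstrassP z + L.weierstrassP a)
        (𝓝[(L.slopePoles a)ᶜ] s) (𝓝 (2 * L.weierstrassP s + L.weierstrassP a)) :=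
      (((L.hasDerivAt_weierstrassP hsL).continuousAt.tendsto.const_mul
          2).add_const _).mono_left nhdsWithin_le_nhds
    have h3 := (tendsto_div_of_norm_atTop h1 (tendsto_div_of_norm_atTop h1 h2)).const_sub 1
    rw [sub_zero] at h3
    refine h3.congr' ?_
    filter_upwards [h1.eventually_ne_atTop 0] with z hz0
    have hz0 : L.halfSlope a z ≠ 0 := norm_ne_zero_iff.1 hz0
    simp only [uniformization]
    field_simp
    ring
  · obtain ⟨ha, ht⟩ := h.torsion nofun
    have hs2 := hs.resolve_left hsL
    obtain ⟨k1, k2⟩ := tendsto_halfSlope_of_neg h hs2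
    rcases hs2 with h1 | h1
    · refine key inf_le_right ?_
      have h2 := tendsto_norm_add_atTop (c := -(1 / 2)) (k := 1 / 2 * g.1) (by norm_num)
        (tendsto_norm_halfSlope ha (l := s) (Or.inr h1))
      have h3 := (tendsto_div_of_norm_atTop h2 ((k1 h1).add_const g.1)).add_const 1
      rw [zero_add] at h3
      refine h3.congr' ?_
      filter_upwards [h2.eventually_ne_atTop 0] with z hz0
      have hz0 := norm_ne_zero_iff.1 hz0
      simp only [uniformization]
      rw [div_add_one hz0]
      congr 1
      ring
    · have h3 := (((k2 h1).const_mul (-(1 / 2))).add_const (1 / 2 * g.1)).norm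
      refine Disjoint.mono (map_le_iff_le_comap.2 ?_) inf_le_left (disjoint_comap
        (disjoint_nhds_atTop ‖-(1 / 2) * (3 * g.1) + 1 / 2 * g.1‖))
      rw [comap_comap]
      exact h3.le_comap

/-- The curves off the discriminant are uniformized by the functions of the lattice. -/
lemma isUniformization (h : IsCompatible T g L a) (hg : discriminant T g ≠ 0) :
    IsUniformization T g L (poles T L a) (uniformization T g L a) where
  contDiff := contDiff_hamiltonianField T g
  isClosed := isClosed_poles T L a
  countable := countable_poles T L a
  hasDerivAt _ hz := hasDerivAt_uniformization h hz
  tendsto _ hs := tendsto_norm_uniformization h hs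
  mem_curve _ hz := uniformization_mem_curve h hz
  exists_eq _ hP := exists_uniformization_eq h hg hP
  cubicMap_eq _ hz := cubicMap_eq h hz
  lattice_subset _ hz := mem_poles_of_mem_lattice hz
  add_mem_iff z _ hl := poles_add_mem_iff z hl
  apply_add z _ hl := uniformization_add z hl
  tendsto_zero := tendsto_uniformization_zero h
  disjoint _ hs hsL := disjoint_uniformization h hs hsL

end EllipticFamily
end

noncomputable section

/-! ### Lifting of paths and the Abel integral -/

namespace EllipticFamily

variable {T : DihedralType} {g P : ℂ × ℂ} {L : PeriodPair} {S : Set ℂ} {Φ : ℂ → ℂ × ℂ}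

/-- The value of the residue form on the velocity of a path. -/
def speed (T : DihedralType) (g : ℂ × ℂ) (c : ℝ → ℂ × ℂ) (α β s : ℝ) : ℂ :=
  primitiveForm T g (c s) (derivWithin c (Icc α β) s)

lemma tangent_derivWithin {c : ℝ → ℂ × ℂ} {α β s : ℝ} (hαβ : α < β)
    (hc : ContDiffOn ℝ 1 c (Icc α β)) (hcurve : ∀ s ∈ Icc α β, c s ∈ curve T g)
    (hs : s ∈ Icc α β) :
    (hamiltonianField T g (c s)).1 * (derivWithin c (Icc α β) s).2 =
      (hamiltonianField T g (c s)).2 * (derivWithin c (Icc α β) s).1 :=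
  tangent_of_hasDerivWithinAt (uniqueDiffOn_Icc hαβ s hs) hs hcurve
    ((hc.differentiableOn one_ne_zero s hs).hasDerivWithinAt)

lemma hasDerivWithinAt_speed {c : ℝ → ℂ × ℂ} {α β s : ℝ} (hαβ : α < β)
    (hg : discriminant T g ≠ 0)
    (hc : ContDiffOn ℝ 1 c (Icc α β)) (hcurve : ∀ s ∈ Icc α β, c s ∈ curve T g)
    (hs : s ∈ Icc α β) :
    HasDerivWithinAt c (speed T g c α β s • hamiltonianField T g (c s)) (Icc α β) s := by
  rw [speed, primitiveForm_smul_eq (hamiltonianField_ne_zero hg (hcurve s hs))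
    (tangent_derivWithin hαβ hc hcurve hs)]
  exact (hc.differentiableOn one_ne_zero s hs).hasDerivWithinAt

open ComplexConjugate in
lemma continuousOn_speed {c : ℝ → ℂ × ℂ} {α β : ℝ} (hαβ : α < β) (hg : discriminant T g ≠ 0)
    (hc : ContDiffOn ℝ 1 c (Icc α β)) (hcurve : ∀ s ∈ Icc α β, c s ∈ curve T g) :
    ContinuousOn (speed T g c α β) (Icc α β) := by
  have hd : ContinuousOn (derivWithin c (Icc α β)) (Icc α β) :=
    hc.continuousOn_derivWithin (uniqueDiffOn_Icc hαβ) le_rfl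
  have hV : ContinuousOn (fun s => hamiltonianField T g (c s)) (Icc α β) :=
    (contDiff_hamiltonianField T g).continuous.comp_continuousOn hc.continuousOn
  have h1 : ContinuousOn (fun s => (hamiltonianField T g (c s)).1) (Icc α β) := hV.fst
  have h2 : ContinuousOn (fun s => (hamiltonianField T g (c s)).2) (Icc α β) := hV.snd
  have d1 : ContinuousOn (fun s => (derivWithin c (Icc α β) s).1) (Icc α β) := hd.fst
  have d2 : ContinuousOn (fun s => (derivWithin c (Icc α β) s).2) (Icc α β) := hd.snd
  have c1 := Complex.continuous_conj.comp_continuousOn h1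
  have c2 := Complex.continuous_conj.comp_continuousOn h2
  refine (((d1.mul c1).add (d2.mul c2)).div ((h1.mul c1).add (h2.mul c2)) ?_).congr fun s hs =>
    primitiveForm_eq_div (hamiltonianField_ne_zero hg (hcurve s hs))
      (tangent_derivWithin hαβ hc hcurve hs)
  intro s hs
  have h0 := hamiltonianField_ne_zero hg (hcurve s hs)
  change (hamiltonianField T g (c s)).1 * conj (hamiltonianField T g (c s)).1 +
    (hamiltonianField T g (c s)).2 * conj (hamiltonianField T g (c s)).2 ≠ 0
  rw [Complex.mul_conj, Complex.mul_conj]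
  norm_cast
  intro h2
  apply h0
  have a1 := Complex.normSq_nonneg (hamiltonianField T g (c s)).1
  have a2 := Complex.normSq_nonneg (hamiltonianField T g (c s)).2
  exact Prod.ext (Complex.normSq_eq_zero.1 (by linarith))
    (Complex.normSq_eq_zero.1 (by linarith))

/-- The derivatives on the line and within the interval agree in its interior; the end points are
null. -/
lemma pathIntegral_eq_integral_speed (c : ℝ → ℂ × ℂ) {α β x y : ℝ} (hxy : x ≤ y) (hx : α ≤ x)
    (hy : y ≤ β) : pathIntegral T g c x y = ∫ s in x..y, speed T g c α β s := by
  refine intervalIntegral.integral_congr_ae ?_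
  have : ∀ᵐ s : ℝ, s ≠ y := by
    simp [MeasureTheory.ae_iff]
  filter_upwards [this] with s hsy hs
  rw [uIoc_of_le hxy] at hs
  rw [speed, derivWithin_of_mem_nhds (Icc_mem_nhds (hx.trans_lt hs.1)
    ((hs.2.lt_of_ne hsy).trans_le hy))]

/-- Paths in the curve lift to the parameter plane, the integral of the residue form being the
displacement of the lift. -/
lemma IsUniformization.exists_lift (h : IsUniformization T g L S Φ) (hg : discriminant T g ≠ 0)
    {c : ℝ → ℂ × ℂ} {α β s₀ : ℝ} (hαβ : α < β)
    (hc : ContDiffOn ℝ 1 c (Icc α β)) (hcurve : ∀ s ∈ Icc α β, c s ∈ curve T g)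
    (hs₀ : s₀ ∈ Icc α β) {z₀ : ℂ} (hz₀ : z₀ ∉ S) (h0 : Φ z₀ = c s₀) :
    ∃ w : ℝ → ℂ, w s₀ = z₀ ∧
      (∀ s ∈ Icc α β, HasDerivWithinAt w (speed T g c α β s) (Icc α β) s) ∧
      (∀ s ∈ Icc α β, w s ∉ S ∧ Φ (w s) = c s) ∧
      ∀ x y, x ≤ y → α ≤ x → y ≤ β → pathIntegral T g c x y = w y - w x := by
  have hf := continuousOn_speed hαβ hg hc hcurve
  -- Extending the speed constantly makes it continuous on the whole line, so its primitive has
  -- two-sided derivatives also at the end points.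
  set f : ℝ → ℂ := IccExtend hαβ.le (fun s : Icc α β => speed T g c α β s) with hfdef
  have hfc : Continuous f := (continuousOn_iff_continuous_domRestrict.1 hf).Icc_extend'
  have hfe : ∀ s ∈ Icc α β, f s = speed T g c α β s := fun s hs => IccExtend_of_mem _ _ hs
  set w : ℝ → ℂ := fun s => z₀ + ∫ t in s₀..s, f t with hw
  have hwd : ∀ s ∈ Icc α β, HasDerivWithinAt w (speed T g c α β s) (Icc α β) s := by
    intro s hs
    rw [← hfe s hs]
    exact ((intervalIntegral.integral_hasDerivAt_right (hfc.intervalIntegrable _ _)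
      (hfc.stronglyMeasurableAtFilter _ _) hfc.continuousAt).const_add z₀).hasDerivWithinAt
  have hw0 : w s₀ = z₀ := by simp [hw]
  refine ⟨w, hw0, hwd, ?_, ?_⟩
  · exact h.toIsComplexFlow.lift_of_hasDerivWithinAt hf
      (fun s hs => hasDerivWithinAt_speed hαβ hg hc hcurve hs) hwd hs₀ (hw0.symm ▸ hz₀)
      (hw0.symm ▸ h0)
  · intro x y hxy hx hy
    rw [pathIntegral_eq_integral_speed c hxy hx hy, hw]
    simp only [add_sub_add_left_eq_sub]
    rw [intervalIntegral.integral_interval_sub_left (hfc.intervalIntegrable _ _)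
      (hfc.intervalIntegrable _ _)]
    refine intervalIntegral.integral_congr fun s hs => (hfe s ?_).symm
    rw [uIcc_of_le hxy] at hs
    exact ⟨hx.trans hs.1, hs.2.trans hy⟩

lemma nhdsInfinityOne_le (T : DihedralType) :
    nhdsInfinityOne T ≤ comap (fun P => ‖P.1‖) atTop := by
  cases T
  · exact le_rfl
  · exact inf_le_left
  · exact inf_le_left

/-- A path from the origin to `z` through the complement of a countable set. -/
lemma exists_path_avoiding (hS : S.Countable) {z : ℂ} (hz : z ∉ S) (hz0 : z ≠ 0) :
    ∃ t : ℝ, ∀ s ∈ Ioc (0 : ℝ) 1, (s : ℂ) * z + s * (1 - s) * t * (Complex.I * z) ∉ S := by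
  -- If the arc with parameter t hits q at a time s < 1, then s = Re (q / z), and Im (q / z)
  -- determines t. Only countably many t are excluded.
  set bad : Set ℝ := (fun q : ℂ => (q / z).im / ((q / z).re * (1 - (q / z).re))) '' S
  obtain ⟨t, ht⟩ : badᶜ.Nonempty := ((hS.image _).dense_compl ℝ).nonempty
  refine ⟨t, fun s hs hmem => ?_⟩
  rcases hs.2.lt_or_eq with h1 | h1
  · refine ht ⟨_, hmem, ?_⟩
    have e : ((s : ℂ) * z + s * (1 - s) * t * (Complex.I * z)) / z =
        (s : ℂ) + ((s * (1 - s) * t : ℝ) : ℂ) * Complex.I := by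
      push_cast
      field_simp
    have e1 : (s : ℝ) ≠ 0 := hs.1.ne'
    have e2 : 1 - s ≠ 0 := by linarith
    simp only [e]
    simp
    field_simp
  · rw [h1] at hmem
    simp at hmem
    exact hz hmem

lemma IsUniformization.zero_mem (h : IsUniformization T g L S Φ) : (0 : ℂ) ∈ S :=
  h.lattice_subset 0 L.lattice.zero_mem

lemma IsUniformization.isAbelIntegral_apply (h : IsUniformization T g L S Φ)
    (hg : discriminant T g ≠ 0) {z : ℂ} (hz : z ∉ S) : IsAbelIntegral T g (Φ z) z := by
  have hz0 : z ≠ 0 := fun h0 => hz (h0 ▸ h.zero_mem)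
  obtain ⟨t, ht⟩ := exists_path_avoiding h.countable hz hz0
  set w : ℝ → ℂ := fun s => (s : ℂ) * z + s * (1 - s) * t * (Complex.I * z) with hw
  have hwc : ContDiff ℝ 1 w := by
    have : ContDiff ℝ 1 (fun s : ℝ => (s : ℂ)) := Complex.ofRealCLM.contDiff
    fun_prop
  have hw1 : w 1 = z := by simp [hw]
  have hw0 : w 0 = 0 := by simp [hw]
  have hd : ∀ s ∈ Ioc (0 : ℝ) 1, HasDerivAt (fun s => Φ (w s))
      (deriv w s • hamiltonianField T g (Φ (w s))) s := by
    intro s hs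
    exact HasDerivAt.scomp s (h.hasDerivAt _ (ht s hs))
      (hwc.differentiable one_ne_zero s).hasDerivAt
  refine ⟨fun s => Φ (w s), ?_, fun s hs => h.mem_curve _ (ht s hs), ?_, congrArg Φ hw1, ?_⟩
  · have hΦ : DifferentiableOn ℂ Φ Sᶜ := fun x hx =>
      (h.hasDerivAt x hx).differentiableAt.differentiableWithinAt
    have := (hΦ.contDiffOn (n := 1) h.isClosed.isOpen_compl).restrict_scalars ℝ
    exact this.comp hwc.contDiffOn ht
  · refine h.tendsto_zero.comp (tendsto_nhdsWithin_iff.2 ⟨?_, ?_⟩)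
    · have := hwc.continuous.tendsto 0
      rw [hw0] at this
      exact this.mono_left nhdsWithin_le_nhds
    · filter_upwards [Ioc_mem_nhdsGT one_pos] with s hs using ht s hs
  · have h1 : ∀ ε ∈ Ioc (0 : ℝ) 1, pathIntegral T g (fun s => Φ (w s)) ε 1 = z - w ε := by
      intro ε hε
      have h2 : pathIntegral T g (fun s => Φ (w s)) ε 1 = ∫ s in ε..1, deriv w s := by
        refine intervalIntegral.integral_congr fun s hs => ?_
        rw [uIcc_of_le hε.2] at hs
        have hs' : s ∈ Ioc (0 : ℝ) 1 := ⟨hε.1.trans_le hs.1, hs.2⟩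
        simp only
        rw [(hd s hs').deriv, primitiveForm_smul
          (hamiltonianField_ne_zero hg (h.mem_curve _ (ht s hs')))]
      rw [h2, intervalIntegral.integral_deriv_eq_sub
        (fun s _ => hwc.differentiable one_ne_zero s)
        ((hwc.continuous_deriv le_rfl).intervalIntegrable _ _), hw1]
    have h3 : Tendsto (fun ε => z - w ε) (𝓝[>] 0) (𝓝 (z - 0)) := by
      have := hwc.continuous.tendsto 0
      rw [hw0] at this
      exact (this.const_sub z).mono_left nhdsWithin_le_nhds
    rw [sub_zero] at h3
    refine h3.congr' ?_
    filter_upwards [Ioc_mem_nhdsGT one_pos] with ε hε using (h1 ε hε).symm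

/-- The path lifts backwards from a parameter z₁ of its end point P, and the lift tends to z₁ - z.
This limit lies in S because the path leaves the affine curve, and in the lattice because it does so
at ∞₁; hence z is a parameter of P, too. -/
lemma IsUniformization.eq_of_isAbelIntegral (h : IsUniformization T g L S Φ)
    (hg : discriminant T g ≠ 0) {z : ℂ} (hz : IsAbelIntegral T g P z) : z ∉ S ∧ P = Φ z := by
  obtain ⟨c, hc, hcurve, hlim, hc1, hint⟩ := hz
  obtain ⟨z₁, hz₁, hΦ⟩ := h.exists_eq P (hc1 ▸ hcurve 1 ⟨one_pos, le_rfl⟩)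
  have hlift : ∀ ε ∈ Ioo (0 : ℝ) 1, z₁ - pathIntegral T g c ε 1 ∉ S ∧
      Φ (z₁ - pathIntegral T g c ε 1) = c ε := by
    intro ε hε
    have hsub : Icc ε 1 ⊆ Ioc 0 1 := fun s hs => ⟨hε.1.trans_le hs.1, hs.2⟩
    obtain ⟨w, hw1, -, hw, hp⟩ := h.exists_lift hg hε.2 (hc.mono hsub)
      (fun s hs => hcurve s (hsub hs)) (right_mem_Icc.2 hε.2.le) hz₁ (hΦ.trans hc1.symm)
    rw [hp ε 1 hε.2.le le_rfl le_rfl, hw1, sub_sub_cancel]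
    exact hw ε (left_mem_Icc.2 hε.2.le)
  have hev : ∀ᶠ ε in 𝓝[>] (0 : ℝ), ε ∈ Ioo (0 : ℝ) 1 := Ioo_mem_nhdsGT one_pos
  have hw : Tendsto (fun ε => z₁ - pathIntegral T g c ε 1) (𝓝[>] 0) (𝓝 (z₁ - z)) :=
    hint.const_sub z₁
  have hw' : Tendsto (fun ε => z₁ - pathIntegral T g c ε 1) (𝓝[>] 0) (𝓝[Sᶜ] (z₁ - z)) :=
    tendsto_nhdsWithin_iff.2 ⟨hw, hev.mono fun ε hε => (hlift ε hε).1⟩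
  have hΦc : (fun ε => Φ (z₁ - pathIntegral T g c ε 1)) =ᶠ[𝓝[>] 0] c :=
    hev.mono fun ε hε => (hlift ε hε).2
  have hmem : z₁ - z ∈ S := by
    by_contra hn
    have h1 : Tendsto c (𝓝[>] 0) (𝓝 (Φ (z₁ - z))) :=
      ((h.continuousAt hn).tendsto.comp hw).congr' hΦc
    have h2 : Tendsto (fun ε => ‖(c ε).1‖) (𝓝[>] 0) atTop :=
      tendsto_comap_iff (g := fun P : ℂ × ℂ => ‖P.1‖) |>.1 (hlim.mono_right (nhdsInfinityOne_le T))
    exact not_tendsto_nhds_of_tendsto_atTop h2 _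
      ((continuous_fst.norm.tendsto _).comp h1)
  have hL : z₁ - z ∈ L.lattice := by
    by_contra hn
    have h1 : Tendsto c (𝓝[>] 0) (map Φ (𝓝[Sᶜ] (z₁ - z))) :=
      (tendsto_map.comp hw').congr' hΦc
    have h2 := tendsto_inf.2 ⟨h1, hlim⟩
    rw [(h.disjoint _ hmem hn).eq_bot] at h2
    exact NeBot.ne inferInstance (map_eq_bot_iff.1 (le_bot_iff.1 h2))
  have e : z₁ = z + (z₁ - z) := by ring
  rw [e, h.add_mem_iff _ _ hL] at hz₁
  refine ⟨hz₁, ?_⟩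
  rw [← hΦ, e, h.apply_add _ _ hL]

lemma IsUniformization.isAbelIntegral_iff (h : IsUniformization T g L S Φ)
    (hg : discriminant T g ≠ 0) (P : ℂ × ℂ) (z : ℂ) :
    IsAbelIntegral T g P z ↔ z ∉ S ∧ P = Φ z :=
  ⟨h.eq_of_isAbelIntegral hg, fun ⟨hz, hP⟩ => hP ▸ h.isAbelIntegral_apply hg hz⟩

end EllipticFamily
end

noncomputable section

/-! ### The inverse functions in terms of the Weierstrass functions -/

namespace EllipticFamily

variable {T : DihedralType} {g P : ℂ × ℂ} {L : PeriodPair} {a : ℂ}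

lemma torsionPoint_snd_ne_zero (hg : discriminant .G2 g ≠ 0) : (torsionPoint .G2 g).2 ≠ 0 := by
  intro h
  apply hg
  simp only [torsionPoint, discriminant] at h ⊢
  have : -g.2 + 2 * g.1 ^ 3 = 0 := by linear_combination -h / 2
  rw [this]; ring

lemma two_mul_notMem (h : IsCompatible .G2 g L a) (hg : discriminant .G2 g ≠ 0) :
    2 * a ∉ L.lattice := by
  intro h2
  have h1 := congrArg Prod.snd (L.toCubic_add_coe (-a) h2)
  rw [show -a + 2 * a = a by ring] at h1
  simp only [PeriodPair.toCubic, L.derivWeierstrassP_neg] at h1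
  apply torsionPoint_snd_ne_zero hg
  rw [← (h.torsion nofun).2]
  simp only [PeriodPair.toCubic]
  linear_combination h1 / 2

lemma zetaDiff_neg_eq (h : IsCompatible .G2 g L a) (hg : discriminant .G2 g ≠ 0) :
    L.zetaDiff a (-a) = -3 * g.1 := by
  obtain ⟨ha, ht⟩ := h.torsion nofun
  have h1 := PeriodPair.two_mul_zetaDiff_neg ha (two_mul_notMem h hg)
  have h2 := Prod.ext_iff.1 ht
  have h3 := (Prod.ext_iff.1 h.invariants).1
  have h4 := torsionPoint_snd_ne_zero hg
  simp only [PeriodPair.toCubic, torsionPoint, cubicInvariants] at h2 h3 h4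
  rw [h2.1, h2.2, h3] at h1
  refine mul_right_cancel₀ h4 ?_
  linear_combination h1 / 2

lemma fst_eq_weierstrassZeta (h : IsCompatible .G2 g L a) (hg : discriminant .G2 g ≠ 0) :
    g.1 = 2 / 3 * L.weierstrassZeta a - 1 / 3 * L.weierstrassZeta (2 * a) := by
  have h1 := zetaDiff_neg_eq h hg
  rw [PeriodPair.zetaDiff, show -a - a = -(2 * a) by ring, L.weierstrassZeta_neg,
    L.weierstrassZeta_neg] at h1
  linear_combination h1 / 3

/-- The formula `zetaDiff_sq` at z = -a reads 9 g_s² = 2℘(a) + ℘(2a). As ℘(a) = 3 g_s², this gives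
℘(2a) = ℘(a), so 2a ≡ ±a, and 2a ≡ a is impossible. -/
lemma three_mul_mem_of_isCompatible (h : IsCompatible .G2 g L a) (hg : discriminant .G2 g ≠ 0) :
    3 * a ∈ L.lattice := by
  obtain ⟨ha, ht⟩ := h.torsion nofun
  have h2a := two_mul_notMem h hg
  have h1 := PeriodPair.zetaDiff_sq ha (z := -a) (by simpa using ha)
    (by rw [show -a - a = -(2 * a) by ring]; simpa using h2a)
  have h2 := Prod.ext_iff.1 ht
  simp only [PeriodPair.toCubic, torsionPoint] at h2
  rw [zetaDiff_neg_eq h hg, show -a - a = -(2 * a) by ring, L.weierstrassP_neg,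
    L.weierstrassP_neg, h2.1] at h1
  rcases L.sub_mem_or_add_mem_of_weierstrassP_eq h2a ha
    (by rw [h2.1]; linear_combination -h1) with h3 | h3
  · exact absurd (by rwa [show 2 * a - a = a by ring] at h3) ha
  · rwa [show 2 * a + a = 3 * a by ring] at h3

lemma level_mul_mem_of_isCompatible (h : IsCompatible T g L a) (hg : discriminant T g ≠ 0)
    (hT : T ≠ .A2) : (level T : ℂ) * a ∈ L.lattice := by
  cases T
  · exact absurd rfl hT
  · simpa [level] using two_mul_mem_of_isCompatible h
  · simpa [level] using three_mul_mem_of_isCompatible h hg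

/-- With a = ω₀ / N, the classes 0, a, -a are the multiples of a, because -a ≡ a for N = 2 and -a ≡
2a for N = 3. -/
lemma placesAtInfinity_eq (T : DihedralType) (L : PeriodPair) :
    placesAtInfinity T L = poles T L (L.ω₁ / level T) := by
  ext z
  have hω := L.ω₁_mem_lattice
  cases T
  · simp [placesAtInfinity, level, poles]
  · constructor
    · rintro ⟨k, hk, hz⟩
      simp only [level] at hk hz ⊢
      interval_cases k
      · exact Or.inl (by simpa using hz)
      · exact Or.inr (Or.inl (by simpa using hz))
    · rintro (hz | hz | hz)
      · exact ⟨0, by simp [level], by simpa using hz⟩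
      · exact ⟨1, by simp [level], by simpa using hz⟩
      · refine ⟨1, by simp [level], ?_⟩
        simp only [level] at hz ⊢
        have := sub_mem hz hω
        rw [show z + L.ω₁ / (2 : ℕ) - L.ω₁ = z - (1 : ℕ) * (L.ω₁ / (2 : ℕ)) by
          push_cast; ring] at this
        exact this
  · constructor
    · rintro ⟨k, hk, hz⟩
      simp only [level] at hk hz ⊢
      interval_cases k
      · exact Or.inl (by simpa using hz)
      · exact Or.inr (Or.inl (by simpa using hz))
      · refine Or.inr (Or.inr ?_)
        have := add_mem hz hω
        rwa [show z - (2 : ℕ) * (L.ω₁ / (3 : ℕ)) + L.ω₁ = z + L.ω₁ / (3 : ℕ) by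
          push_cast; ring] at this
    · rintro (hz | hz | hz)
      · exact ⟨0, by simp [level], by simpa using hz⟩
      · exact ⟨1, by simp [level], by simpa using hz⟩
      · refine ⟨2, by simp [level], ?_⟩
        simp only [level] at hz ⊢
        have := sub_mem hz hω
        rwa [show z + L.ω₁ / (3 : ℕ) - L.ω₁ = z - (2 : ℕ) * (L.ω₁ / (3 : ℕ)) by
          push_cast; ring] at this

lemma meromorphic_halfSlope (L : PeriodPair) (a : ℂ) : Meromorphic (L.halfSlope a) := by
  intro z
  have h1 : MeromorphicAt L.weierstrassP z := L.meromorphic_weierstrassP z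
  have h2 : MeromorphicAt L.derivWeierstrassP z := by
    rw [← L.deriv_weierstrassP]; exact h1.deriv
  unfold PeriodPair.halfSlope
  fun_prop

lemma meromorphic_uniformization (T : DihedralType) (g : ℂ × ℂ) (L : PeriodPair) (a : ℂ) :
    Meromorphic (fun z => (uniformization T g L a z).1) ∧
      Meromorphic (fun z => (uniformization T g L a z).2) := by
  have h1 : ∀ z, MeromorphicAt L.weierstrassP z := fun z => L.meromorphic_weierstrassP z
  have h2 : ∀ z, MeromorphicAt L.derivWeierstrassP z := fun z => by
    rw [← L.deriv_weierstrassP]; exact (h1 z).deriv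
  have h3 : ∀ z, MeromorphicAt (L.halfSlope a) z := fun z => meromorphic_halfSlope L a z
  have h4 : ∀ z, MeromorphicAt (L.halfSlope (-a)) z := fun z => meromorphic_halfSlope L (-a) z
  constructor <;> intro z <;> have h1 := h1 z <;> have h2 := h2 z <;> have h3 := h3 z <;>
    have h4 := h4 z <;> cases T <;> simp only [uniformization] <;> fun_prop

lemma nhdsNE_eventually_notMem_poles (T : DihedralType) (L : PeriodPair) (a z : ℂ) :
    ∀ᶠ w in 𝓝[≠] z, w ∉ poles T L a := by
  cases T
  · exact L.nhdsNE_eventually_notMem_lattice z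
  · exact PeriodPair.nhdsNE_eventually_notMem_slopePoles a z
  · exact PeriodPair.nhdsNE_eventually_notMem_slopePoles a z

/-- Functions that agree with the uniformization off the places at infinity are the inverse
functions of the Abel integral. -/
lemma isInversePair_of_eq (h : IsCompatible T g L (L.ω₁ / level T)) (hg : discriminant T g ≠ 0)
    {x y : ℂ → ℂ} (hxy : ∀ z ∉ poles T L (L.ω₁ / level T),
      (x z, y z) = uniformization T g L (L.ω₁ / level T) z) :
    IsInversePair T g (placesAtInfinity T L) x y where
  meromorphic_x z := by
    refine ((meromorphic_uniformization T g L (L.ω₁ / level T)).1 z).congr ?_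
    filter_upwards [nhdsNE_eventually_notMem_poles T L (L.ω₁ / level T) z] with w hw
    rw [← hxy w hw]
  meromorphic_y z := by
    refine ((meromorphic_uniformization T g L (L.ω₁ / level T)).2 z).congr ?_
    filter_upwards [nhdsNE_eventually_notMem_poles T L (L.ω₁ / level T) z] with w hw
    rw [← hxy w hw]
  isAbelIntegral_iff P z := by
    rw [(isUniformization h hg).isAbelIntegral_iff hg, placesAtInfinity_eq]
    exact and_congr_right fun hz => by rw [hxy z hz]

lemma isInversePair_A2 (h : IsCompatible .A2 g L (L.ω₁ / level .A2))
    (hg : discriminant .A2 g ≠ 0) :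
    IsInversePair .A2 g (placesAtInfinity .A2 L) (fun z => 1 / 4 * L.weierstrassP z)
      (fun z => 1 / 8 * deriv L.weierstrassP z) :=
  isInversePair_of_eq h hg fun z _ => by rw [L.deriv_weierstrassP]; rfl

lemma isInversePair_B2 (h : IsCompatible .B2 g L (L.ω₁ / level .B2))
    (hg : discriminant .B2 g ≠ 0) :
    IsInversePair .B2 g (placesAtInfinity .B2 L)
      (fun z => -(1 / 2) * L.weierstrassZeta (L.ω₁ / 2)
        + 1 / 2 * L.weierstrassZeta z - 1 / 2 * L.weierstrassZeta (z - L.ω₁ / 2))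
      (fun z => -(1 / 4) * L.weierstrassP z + 1 / 4 * L.weierstrassP (z - L.ω₁ / 2)) ∧
    g.1 = 3 / 2 * L.weierstrassP (L.ω₁ / 2) := by
  have e : L.ω₁ / level .B2 = L.ω₁ / 2 := by simp [level]
  refine ⟨isInversePair_of_eq h hg fun z hz => ?_, ?_⟩
  · rw [e] at h hz ⊢
    obtain ⟨ha, ht⟩ := h.torsion nofun
    have h1 := PeriodPair.zetaDiff_eq ha hz
    have h2 := halfSlope_sq_eq ha hz
    simp only [PeriodPair.zetaDiff] at h1
    refine Prod.ext ?_ ?_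
    · simp only [uniformization]; linear_combination h1 / 2
    · simp only [uniformization]; linear_combination -h2 / 4
  · rw [e] at h
    have := congrArg Prod.fst (h.torsion nofun).2
    simp only [PeriodPair.toCubic, torsionPoint] at this
    rw [this]; ring

lemma isInversePair_G2 (h : IsCompatible .G2 g L (L.ω₁ / level .G2))
    (hg : discriminant .G2 g ≠ 0) :
    IsInversePair .G2 g (placesAtInfinity .G2 L)
      (fun z => -(1 / 6) * L.weierstrassZeta (L.ω₁ / 3)
        - 1 / 6 * L.weierstrassZeta (2 * L.ω₁ / 3)
        + 1 / 2 * L.weierstrassZeta z - 1 / 2 * L.weierstrassZeta (z - L.ω₁ / 3))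
      (fun z => 1 / 2 * L.weierstrassZeta (L.ω₁ / 3) + 1 / 2 * L.weierstrassZeta (2 * L.ω₁ / 3)
        - 1 / 2 * L.weierstrassZeta z - 1 / 2 * L.weierstrassZeta (z - L.ω₁ / 3)
        + L.weierstrassZeta (z - 2 * L.ω₁ / 3)) ∧
    g.1 = 2 / 3 * L.weierstrassZeta (L.ω₁ / 3) - 1 / 3 * L.weierstrassZeta (2 * L.ω₁ / 3) := by
  have e : L.ω₁ / level .G2 = L.ω₁ / 3 := by simp [level]
  have h' := h
  rw [e] at h'
  have hgs := fst_eq_weierstrassZeta h' hg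
  rw [← mul_div_assoc] at hgs
  refine ⟨isInversePair_of_eq h hg fun z hz => ?_, hgs⟩
  rw [e] at hz ⊢
  obtain ⟨ha, ht⟩ := h'.torsion nofun
  have h1 := PeriodPair.zetaDiff_eq ha hz
  have hω := L.ω₁_mem_lattice
  -- The half slope is the same for 2ω₀ / 3 as for -ω₀ / 3. The zeta function is only
  -- quasi-periodic, so the zeta formula is applied to the representative that occurs in the claim.
  have h2a : 2 * L.ω₁ / 3 = -(L.ω₁ / 3) + L.ω₁ := by ring
  have hz2 : z ∉ L.slopePoles (2 * L.ω₁ / 3) := by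
    rintro (h3 | h3 | h3)
    · exact hz (Or.inl h3)
    · refine hz (Or.inr (Or.inr ?_))
      have := add_mem h3 hω
      rwa [show z - 2 * L.ω₁ / 3 + L.ω₁ = z + L.ω₁ / 3 by ring] at this
    · refine hz (Or.inr (Or.inl ?_))
      have := sub_mem h3 hω
      rwa [show z + 2 * L.ω₁ / 3 - L.ω₁ = z - L.ω₁ / 3 by ring] at this
  have h2 := PeriodPair.zetaDiff_eq (a := 2 * L.ω₁ / 3)
    (by rw [mul_div_assoc]; exact two_mul_notMem h' hg) hz2
  have h3 : L.halfSlope (2 * L.ω₁ / 3) z = L.halfSlope (-(L.ω₁ / 3)) z := by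
    have := Prod.ext_iff.1 (L.toCubic_add_coe (-(L.ω₁ / 3)) hω)
    simp only [PeriodPair.toCubic] at this
    rw [h2a, PeriodPair.halfSlope, PeriodPair.halfSlope, this.1, this.2]
  rw [h3] at h2
  simp only [PeriodPair.zetaDiff] at h1 h2
  refine Prod.ext ?_ ?_
  · simp only [uniformization]; linear_combination h1 / 2 - hgs / 2
  · simp only [uniformization]; linear_combination h1 / 2 - h2 - 3 / 2 * hgs

end EllipticFamily
end

noncomputable section

/-! ### Transport along paths in the parameter space -/

namespace OrientedPeriods

open ComplexConjugate

/-- A continuous family of lattice elements has constant coordinates. -/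
lemma exists_forall_eq_period {X : Type*} [TopologicalSpace X] [PreconnectedSpace X]
    {ω : X → OrientedPeriods} {u : X → ℂ} (hω : Continuous ω) (hu : Continuous u)
    (h : ∀ x, u x ∈ (ω x).toPair.lattice) : ∃ k, ∀ x, u x = period (ω x).1 k := by
  rcases isEmpty_or_nonempty X with hX | ⟨⟨x₀⟩⟩
  · exact ⟨0, fun x => hX.elim x⟩
  choose k hk using fun x => (ω x).mem_lattice_iff.1 (h x)
  have hω' : Continuous fun x => (ω x).1 := continuous_subtype_val.comp hω
  -- The coordinate is a quotient of area forms, hence continuous, and integral, hence constant.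
  have c1 : Continuous fun x => (((k x).1 : ℤ) : ℝ) := by
    have e : (fun x => (((k x).1 : ℤ) : ℝ)) =
        fun x => (conj (u x) * (ω x).1.2).im / (conj (ω x).1.1 * (ω x).1.2).im := by
      funext x
      rw [eq_div_iff (ω x).2.ne', ← fst_coord (ω x).1 (k x).1 (k x).2, ← hk x]
      simp [period]
    rw [e]
    refine Continuous.div ?_ ?_ fun x => (ω x).2.ne' <;> fun_prop
  have c2 : Continuous fun x => (((k x).2 : ℤ) : ℝ) := by
    have e : (fun x => (((k x).2 : ℤ) : ℝ)) =
        fun x => (conj (ω x).1.1 * u x).im / (conj (ω x).1.1 * (ω x).1.2).im := by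
      funext x
      rw [eq_div_iff (ω x).2.ne', ← snd_coord (ω x).1 (k x).1 (k x).2, ← hk x]
      simp [period]
    rw [e]
    refine Continuous.div ?_ ?_ fun x => (ω x).2.ne' <;> fun_prop
  refine ⟨k x₀, fun x => ?_⟩
  have d1 := PreconnectedSpace.constant ‹_›
    (Int.isClosedEmbedding_coe_real.isInducing.continuous_iff.2 c1) (x := x) (y := x₀)
  have d2 := PreconnectedSpace.constant ‹_›
    (Int.isClosedEmbedding_coe_real.isInducing.continuous_iff.2 c2) (x := x) (y := x₀)
  rw [← hk x, Prod.ext d1 d2]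

lemma exists_continuous_toCubic_eq {X : Type*} [TopologicalSpace X] [SimplyConnectedSpace X]
    [LocallyPathConnectedSpace X] {ω : X → OrientedPeriods} {Q : X → ℂ × ℂ} (hω : Continuous ω)
    (hQ : Continuous Q) (h : ∀ x, (Q x).2 ^ 2 = 4 * (Q x).1 ^ 3 - (ω x).toPair.g₂ * (Q x).1 -
      (ω x).toPair.g₃) {x₀ : X} {z₀ : ℂ} (hz₀ : z₀ ∉ (ω x₀).toPair.lattice)
    (h₀ : (ω x₀).toPair.toCubic z₀ = Q x₀) :
    ∃ z : X → ℂ, Continuous z ∧ z x₀ = z₀ ∧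
      ∀ x, z x ∉ (ω x).toPair.lattice ∧ (ω x).toPair.toCubic (z x) = Q x := by
  set f : C(X, CubicPoints) := ⟨fun x => ⟨(ω x, Q x), h x⟩, by fun_prop⟩ with hf
  obtain ⟨G, ⟨hG0, hG⟩, -⟩ := isCoveringMap_uniformization.existsUnique_continuousMap_lifts f x₀
    ⟨(ω x₀, z₀), hz₀⟩ (Subtype.ext (Prod.ext rfl h₀))
  have hG' : ∀ x, (G x).1.1 = ω x ∧ (G x).1.1.toPair.toCubic (G x).1.2 = Q x := fun x => by
    have := Prod.ext_iff.1 (congrArg Subtype.val (congrFun hG x))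
    exact this
  refine ⟨fun x => (G x).1.2, by fun_prop, by simp [hG0], fun x => ?_⟩
  have h1 := (G x).2
  have h2 := (hG' x).2
  rw [(hG' x).1] at h1 h2
  exact ⟨h1, h2⟩

lemma exists_continuous_invariants_eq {X : Type*} [TopologicalSpace X] [SimplyConnectedSpace X]
    [LocallyPathConnectedSpace X] {W : X → ℂ × ℂ} (hW : Continuous W)
    (h : ∀ x, (W x).1 ^ 3 - 27 * (W x).2 ^ 2 ≠ 0) {x₀ : X} {ω₀ : OrientedPeriods}
    (h₀ : (ω₀.toPair.g₂, ω₀.toPair.g₃) = W x₀) :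
    ∃ ω : X → OrientedPeriods, Continuous ω ∧ ω x₀ = ω₀ ∧
      ∀ x, ((ω x).toPair.g₂, (ω x).toPair.g₃) = W x := by
  set f : C(X, CubicInvariants) := ⟨fun x => ⟨W x, h x⟩, by fun_prop⟩ with hf
  obtain ⟨G, ⟨hG0, hG⟩, -⟩ := isCoveringMap_invariants.existsUnique_continuousMap_lifts f x₀ ω₀
    (Subtype.ext h₀)
  exact ⟨G, G.continuous, hG0, fun x => congrArg Subtype.val (congrFun hG x)⟩

end OrientedPeriods

namespace EllipticFamily

open OrientedPeriods (period)

variable {T : DihedralType}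

/-- The invariants lift to a basis and the torsion point lifts to a parameter a(t). Since N a(t) is
a continuous family of lattice elements, its coordinates keep their initial value (1, 0). -/
lemma exists_isCompatible {g : ℝ → ℂ × ℂ} (hc : Continuous g)
    (hg : ∀ t, discriminant T (g t) ≠ 0) {ω₀ : OrientedPeriods}
    (h₀ : IsCompatible T (g 0) ω₀.toPair (ω₀.1.1 / level T)) :
    ∃ ω : ℝ → OrientedPeriods, Continuous ω ∧ ω 0 = ω₀ ∧
      ∀ t, IsCompatible T (g t) (ω t).toPair ((ω t).1.1 / level T) := by
  obtain ⟨ω, hω, hω0, hinv⟩ := OrientedPeriods.exists_continuous_invariants_eq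
    ((continuous_cubicInvariants T).comp hc)
    (fun t => cubicInvariants_discriminant (hg t)) h₀.invariants
  refine ⟨ω, hω, hω0, fun t => ⟨hinv t, fun hT => ?_⟩⟩
  subst hω0
  obtain ⟨a, ha, ha0, ht⟩ := OrientedPeriods.exists_continuous_toCubic_eq hω
    ((continuous_torsionPoint T).comp hc)
    (fun t => by
      have h1 := Prod.ext_iff.1 (hinv t)
      simp only at h1
      rw [h1.1, h1.2]
      exact torsionPoint_mem hT) (h₀.torsion hT).1 (h₀.torsion hT).2
  obtain ⟨k, hk⟩ := OrientedPeriods.exists_forall_eq_period hω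
    (u := fun t => level T * a t) (by fun_prop)
    fun t => level_mul_mem_of_isCompatible (a := a t) ⟨hinv t, fun _ => ht t⟩ (hg t) hT
  have hN : (level T : ℂ) ≠ 0 := by cases T <;> simp [level]
  have hk' : k = (1, 0) := by
    apply (ω 0).period_injective
    rw [← hk 0, ha0, mul_div_cancel₀ _ hN]
    simp [period]
  have : (ω t).1.1 / level T = a t := by
    rw [div_eq_iff hN, mul_comm, hk t, hk']
    simp [period]
  rw [this]
  exact ht t

/-- The integral over a path in the curve is the increment of any continuous lift. -/
lemma pathIntegral_eq_sub_of_lift {g : ℂ × ℂ} {ω : OrientedPeriods} {S : Set ℂ} {Φ : ℂ → ℂ × ℂ}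
    (h : IsUniformization T g ω.toPair S Φ)
    (hg : discriminant T g ≠ 0) {c : ℝ → ℂ × ℂ} (hc : ContDiffOn ℝ 1 c (Icc 0 1))
    (hcurve : ∀ s ∈ Icc (0 : ℝ) 1, c s ∈ curve T g) {v : ℝ → ℂ} (hv : ContinuousOn v (Icc 0 1))
    (hvL : ∀ s ∈ Icc (0 : ℝ) 1, v s ∉ ω.toPair.lattice ∧
      ω.toPair.toCubic (v s) = cubicMap T g (c s)) :
    pathIntegral T g c 0 1 = v 1 - v 0 := by
  have h0 : (0 : ℝ) ∈ Icc (0 : ℝ) 1 := left_mem_Icc.2 zero_le_one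
  have h1 : (1 : ℝ) ∈ Icc (0 : ℝ) 1 := right_mem_Icc.2 zero_le_one
  obtain ⟨z₀, hz₀, hΦ⟩ := h.exists_eq _ (hcurve 0 h0)
  obtain ⟨w, -, hd, hw, hp⟩ := h.exists_lift hg zero_lt_one hc hcurve h0 hz₀ hΦ
  have hwc : ContinuousOn w (Icc 0 1) := fun s hs => (hd s hs).continuousWithinAt
  -- Two lifts of the same path differ by a continuous lattice-valued function, which is constant.
  obtain ⟨k, hk⟩ := OrientedPeriods.exists_forall_eq_period (X := Icc (0 : ℝ) 1)
    (ω := fun _ => ω) (u := fun s => w s - v s) continuous_const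
    ((continuousOn_iff_continuous_domRestrict.1 hwc).sub (continuousOn_iff_continuous_domRestrict.1 hv))
    fun s => ω.toPair.sub_mem_of_toCubic_eq (fun hm => (hw s s.2).1 (h.lattice_subset _ hm))
      (hvL s s.2).1 (by rw [← h.cubicMap_eq _ (hw s s.2).1, (hw s s.2).2, (hvL s s.2).2])
  have e0 := hk ⟨0, h0⟩
  have e1 := hk ⟨1, h1⟩
  simp only at e0 e1
  rw [hp 0 1 zero_le_one le_rfl le_rfl]
  linear_combination e1 - e0

/-- A transported period has constant coordinates with respect to the transported basis. -/
lemma eq_period_of_isTransportedPeriod {g : ℝ → ℂ × ℂ} (hc : ContinuousOn g (Icc 0 1))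
    (hg : ∀ t ∈ Icc (0 : ℝ) 1, discriminant T (g t) ≠ 0) {ω : ℝ → OrientedPeriods} {a : ℝ → ℂ}
    (hω : Continuous ω) (h : ∀ t ∈ Icc (0 : ℝ) 1, IsCompatible T (g t) (ω t).toPair (a t))
    {c : ℝ → ℂ × ℂ} (hc' : ContDiffOn ℝ 1 c (Icc 0 1)) {k : ℤ × ℤ}
    (hk : pathIntegral T (g 0) c 0 1 = period (ω 0).1 k) {p : ℂ}
    (hp : IsTransportedPeriod T g c p) : p = period (ω 1).1 k := by
  obtain ⟨H, hH, hcurve, hclosed, hH0, hH1, rfl⟩ := hp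
  have h0 : (0 : ℝ) ∈ Icc (0 : ℝ) 1 := left_mem_Icc.2 zero_le_one
  have h1 : (1 : ℝ) ∈ Icc (0 : ℝ) 1 := right_mem_Icc.2 zero_le_one
  -- Clamping to the unit square extends the homotopy to the simply connected plane, where the
  -- covering can be lifted.
  set κ : ℝ → ℝ := fun t => projIcc 0 1 zero_le_one t with hκdef
  have hκc : Continuous κ := continuous_subtype_val.comp continuous_projIcc
  have hκm : ∀ t, κ t ∈ Icc (0 : ℝ) 1 := fun t => (projIcc 0 1 zero_le_one t).2
  have hκ : ∀ t ∈ Icc (0 : ℝ) 1, κ t = t := fun t ht => by simp [hκdef, projIcc_of_mem _ ht]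
  have hgc : Continuous (g ∘ κ) := hc.comp_continuous hκc hκm
  have hHc : Continuous fun x : ℝ × ℝ => H (κ x.1) (κ x.2) :=
    hH.comp_continuous (f := fun x : ℝ × ℝ => (κ x.1, κ x.2)) (by fun_prop)
      fun x => ⟨hκm _, hκm _⟩
  set Q : ℝ × ℝ → ℂ × ℂ := fun x => cubicMap T (g (κ x.1)) (H (κ x.1) (κ x.2)) with hQdef
  have hQ : Continuous Q := (continuous_cubicMap T).comp
    ((hgc.comp continuous_fst).prodMk hHc)
  have hQm : ∀ x, (Q x).2 ^ 2 = 4 * (Q x).1 ^ 3 - (ω (κ x.1)).toPair.g₂ * (Q x).1 -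
      (ω (κ x.1)).toPair.g₃ := fun x => by
    have e := Prod.ext_iff.1 (h _ (hκm x.1)).invariants
    simp only at e
    rw [e.1, e.2]
    exact cubicMap_mem (hcurve _ (hκm _) _ (hκm _))
  have hU : ∀ t (ht : t ∈ Icc (0 : ℝ) 1), IsUniformization T (g t) (ω t).toPair _ _ :=
    fun t ht => isUniformization (h t ht) (hg t ht)
  obtain ⟨z₀, hz₀, hΦ⟩ := (hU _ (hκm 0)).exists_eq _ (hcurve _ (hκm 0) _ (hκm 0))
  obtain ⟨z, hz, -, hzQ⟩ := OrientedPeriods.exists_continuous_toCubic_eq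
    (ω := fun x : ℝ × ℝ => ω (κ x.1)) (by fun_prop) hQ hQm (x₀ := (0, 0)) (z₀ := z₀)
    (fun hm => hz₀ ((hU _ (hκm 0)).lattice_subset _ hm))
    (by rw [← (hU _ (hκm 0)).cubicMap_eq _ hz₀, hΦ])
  -- The loops in between are merely continuous, so their periods are taken as displacements of the
  -- lift; closedness makes these lattice elements, with constant coordinates in the moving basis.
  obtain ⟨l, hl⟩ := OrientedPeriods.exists_forall_eq_period
    (ω := fun t => ω (κ t)) (u := fun t => z (t, 1) - z (t, 0)) (by fun_prop) (by fun_prop)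
    fun t => (ω (κ t)).toPair.sub_mem_of_toCubic_eq (hzQ (t, 1)).1 (hzQ (t, 0)).1 (by
      rw [(hzQ (t, 1)).2, (hzQ (t, 0)).2]
      simp only [hQdef, hκ 0 h0, hκ 1 h1, hclosed _ (hκm t)])
  have key : ∀ t ∈ Icc (0 : ℝ) 1, ∀ c' : ℝ → ℂ × ℂ, ContDiffOn ℝ 1 c' (Icc 0 1) →
      EqOn (H t) c' (Icc 0 1) → pathIntegral T (g t) c' 0 1 = period (ω t).1 l := by
    intro t ht c' hcd he
    have e := hl t
    simp only [hκ t ht] at e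
    rw [← e]
    refine pathIntegral_eq_sub_of_lift (hU t ht) (hg t ht) hcd
      (fun s hs => he hs ▸ hcurve t ht s hs) (v := fun s => z (t, s))
      (Continuous.continuousOn (by fun_prop)) fun s hs => ?_
    have := hzQ (t, s)
    simp only [hQdef, hκ t ht, hκ s hs, he hs] at this
    exact this
  have hkl : k = l := (ω 0).period_injective (hk.symm.trans (key 0 h0 c hc' hH0))
  rw [hkl]
  exact key 1 h1 _ hH1 fun _ _ => rfl

end EllipticFamily
end

noncomputable section

/-! ### Reflections and loops -/

open ComplexConjugate

namespace IsComplexFlow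

variable {V : ℂ × ℂ → ℂ × ℂ} {S : Set ℂ} {Φ : ℂ → ℂ × ℂ}

lemma star_conj (h : IsComplexFlow V S Φ) (hV : ∀ P, V (star P) = star (V P)) :
    IsComplexFlow V (conj ⁻¹' S) (star ∘ Φ ∘ conj) where
  contDiff := h.contDiff
  isClosed := h.isClosed.preimage Complex.continuous_conj
  countable := h.countable.preimage (RingHom.injective _)
  hasDerivAt z hz := by
    have h1 := (h.hasDerivAt (conj z) hz).star_conj
    rw [Complex.conj_conj] at h1
    rw [← hV] at h1
    exact h1
  tendsto s hs := by
    have h1 : Tendsto conj (𝓝[(conj ⁻¹' S)ᶜ] s) (𝓝[Sᶜ] (conj s)) :=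
      tendsto_nhdsWithin_iff.2 ⟨(Complex.continuous_conj.tendsto s).mono_left inf_le_left,
        eventually_mem_nhdsWithin⟩
    refine ((h.tendsto _ hs).comp h1).congr fun z => ?_
    simp

/-- The reflection principle for a flow that is real at the point `z₀`. -/
lemma reflection (h : IsComplexFlow V S Φ) (hV : ∀ P, V (star P) = star (V P)) {z₀ : ℂ}
    (hz₀ : z₀ ∉ S) (h₀ : star (Φ z₀) = Φ z₀) (w : ℂ) :
    (z₀ + w ∈ S ↔ z₀ + conj w ∈ S) ∧ (z₀ + w ∉ S → Φ (z₀ + w) = star (Φ (z₀ + conj w))) := by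
  obtain ⟨h1, h2⟩ := h.eq_of_eq (h.star_conj hV) (z := z₀) (z' := conj z₀) hz₀
    (by simpa using hz₀) (by simp [h₀])
  have h3 := h1 w
  have h4 := h2 w
  simp only [mem_preimage, map_add, Complex.conj_conj, Function.comp_apply] at h3 h4
  exact ⟨h3, fun hw => h4 hw (fun h' => hw (h3.2 h'))⟩

end IsComplexFlow

/-- Multiples of a vector in a group are integer multiples of a minimal one. -/
lemma exists_int_mul_eq_of_minimal {Λ : Submodule ℤ ℂ} {e : ℂ} {l : ℝ} (hl : 0 < l)
    (hmem : (l : ℂ) * e ∈ Λ) (hmin : ∀ x : ℝ, 0 < x → x < l → (x : ℂ) * e ∉ Λ) {x : ℝ}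
    (hx : (x : ℂ) * e ∈ Λ) : ∃ m : ℤ, x = m * l := by
  refine ⟨⌊x / l⌋, ?_⟩
  have h1 := Int.floor_le (x / l)
  have h2 := Int.lt_floor_add_one (x / l)
  rw [le_div_iff₀ hl] at h1
  rw [div_lt_iff₀ hl] at h2
  by_contra hne
  refine hmin (x - ⌊x / l⌋ * l) ?_ (by linarith) ?_
  · exact sub_pos.2 (lt_of_le_of_ne h1 (Ne.symm hne))
  · convert Λ.sub_mem hx (Λ.smul_mem ⌊x / l⌋ hmem) using 1
    push_cast
    rw [zsmul_eq_mul]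
    ring

/-- A lattice symmetric with respect to the real axis and to a parallel of the real axis without
lattice points is rectangular. -/
lemma exists_eq_of_symmetric {Λ : Submodule ℤ ℂ} {l m : ℝ} (hl : 0 < l) (hm : 0 < m)
    (hlm : (l : ℂ) ∈ Λ) (hmm : (m : ℂ) * Complex.I ∈ Λ)
    (hlmin : ∀ x : ℝ, 0 < x → x < l → (x : ℂ) ∉ Λ)
    (hmmin : ∀ x : ℝ, 0 < x → x < m → (x : ℂ) * Complex.I ∉ Λ)
    (hconj : ∀ z ∈ Λ, conj z ∈ Λ) {z₀ : ℂ} (hline : ∀ x : ℝ, z₀ + x ∉ Λ)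
    (hz₀ : z₀ - conj z₀ ∈ Λ) :
    (∃ k : ℤ, Odd k ∧ 2 * z₀.im = k * m) ∧
      ∀ z ∈ Λ, ∃ i j : ℤ, z = i * l + j * (m * Complex.I) := by
  have him : ∀ z, z - conj z ∈ Λ → ∃ k : ℤ, 2 * z.im = k * m := fun z hz =>
    exists_int_mul_eq_of_minimal hm hmm hmmin (by rwa [Complex.sub_conj] at hz)
  obtain ⟨k, hk⟩ := him z₀ hz₀
  have hkodd : Odd k := by
    -- For even k the line z₀ + ℝ would pass through a multiple of i m.
    rw [← Int.not_even_iff_odd]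
    rintro ⟨j, rfl⟩
    refine hline (-z₀.re) ?_
    convert Λ.smul_mem j hmm using 1
    rw [zsmul_eq_mul]
    apply Complex.ext <;> simp
    push_cast at hk
    linarith
  refine ⟨⟨k, hkodd, hk⟩, fun z hz => ?_⟩
  obtain ⟨n, hn⟩ := him z (Λ.sub_mem hz (hconj z hz))
  rcases Int.even_or_odd n with ⟨j, rfl⟩ | hodd
  · have h1 : ((z.re : ℝ) : ℂ) * 1 ∈ Λ := by
      convert Λ.sub_mem hz (Λ.smul_mem j hmm) using 1
      rw [zsmul_eq_mul]
      apply Complex.ext <;> simp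
      push_cast at hn
      linarith
    obtain ⟨i, hi⟩ := exists_int_mul_eq_of_minimal hl (by simpa using hlm)
      (by simpa using hlmin) h1
    refine ⟨i, j, ?_⟩
    apply Complex.ext <;> simp [hi]
    push_cast at hn
    linarith
  -- The rhombic case: twice the height of z is an odd multiple of m, like that of z₀, so a
  -- translate of z by a multiple of i m lies on the forbidden line.
  · obtain ⟨j, hj⟩ := hkodd.sub_odd hodd
    refine absurd ?_ (hline (z.re - z₀.re))
    convert Λ.add_mem hz (Λ.smul_mem j hmm) using 1
    rw [zsmul_eq_mul]
    have hj' : (k : ℝ) - n = j + j := by exact_mod_cast hj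
    apply Complex.ext <;> simp
    have : ((k : ℝ) - n) * m = (j + j) * m := by rw [hj']
    linarith

namespace EllipticFamily

variable {T : DihedralType} {g : ℂ × ℂ} {L : PeriodPair} {S : Set ℂ} {Φ : ℂ → ℂ × ℂ}

lemma hamiltonianField_star (T : DihedralType) (gs gl : ℝ) (P : ℂ × ℂ) :
    hamiltonianField T (gs, gl) (star P) = star (hamiltonianField T (gs, gl) P) := by
  cases T <;> ext <;> simp [hamiltonianField]

lemma tendsto_star_nhdsInfinityOne (T : DihedralType) :
    Tendsto star (nhdsInfinityOne T) (nhdsInfinityOne T) := by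
  have h1 : Tendsto (star : ℂ × ℂ → ℂ × ℂ) (comap (fun P => ‖P.1‖) atTop)
      (comap (fun P => ‖P.1‖) atTop) :=
    tendsto_comap_iff.2 (tendsto_comap.congr fun P => by simp)
  have h2 : Tendsto (star : ℂ → ℂ) (𝓝 (-1)) (𝓝 (-1)) := by
    simpa using (continuous_star (R := ℂ)).tendsto (-1)
  cases T
  · exact h1
  · exact h1.inf (tendsto_comap_iff.2 ((h2.comp tendsto_comap).congr fun P => by simp))
  · exact h1.inf (tendsto_comap_iff.2 ((h2.comp tendsto_comap).congr fun P => by simp))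

/-- A simple loop on which the residue form is a positive multiple of `e` lifts to a segment. -/
lemma IsUniformization.exists_segment (h : IsUniformization T g L S Φ)
    (hg : discriminant T g ≠ 0) {c : ℝ → ℂ × ℂ} (hc : IsSimpleLoop T g c) {e : ℂ} (he : e ≠ 0)
    (hor : ∀ s ∈ Ioo (0 : ℝ) 1, ∃ r : ℝ, 0 < r ∧ primitiveForm T g (c s) (deriv c s) = r * e) :
    ∃ z₀ : ℂ, ∃ l : ℝ, 0 < l ∧ pathIntegral T g c 0 1 = l * e ∧ l * e ∈ L.lattice ∧
      (∀ x : ℝ, 0 < x → x < l → (x : ℂ) * e ∉ L.lattice) ∧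
      ∀ x ∈ Icc 0 l, z₀ + x * e ∉ S ∧ Φ (z₀ + x * e) ∈ c '' Icc 0 1 := by
  have h0 : (0 : ℝ) ∈ Icc (0 : ℝ) 1 := left_mem_Icc.2 zero_le_one
  have h1 : (1 : ℝ) ∈ Icc (0 : ℝ) 1 := right_mem_Icc.2 zero_le_one
  obtain ⟨z₀, hz₀, hΦ⟩ := h.exists_eq _ (hc.mem_curve 0 h0)
  obtain ⟨w, hw0, hd, hw, hp⟩ := h.exists_lift hg zero_lt_one hc.contDiffOn hc.mem_curve h0 hz₀ hΦ
  -- The displacement of the lift in units of e has a positive real derivative. It is therefore real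
  -- and increasing, and the lift runs through a segment of direction e.
  set f : ℝ → ℂ := fun s => (w s - z₀) / e with hf
  have hfc : ContinuousOn f (Icc 0 1) := fun s hs =>
    (((hd s hs).continuousWithinAt).sub continuousWithinAt_const).div_const e
  have hf0 : f 0 = 0 := by simp [hf, hw0]
  have hfd : ∀ s ∈ Ioo (0 : ℝ) 1, ∃ r : ℝ, 0 < r ∧ HasDerivAt f r s := by
    intro s hs
    obtain ⟨r, hr, hre⟩ := hor s hs
    have hn := Icc_mem_nhds hs.1 hs.2
    have hd' := (hd s (Ioo_subset_Icc_self hs)).hasDerivAt hn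
    rw [speed, derivWithin_of_mem_nhds hn, hre] at hd'
    refine ⟨r, hr, ?_⟩
    have := (hd'.sub_const z₀).div_const e
    rwa [mul_div_cancel_right₀ _ he] at this
  have hre : ∀ s ∈ Ioo (0 : ℝ) 1, ∃ r : ℝ, 0 < r ∧ HasDerivAt (fun s => (f s).re) r s ∧
      HasDerivAt (fun s => (f s).im) 0 s := by
    intro s hs
    obtain ⟨r, hr, hdr⟩ := hfd s hs
    have e1 := (Complex.reCLM.hasFDerivAt (x := f s)).comp_hasDerivAt s hdr
    have e2 := (Complex.imCLM.hasFDerivAt (x := f s)).comp_hasDerivAt s hdr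
    simp only [Complex.reCLM_apply, Complex.ofReal_re, Complex.imCLM_apply,
      Complex.ofReal_im] at e1 e2
    exact ⟨r, hr, e1, e2⟩
  have hrec : ContinuousOn (fun s => (f s).re) (Icc 0 1) :=
    Complex.continuous_re.comp_continuousOn hfc
  have himc : ContinuousOn (fun s => (f s).im) (Icc 0 1) :=
    Complex.continuous_im.comp_continuousOn hfc
  have hmono : StrictMonoOn (fun s => (f s).re) (Icc 0 1) := by
    refine strictMonoOn_of_deriv_pos (convex_Icc 0 1) hrec fun s hs => ?_
    rw [interior_Icc] at hs
    obtain ⟨r, hr, hdr, -⟩ := hre s hs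
    rwa [hdr.deriv]
  have him : ∀ s ∈ Icc (0 : ℝ) 1, (f s).im = 0 := by
    intro s hs
    have m1 : MonotoneOn (fun s => (f s).im) (Icc 0 1) := by
      refine monotoneOn_of_deriv_nonneg (convex_Icc 0 1) himc ?_ fun s hs => ?_ <;>
        rw [interior_Icc] at *
      · intro s hs
        obtain ⟨r, hr, -, hdi⟩ := hre s hs
        exact hdi.differentiableAt.differentiableWithinAt
      · obtain ⟨r, hr, -, hdi⟩ := hre s hs
        exact hdi.deriv.ge
    have m2 : AntitoneOn (fun s => (f s).im) (Icc 0 1) := by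
      refine antitoneOn_of_deriv_nonpos (convex_Icc 0 1) himc ?_ fun s hs => ?_ <;>
        rw [interior_Icc] at *
      · intro s hs
        obtain ⟨r, hr, -, hdi⟩ := hre s hs
        exact hdi.differentiableAt.differentiableWithinAt
      · obtain ⟨r, hr, -, hdi⟩ := hre s hs
        exact hdi.deriv.le
    have b1 := m1 h0 hs hs.1
    have b2 := m2 h0 hs hs.1
    simp only [hf0, Complex.zero_im] at b1 b2
    exact le_antisymm b2 b1
  have hwf : ∀ s ∈ Icc (0 : ℝ) 1, w s = z₀ + ((f s).re : ℂ) * e := by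
    intro s hs
    have e1 : ((f s).re : ℂ) = f s := Complex.ext (by simp) (by simp [him s hs])
    rw [e1, hf, div_mul_cancel₀ _ he]
    ring
  have hsurj : ∀ x ∈ Icc 0 (f 1).re, ∃ s ∈ Icc (0 : ℝ) 1, (f s).re = x := by
    intro x hx
    have := intermediate_value_Icc zero_le_one hrec
    rw [hf0, Complex.zero_re] at this
    exact this hx
  have hseg : ∀ x ∈ Icc 0 (f 1).re, ∃ s ∈ Icc (0 : ℝ) 1, (f s).re = x ∧
      z₀ + x * e ∉ S ∧ Φ (z₀ + x * e) = c s := by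
    intro x hx
    obtain ⟨s, hs, rfl⟩ := hsurj x hx
    rw [← hwf s hs]
    exact ⟨s, hs, rfl, hw s hs⟩
  have hpos : 0 < (f 1).re := by
    have := hmono h0 h1 zero_lt_one
    simpa [hf0] using this
  refine ⟨z₀, (f 1).re, hpos, ?_, ?_, ?_, fun x hx => ?_⟩
  · rw [hp 0 1 zero_le_one le_rfl le_rfl, hw0, hwf 1 h1]
    ring
  · have e1 := hw 1 h1
    have e2 : L.toCubic (w 1) = L.toCubic z₀ := by
      rw [← h.cubicMap_eq _ e1.1, ← h.cubicMap_eq _ hz₀, e1.2, hΦ, hc.closed]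
    have := L.sub_mem_of_toCubic_eq (fun hm => e1.1 (h.lattice_subset _ hm))
      (fun hm => hz₀ (h.lattice_subset _ hm)) e2
    rwa [hwf 1 h1, add_sub_cancel_left] at this
  · intro x hx hxl hm
    -- A shorter period in the direction e would bring the loop back to its initial point too early.
    obtain ⟨s, hs, hsx, -, hsc⟩ := hseg x ⟨hx.le, hxl.le⟩
    rw [h.apply_add _ _ hm, hΦ] at hsc
    have hs1 : s < 1 := lt_of_le_of_ne hs.2 fun h => by subst h; exact hxl.ne' hsx
    have := hc.injOn ⟨le_rfl, zero_lt_one⟩ ⟨hs.1, hs1⟩ hsc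
    rw [← this, hf0] at hsx
    exact hx.ne hsx
  · obtain ⟨s, hs, -, hm, hsc⟩ := hseg x hx
    exact ⟨hm, s, hs, hsc.symm⟩

end EllipticFamily
end

noncomputable section

/-! ### The curves over the totally real component -/

open ComplexConjugate

lemma PeriodPair.toCubic_eq_of_lattice_eq {L L' : PeriodPair} (h : L.lattice = L'.lattice) (z : ℂ) :
    L.toCubic z = L'.toCubic z := by
  simp only [toCubic, weierstrassP, derivWeierstrassP]
  rw [h]

/-- The derivative `℘'` is negative on the first half of the real period. -/
lemma OrientedPeriods.re_derivWeierstrassP_nonpos (ω : OrientedPeriods) {l x₀ : ℝ}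
    (hmin : ∀ x : ℝ, 0 < x → x < l → (x : ℂ) ∉ ω.toPair.lattice) (hx₀ : 0 < x₀)
    (hx₀l : 2 * x₀ < l) (hreal : ∀ x : ℝ, (x : ℂ) ∉ ω.toPair.lattice →
      star (ω.toPair.toCubic x) = ω.toPair.toCubic x) :
    (ω.toPair.derivWeierstrassP x₀).re ≤ 0 := by
  by_contra! hpos
  have hmem : ∀ x ∈ Ioc 0 x₀, (x : ℂ) ∉ ω.toPair.lattice := fun x hx =>
    hmin x hx.1 (by linarith [hx.2])
  have hd : ∀ x ∈ Ioc 0 x₀, HasDerivAt (fun x : ℝ => (ω.toPair.weierstrassP x).re)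
      (ω.toPair.derivWeierstrassP x).re x := fun x hx =>
    (ω.toPair.hasDerivAt_weierstrassP (hmem x hx)).real_of_complex
  have hd' : ∀ x ∈ Ioc 0 x₀, ContinuousAt (fun x : ℝ => (ω.toPair.derivWeierstrassP x).re) x :=
    fun x hx => (ω.toPair.hasDerivAt_derivWeierstrassP (hmem x hx)).real_of_complex.continuousAt
  -- A zero of ℘' at x gives x and -x the same point of the cubic, so 2x would be a period, but 2x <
  -- l.
  have hne : ∀ x ∈ Ioc 0 x₀, (ω.toPair.derivWeierstrassP x).re ≠ 0 := by
    intro x hx h0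
    have h1 := congrArg Prod.snd (hreal x (hmem x hx))
    have h2 : ω.toPair.derivWeierstrassP x = 0 :=
      Complex.ext h0 (Complex.conj_eq_iff_im.1 h1)
    have h3 := ω.toPair.sub_mem_of_toCubic_eq (z := x) (w := -x) (hmem x hx)
      (fun h => hmem x hx (by simpa using h)) (by
        simp [PeriodPair.toCubic, h2])
    refine hmin (2 * x) (by linarith [hx.1]) (by linarith [hx.2]) ?_
    convert h3 using 1
    push_cast
    ring
  have hp : ∀ x ∈ Ioc 0 x₀, 0 < (ω.toPair.derivWeierstrassP x).re := by
    intro x hx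
    by_contra! hneg
    obtain ⟨y, hy, hy0⟩ := intermediate_value_Icc hx.2
      (fun y hy => (hd' y ⟨hx.1.trans_le hy.1, hy.2⟩).continuousWithinAt) ⟨hneg, hpos.le⟩
    exact hne y ⟨hx.1.trans_le hy.1, hy.2⟩ hy0
  have hmono : MonotoneOn (fun x : ℝ => (ω.toPair.weierstrassP x).re) (Ioc 0 x₀) := by
    refine monotoneOn_of_deriv_nonneg (convex_Ioc 0 x₀)
      (fun x hx => (hd x hx).continuousAt.continuousWithinAt) ?_ fun x hx => ?_ <;>
      rw [interior_Ioc] at *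
    · exact fun x hx => (hd x (Ioo_subset_Ioc_self hx)).differentiableAt.differentiableWithinAt
    · rw [(hd x (Ioo_subset_Ioc_self hx)).deriv]
      exact (hp x (Ioo_subset_Ioc_self hx)).le
  -- If ℘' were positive on (0, x₀], then ℘ would be bounded above near 0, against the pole 1 / x².
  have hle : ∀ᶠ x : ℝ in 𝓝[>] (0 : ℝ),
      (ω.toPair.weierstrassP x).re ≤ (ω.toPair.weierstrassP x₀).re := by
    filter_upwards [Ioc_mem_nhdsGT hx₀] with x hx
    exact hmono hx ⟨hx₀, le_rfl⟩ hx.2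
  have hc : ContinuousAt (fun x : ℝ => (regularP ω x).re) 0 := by
    have h1 : ContinuousAt (fun p : OrientedPeriods × ℂ => regularP p.1 p.2) (ω, ((0 : ℝ) : ℂ)) :=
      continuousAt_regularP fun k hk h => hk (ω.period_eq_zero_iff.1 (by simpa using h.symm))
    exact Complex.continuous_re.continuousAt.comp (h1.comp (f := fun x : ℝ => (ω, (x : ℂ)))
      (x := 0) (by fun_prop))
  have ht : Tendsto (fun x : ℝ => (x ^ 2)⁻¹ + (regularP ω x).re) (𝓝[>] 0) atTop := by
    refine Tendsto.atTop_add ?_ (hc.tendsto.mono_left inf_le_left)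
    have : Tendsto (fun x : ℝ => x⁻¹ ^ 2) (𝓝[>] 0) atTop :=
      (tendsto_pow_atTop two_ne_zero).comp tendsto_inv_nhdsGT_zero
    exact this.congr fun x => inv_pow x 2
  obtain ⟨x, hx1, hx2⟩ := (hle.and (ht.eventually_gt_atTop
    (ω.toPair.weierstrassP x₀).re)).exists
  rw [ω.weierstrassP_eq, Complex.add_re, ← Complex.ofReal_pow, ← Complex.ofReal_one,
    ← Complex.ofReal_div, Complex.ofReal_re, one_div] at hx1
  linarith

namespace EllipticFamily

variable {T : DihedralType} {gs gl : ℝ} {a : ℂ}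

lemma star_cubicInvariants_fst (T : DihedralType) (gs gl : ℝ) :
    conj (cubicInvariants T (gs, gl)).1 = (cubicInvariants T (gs, gl)).1 := by
  cases T <;> simp [cubicInvariants, Complex.conj_ofNat]

lemma star_torsionPoint (T : DihedralType) (gs gl : ℝ) :
    star (torsionPoint T (gs, gl)) = torsionPoint T (gs, gl) := by
  cases T <;> ext <;> simp [torsionPoint]

/-- The torsion parameter is the rational multiple `ω₀ / [p/2]` of the real period. -/
lemma IsCompatible.of_rectangular {ω : OrientedPeriods} {l m : ℝ} (hl : 0 < l)
    (hω : ω.1 = ((l : ℂ), (m : ℂ) * Complex.I)) (hΓ : IsTotallyReal T gs gl)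
    (hg : discriminant T (gs, gl) ≠ 0)
    (h : IsCompatible T (gs, gl) ω.toPair a) {y : ℝ} {k : ℤ} (hk : Odd k) (hy : 2 * y = k * m)
    (hline : ∀ x : ℝ, (x : ℂ) + y * Complex.I ∉ poles T ω.toPair a) :
    IsCompatible T (gs, gl) ω.toPair (ω.1.1 / level T) := by
  refine ⟨h.invariants, fun hT => ?_⟩
  obtain ⟨ha, hta⟩ := h.torsion hT
  have hmem : ∀ z, z ∈ ω.toPair.lattice ↔ ∃ i j : ℤ, z = i * l + j * (m * Complex.I) := by
    intro z
    rw [ω.mem_lattice_iff]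
    constructor
    · rintro ⟨k, rfl⟩
      exact ⟨k.1, k.2, by simp [OrientedPeriods.period, hω]⟩
    · rintro ⟨i, j, rfl⟩
      exact ⟨(i, j), by simp [OrientedPeriods.period, hω]⟩
  suffices hsub : a - ω.1.1 / level T ∈ ω.toPair.lattice by
    have e : ω.1.1 / level T = a + -(a - ω.1.1 / level T) := by ring
    refine ⟨fun hm => ha ?_, ?_⟩
    · simpa using add_mem hsub hm
    · rw [e, ω.toPair.toCubic_add_coe _ (neg_mem hsub), hta]
  obtain ⟨i, j, hij⟩ := (hmem _).1 (level_mul_mem_of_isCompatible h hg hT)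
  cases T
  · exact absurd rfl hT
  · simp only [level, Nat.cast_ofNat] at hij ⊢
    have hre := congrArg Complex.re hij
    have him := congrArg Complex.im hij
    simp at hre him
    -- Of the classes with 2a in the lattice, those with odd j have the height of the line over the
    -- oval, which contains no pole; of the others only ω₀ / 2 is not a lattice class.
    rcases Int.even_or_odd j with ⟨j, rfl⟩ | hj
    · rcases Int.even_or_odd i with ⟨i, rfl⟩ | ⟨i, rfl⟩
      · refine absurd ((hmem a).2 ⟨i, j, ?_⟩) ha
        push_cast at hij
        linear_combination hij / 2
      · refine (hmem _).2 ⟨i, j, ?_⟩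
        rw [hω]
        push_cast at hij
        linear_combination hij / 2
    · obtain ⟨n, hn⟩ := hk.sub_odd hj
      have hn' : (k : ℝ) - j = n + n := by exact_mod_cast hn
      refine absurd ?_ (hline a.re)
      refine Or.inr (Or.inl ((hmem _).2 ⟨0, n, ?_⟩))
      have : ((k : ℝ) - j) * m = (n + n) * m := by rw [hn']
      apply Complex.ext <;> simp
      linarith
  · simp only [level, Nat.cast_ofNat] at hij ⊢
    have hg₂ : conj ω.toPair.g₂ = ω.toPair.g₂ := by
      have := Prod.ext_iff.1 h.invariants
      simp only at this
      rw [this.1, star_cubicInvariants_fst]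
    have hrefl : ∀ z₀ ∉ ω.toPair.lattice, star (ω.toPair.toCubic z₀) = ω.toPair.toCubic z₀ →
        ∀ w, _ := fun z₀ hz₀ h₀ => ω.toPair.isComplexFlow_toCubic.reflection
          (fun P => by ext <;> simp [weierstrassField, hg₂]) hz₀ h₀
    -- The torsion point is real, so conjugation fixes a modulo the lattice; this leaves the classes
    -- of 0, l/3 and 2l/3.
    have hsub : a - conj a ∈ ω.toPair.lattice := by
      have := (hrefl a ha (by rw [hta, star_torsionPoint]) (-a)).1
      simpa [sub_eq_add_neg] using this
    obtain ⟨i', j', hij'⟩ := (hmem _).1 hsub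
    have hre := congrArg Complex.re hij
    have him := congrArg Complex.im hij
    have him' := congrArg Complex.im hij'
    simp at hre him him'
    have ha' : a = i / 3 * l + (j - j' : ℤ) * (m * Complex.I) := by
      apply Complex.ext <;> simp <;> linarith
    obtain ⟨q, hq | hq | hq⟩ : ∃ q : ℤ, i = 3 * q ∨ i = 3 * q + 1 ∨ i = 3 * q + 2 :=
      ⟨i / 3, by omega⟩
    · refine absurd ((hmem a).2 ⟨q, j - j', ?_⟩) ha
      rw [ha', hq]
      push_cast
      ring
    · refine (hmem _).2 ⟨q, j - j', ?_⟩
      rw [ha', hω, hq]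
      push_cast
      ring
    -- The class 2l/3 would make ℘'(l/3) equal to -2(g_l - 2g_s³), which is positive on Γ, whereas
    -- ℘' is not positive on the first half of the real period.
    · have hsum : ((l / 3 : ℝ) : ℂ) + a ∈ ω.toPair.lattice := by
        refine (hmem _).2 ⟨q + 1, j - j', ?_⟩
        rw [ha', hq]
        push_cast
        ring
      have hmin : ∀ x : ℝ, 0 < x → x < l → (x : ℂ) ∉ ω.toPair.lattice := by
        rintro x hx hxl hxm
        obtain ⟨i, j, hx'⟩ := (hmem _).1 hxm
        have := congrArg Complex.re hx'
        simp at this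
        rw [this] at hx hxl
        have h1 : (0 : ℝ) < i := (mul_pos_iff_of_pos_right hl).1 hx
        have h2 : (i : ℝ) < 1 := by
          by_contra! hi
          nlinarith
        have h3 : 0 < i := by exact_mod_cast h1
        have h4 : i < 1 := by exact_mod_cast h2
        omega
      have hcub : ω.toPair.toCubic ((l / 3 : ℝ) : ℂ) =
          ((torsionPoint .G2 (gs, gl)).1, -(torsionPoint .G2 (gs, gl)).2) := by
        rw [← hta, show ((l / 3 : ℝ) : ℂ) = -a + (((l / 3 : ℝ) : ℂ) + a) by ring,
          ω.toPair.toCubic_add_coe _ hsum]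
        simp [PeriodPair.toCubic]
      have hl3 := hmin (l / 3) (by linarith) (by linarith)
      have hneg := ω.re_derivWeierstrassP_nonpos hmin (x₀ := l / 3) (by linarith) (by linarith)
        fun x hx => by
          have := (hrefl _ hl3 (by
            rw [hcub]; ext <;> simp [torsionPoint]) ((x : ℂ) - ((l / 3 : ℝ) : ℂ))).2
          rw [map_sub, Complex.conj_ofReal, Complex.conj_ofReal] at this
          rw [add_sub_cancel] at this
          exact (this hx).symm
      have hsnd := congrArg Prod.snd hcub
      simp only [PeriodPair.toCubic, torsionPoint] at hsnd
      rw [hsnd] at hneg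
      have := (abs_lt.1 hΓ.2).2
      have e : -(2 * ((gl : ℂ) - 2 * gs ^ 3)) = ((-(2 * (gl - 2 * gs ^ 3)) : ℝ) : ℂ) := by
        push_cast; ring
      rw [e, Complex.ofReal_re] at hneg
      linarith

/-- Over the totally real component the periods of `γ₀` and `γ₁` form an oriented basis of the
lattice of periods. -/
theorem exists_isCompatible_of_isTotallyReal (hΓ : IsTotallyReal T gs gl)
    (hg : discriminant T (gs, gl) ≠ 0) {c₀ c₁ : ℝ → ℂ × ℂ}
    (h₀ : IsGammaZero T (gs, gl) c₀) (h₁ : IsGammaOne T (gs, gl) c₁) :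
    ∃ ω : OrientedPeriods, IsCompatible T (gs, gl) ω.toPair (ω.1.1 / level T) ∧
      pathIntegral T (gs, gl) c₀ 0 1 = ω.1.1 ∧ pathIntegral T (gs, gl) c₁ 0 1 = ω.1.2 := by
  obtain ⟨ω', hω'⟩ := OrientedPeriods.surjective_invariants
    ⟨cubicInvariants T (gs, gl), cubicInvariants_discriminant hg⟩
  have hinv : (ω'.toPair.g₂, ω'.toPair.g₃) = cubicInvariants T (gs, gl) :=
    congrArg Subtype.val hω'
  set L := ω'.toPair with hL
  obtain ⟨a, hLa⟩ : ∃ a, IsCompatible T (gs, gl) L a := by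
    by_cases hT : T = .A2
    · exact ⟨0, hinv, fun h => absurd hT h⟩
    · have h1 := Prod.ext_iff.1 hinv
      simp only at h1
      obtain ⟨a, ha, ha'⟩ := L.exists_toCubic_eq (P := torsionPoint T (gs, gl))
        (by rw [h1.1, h1.2]; exact torsionPoint_mem hT)
      exact ⟨a, hinv, fun _ => ⟨ha, ha'⟩⟩
  have hU := isUniformization hLa hg
  set S := poles T L a
  set Φ := uniformization T (gs, gl) L a
  obtain ⟨z₀, l, hl, hint₀, hlm, hlmin, hseg⟩ := hU.exists_segment hg h₀.toIsSimpleLoop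
    one_ne_zero (by simpa using h₀.oriented)
  obtain ⟨-, m, hm, hint₁, hmm, hmmin, -⟩ := hU.exists_segment hg h₁.toIsSimpleLoop
    Complex.I_ne_zero h₁.oriented
  simp only [mul_one] at hint₀ hlm hlmin hseg
  have hz₀ : z₀ ∉ S ∧ star (Φ z₀) = Φ z₀ := by
    obtain ⟨h1, s, hs, h2⟩ := hseg 0 ⟨le_rfl, hl.le⟩
    rw [Complex.ofReal_zero, add_zero] at h1 h2
    refine ⟨h1, ?_⟩
    rw [← h2]
    exact Prod.ext (Complex.conj_eq_iff_im.2 (h₀.real s hs).1)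
      (Complex.conj_eq_iff_im.2 (h₀.real s hs).2)
  have hrefl := hU.toIsComplexFlow.reflection (hamiltonianField_star T gs gl) hz₀.1 hz₀.2
  have hlineS : ∀ x : ℝ, z₀ + x ∉ S := by
    intro x hx
    have e : z₀ + x = (z₀ + ((x - ⌊x / l⌋ * l : ℝ) : ℂ)) + ⌊x / l⌋ • (l : ℂ) := by
      rw [zsmul_eq_mul]
      push_cast
      ring
    rw [e, hU.add_mem_iff _ _ (L.lattice.smul_mem _ hlm)] at hx
    have h1 := Int.floor_le (x / l)
    have h2 := Int.lt_floor_add_one (x / l)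
    rw [le_div_iff₀ hl] at h1
    rw [div_lt_iff₀ hl] at h2
    exact (hseg _ ⟨by linarith, by linarith⟩).1 hx
  have hconj : ∀ z ∈ L.lattice, conj z ∈ L.lattice := by
    intro z hz
    have hzS : z₀ + z ∉ S := fun h => hz₀.1 ((hU.add_mem_iff _ _ hz).1 h)
    have hzS' : z₀ + conj z ∉ S := fun h => hzS ((hrefl z).1.2 h)
    have e := (hrefl z).2 hzS
    rw [hU.apply_add _ _ hz] at e
    have e' : Φ (z₀ + conj z) = Φ z₀ := by rw [← hz₀.2, e, star_star]
    have := L.sub_mem_of_toCubic_eq (fun h => hzS' (hU.lattice_subset _ h))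
      (fun h => hz₀.1 (hU.lattice_subset _ h))
      (by rw [← hU.cubicMap_eq _ hzS', ← hU.cubicMap_eq _ hz₀.1, e'])
    rwa [add_sub_cancel_left] at this
  -- Reflection in the line over the oval sends the place 0 to z₀ - conj z₀. Since ∞₁ is real, this
  -- place belongs to ∞₁ again, and such places are lattice points.
  have hsym : z₀ - conj z₀ ∈ L.lattice := by
    have hsS : z₀ - conj z₀ ∈ S := by
      have := (hrefl (-z₀)).1.1 (by simpa using hU.zero_mem)
      simpa [sub_eq_add_neg] using this
    by_contra hs
    have : (𝓝[Sᶜ] (z₀ - conj z₀)).NeBot := neBot_nhdsWithin_compl_of_countable hU.countable _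
    have hto : Tendsto (fun z => z₀ + conj (z - z₀)) (𝓝[Sᶜ] (z₀ - conj z₀)) (𝓝[Sᶜ] 0) := by
      refine tendsto_nhdsWithin_iff.2 ⟨?_, ?_⟩
      · have h1 : Continuous fun z : ℂ => z₀ + conj (z - z₀) :=
          continuous_const.add (Complex.continuous_conj.comp (by fun_prop))
        have := h1.tendsto (z₀ - conj z₀)
        simp only [sub_sub_cancel_left, map_neg, Complex.conj_conj, add_neg_cancel] at this
        exact this.mono_left inf_le_left
      · filter_upwards [self_mem_nhdsWithin] with z hz h
        exact hz (by simpa using (hrefl (z - z₀)).1.2 h)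
    have hΦ : Tendsto Φ (𝓝[Sᶜ] (z₀ - conj z₀)) (nhdsInfinityOne T) := by
      refine ((tendsto_star_nhdsInfinityOne T).comp (hU.tendsto_zero.comp hto)).congr' ?_
      filter_upwards [self_mem_nhdsWithin] with z hz
      have := (hrefl (z - z₀)).2 (by simpa using hz)
      rw [add_sub_cancel] at this
      exact this.symm
    exact (this.map Φ).ne ((hU.disjoint _ hsS hs).eq_bot_of_le hΦ)
  obtain ⟨⟨k, hk, hky⟩, hspan⟩ := exists_eq_of_symmetric hl hm hlm hmm hlmin hmmin hconj
    (fun x hx => hlineS x (hU.lattice_subset _ hx)) hsym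
  set ω : OrientedPeriods := ⟨((l : ℂ), (m : ℂ) * Complex.I), by
    simpa [Complex.mul_im] using mul_pos hl hm⟩ with hω
  have hlat : L.lattice = ω.toPair.lattice := by
    ext z
    rw [ω.mem_lattice_iff]
    constructor
    · intro hz
      obtain ⟨i, j, rfl⟩ := hspan z hz
      exact ⟨(i, j), rfl⟩
    · rintro ⟨i, rfl⟩
      have := L.lattice.add_mem (L.lattice.smul_mem i.1 hlm) (L.lattice.smul_mem i.2 hmm)
      simpa [OrientedPeriods.period, hω] using this
  have hωa : IsCompatible T (gs, gl) ω.toPair a := by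
    refine ⟨?_, fun hT => ?_⟩
    · rw [← hinv]
      exact (congrArg Subtype.val (OrientedPeriods.invariants_eq_of_lattice_eq hlat)).symm
    · rw [← hlat, ← PeriodPair.toCubic_eq_of_lattice_eq hlat]
      exact hLa.torsion hT
  have hpoles : poles T ω.toPair a = S := by
    cases T <;> simp only [S, poles, PeriodPair.slopePoles, hlat]
  refine ⟨ω, hωa.of_rectangular hl rfl hΓ hg hk hky fun x hx => ?_, hint₀, hint₁⟩
  refine hlineS (x - z₀.re) ?_
  rw [hpoles] at hx
  convert hx using 1
  apply Complex.ext <;> simp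

end EllipticFamily
end

theorem theorem8p1 (T : EllipticFamily.DihedralType) (g : ℝ → ℂ × ℂ)
    (hg : EllipticFamily.IsParameterPath T g) (ω₀ ω₁ : ℂ)
    (h₀ : EllipticFamily.IsPeriodGammaZero T g ω₀)
    (h₁ : EllipticFamily.IsPeriodGammaOne T g ω₁) :
    0 < (ω₁ / ω₀).im ∧
    ∃ L : PeriodPair, L.ω₁ = ω₀ ∧ L.ω₂ = ω₁ ∧
      match (generalizing := false) T with
      | .A2 =>
        EllipticFamily.IsInversePair .A2 (g 1) (EllipticFamily.placesAtInfinity .A2 L)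
          (fun z => 1 / 4 * L.weierstrassP z)
          (fun z => 1 / 8 * deriv L.weierstrassP z)
      | .B2 =>
        EllipticFamily.IsInversePair .B2 (g 1) (EllipticFamily.placesAtInfinity .B2 L)
          (fun z => -(1 / 2) * L.weierstrassZeta (ω₀ / 2)
            + 1 / 2 * L.weierstrassZeta z - 1 / 2 * L.weierstrassZeta (z - ω₀ / 2))
          (fun z => -(1 / 4) * L.weierstrassP z + 1 / 4 * L.weierstrassP (z - ω₀ / 2)) ∧
        (g 1).1 = 3 / 2 * L.weierstrassP (ω₀ / 2)
      | .G2 =>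
        EllipticFamily.IsInversePair .G2 (g 1) (EllipticFamily.placesAtInfinity .G2 L)
          (fun z => -(1 / 6) * L.weierstrassZeta (ω₀ / 3) - 1 / 6 * L.weierstrassZeta (2 * ω₀ / 3)
            + 1 / 2 * L.weierstrassZeta z - 1 / 2 * L.weierstrassZeta (z - ω₀ / 3))
          (fun z => 1 / 2 * L.weierstrassZeta (ω₀ / 3) + 1 / 2 * L.weierstrassZeta (2 * ω₀ / 3)
            - 1 / 2 * L.weierstrassZeta z - 1 / 2 * L.weierstrassZeta (z - ω₀ / 3)
            + L.weierstrassZeta (z - 2 * ω₀ / 3)) ∧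
        (g 1).1 = 2 / 3 * L.weierstrassZeta (ω₀ / 3)
          - 1 / 3 * L.weierstrassZeta (2 * ω₀ / 3) := by
  obtain ⟨gs, gl, hΓ, hg0⟩ := hg.base
  obtain ⟨c₀, hc₀, ht₀⟩ := h₀
  obtain ⟨c₁, hc₁, ht₁⟩ := h₁
  have hd := hg.discriminant_ne_zero
  have hd0 := hd 0 (left_mem_Icc.2 zero_le_one)
  have hd1 := hd 1 (right_mem_Icc.2 zero_le_one)
  have hbase : ∃ ω : OrientedPeriods,
      EllipticFamily.IsCompatible T (g 0) ω.toPair (ω.1.1 / EllipticFamily.level T) ∧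
      EllipticFamily.pathIntegral T (g 0) c₀ 0 1 = ω.1.1 ∧
      EllipticFamily.pathIntegral T (g 0) c₁ 0 1 = ω.1.2 := by
    rw [hg0] at hc₀ hc₁ hd0 ⊢
    exact EllipticFamily.exists_isCompatible_of_isTotallyReal hΓ hd0 hc₀ hc₁
  obtain ⟨ω', hω', hp₀, hp₁⟩ := hbase
  -- The path is extended constantly to the whole line, over which the coverings are lifted.
  have hκ : ∀ t ∈ Icc (0 : ℝ) 1, IccExtend zero_le_one ((Icc 0 1).domRestrict g) t = g t :=
    fun t ht => IccExtend_of_mem _ _ ht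
  obtain ⟨ω, hω, hω0, hcomp⟩ := EllipticFamily.exists_isCompatible (T := T)
    (g := IccExtend zero_le_one ((Icc 0 1).domRestrict g))
    (continuousOn_iff_continuous_domRestrict.1 hg.continuousOn).Icc_extend'
    (fun t => hd _ (projIcc (0 : ℝ) 1 zero_le_one t).2)
    (ω₀ := ω') (by rwa [hκ 0 (left_mem_Icc.2 zero_le_one)])
  have hcomp' : ∀ t ∈ Icc (0 : ℝ) 1, EllipticFamily.IsCompatible T (g t) (ω t).toPair
      ((ω t).1.1 / EllipticFamily.level T) := fun t ht => hκ t ht ▸ hcomp t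
  have e₀ : ω₀ = (ω 1).1.1 := by
    have := EllipticFamily.eq_period_of_isTransportedPeriod hg.continuousOn hd hω hcomp'
      hc₀.contDiffOn (k := (1, 0)) (by rw [hp₀, hω0]; simp [OrientedPeriods.period]) ht₀
    simpa [OrientedPeriods.period] using this
  have e₁ : ω₁ = (ω 1).1.2 := by
    have := EllipticFamily.eq_period_of_isTransportedPeriod hg.continuousOn hd hω hcomp'
      hc₁.contDiffOn (k := (0, 1)) (by rw [hp₁, hω0]; simp [OrientedPeriods.period]) ht₁
    simpa [OrientedPeriods.period] using this
  subst e₀ e₁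
  have h1 := hcomp' 1 (right_mem_Icc.2 zero_le_one)
  refine ⟨?_, (ω 1).toPair, rfl, rfl, ?_⟩
  · rw [OrientedPeriods.im_div_eq]
    exact div_pos (ω 1).2 (Complex.normSq_pos.2 (ω 1).fst_ne_zero)
  · cases T
    · exact EllipticFamily.isInversePair_A2 h1 hd1
    · exact EllipticFamily.isInversePair_B2 h1 hd1
    · exact EllipticFamily.isInversePair_G2 h1 hd1
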